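/- **Notation.** Let $\omega\in\mathbb C\setminus[0,\infty)$, take $\arg z\in(-\pi,\pi]$, let $\operatorname{Log}$ be the principal logarithm, put $\sigma:=\operatorname{sgn}(\arg\omega)$, and let $\Omega_\omega:=(-\pi,\arg\omega)$ if $\arg\omega>0$ and $\Omega_\omega:=(\arg\omega,\pi]$ if $\arg\omega<0$. Let $\log(z;\omega):=\operatorname{Log}z$ if $\arg z\in\Omega_\omega$ and $\log(z;\omega):=\operatorname{Log}z-2\pi i\sigma$ otherwise. For $\eta\in\mathbb C$, $z\neq0$ let $$I_\eta(z;\omega):=e^{\eta\log(z/2;\omega)}\sum_{k\ge0}\frac{(z/2)^{2k}}{k!\,\Gamma(\eta+k+1)},\qquad K_\eta(z;\omega):=\frac\pi2\,\frac{I_{-\eta}(z;\omega)-I_\eta(z;\omega)}{\sin(\eta\pi)}\quad(\eta\notin\mathbb Z),$$ and $K_\eta(z;\omega):=\lim_{\xi\to\eta}K_\xi(z;\omega)$ for $\eta\in\mathbb Z$. For $m\in\mathbb N_0$, $\alpha\in\mathbb C\setminus\omega\mathbb R_{\ge0}$, $y>0$, $s\in\mathbb C$ let $$\mathbf I(m,\alpha,y,s):=\frac{y^{1/2}}{i^m}\,\partial_\alpha^m\bigl(I_{s-\frac12}(\alpha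 y;\omega)\bigr),\qquad \mathbf K(m,\alpha,y,s):=\frac{y^{1/2}}{i^m}\,\partial_\alpha^m\bigl(K_{s-\frac12}(\alpha y;\omega)\bigr).$$ The roots are principal: $\frac1{\sqrt z}:=e^{-\frac12\operatorname{Log}z}$ and $\sqrt{\tfrac{\pi}{2\alpha}}:=\sqrt\pi\cdot\frac1{\sqrt{2\alpha}}$. For a right-hand side $t_1+\dots+t_n$, where each $t_j$ is a constant times $y^me^{\alpha y}$ or $y^me^{-\alpha y}$ (products below are expanded into such terms), $f\sim t_1+\dots+t_n$ means: there are functions $\varepsilon_j(y)\to0$ as $y\to\infty$ with $f=\sum_jt_j(1+\varepsilon_j)$ for all large $y$; and, if $\operatorname{Re}\alpha\ne0$, moreover $f/(t_1+\dots+t_n)\to1$. (For $n=1$ it is the usual $f/t_1\to1$, for every $\alpha$.) **Theorem.** Let $s\in\mathbb C$, $\alpha\in\mathbb C\setminus\omega\mathbb R_{\ge0}$, $m\in\mathbb N_0$. As $y\to\infty$: (a) $$\mathbf I(m,\alpha,y,s)\sim\begin{cases}\frac{y^m}{i^m\sqrt{2\pi\alpha}}\bigl(e^{\alpha y}+(-1)^me^{i\pi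 s}e^{-\alpha y}\bigr),&\arg\alpha\in(-\frac\pi2,\pi]\cap\Omega_\omega,\\ \frac{y^m}{i^m\sqrt{2\pi\alpha}}\bigl(e^{\alpha y}+(-1)^me^{-i\pi s}e^{-\alpha y}\bigr),&\arg\alpha\in(-\pi,-\frac\pi2]\cap\Omega_\omega,\\ \frac{y^m}{i^m\sqrt{2\pi\alpha}}e^{-2\pi i(s-\frac12)\sigma}\bigl(e^{\alpha y}+(-1)^me^{i\pi s}e^{-\alpha y}\bigr),&\arg\alpha\in(-\frac\pi2,\pi]\setminus\Omega_\omega,\\ \frac{y^m}{i^m\sqrt{2\pi\alpha}}e^{-2\pi i(s-\frac12)\sigma}\bigl(e^{\alpha y}+(-1)^me^{-i\pi s}e^{-\alpha y}\bigr),&\arg\alpha\in(-\pi,-\frac\pi2]\setminus\Omega_\omega.\end{cases}$$ (b) If $\arg\alpha\in\Omega_\omega$, then $\mathbf K(m,\alpha,y,s)\sim\sqrt{\tfrac\pi{2\alpha}}\;i^m\,y^me^{-\alpha y}$. (c) If $\arg\alpha\in(-\frac\pi2,\pi]\setminus\Omega_\omega$, then $$\mathbf K(m,\alpha,y,s)\sim-e^{-2\pi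 i\sigma s}\sqrt{\tfrac\pi{2\alpha}}\;i^m\,y^me^{-\alpha y}+\frac{\sqrt{2\pi}}{i^{m-1}\sqrt\alpha}\,\sigma\sin(\pi s)\,y^m\bigl(e^{\alpha y}-(-1)^me^{-i\pi s}e^{-\alpha y}\bigr).$$ (d) If $\arg\alpha\in(-\pi,-\frac\pi2]\setminus\Omega_\omega$, then $$\mathbf K(m,\alpha,y,s)\sim-e^{-2\pi i\sigma s}\sqrt{\tfrac\pi{2\alpha}}\;i^m\,y^me^{-\alpha y}+\frac{\sqrt{2\pi}}{i^{m-1}\sqrt\alpha}\,\sigma\sin(\pi s)\,y^m\bigl(e^{\alpha y}-(-1)^me^{i\pi s}e^{-\alpha y}\bigr).$$ (e) If $\arg\alpha\in\Omega_\omega$ (the principal sector) and $\operatorname{Re}\alpha>0$, then $\mathbf I(m,\alpha,y,s)\sim\frac{y^m}{i^m\sqrt{2\pi\alpha}}e^{\alpha y}$, and $|\mathbf K(m,\alpha,y,s)|$ decays exponentially: $|\mathbf K|\asymp y^me^{-y\operatorname{Re}\alpha}$. In every sector, if $\operatorname{Re}\alpha\ne0$, then $|\mathbf I(m,\alpha,y,s)|$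 grows exponentially: $|\mathbf I|\asymp y^me^{y|\operatorname{Re}\alpha|}$. If $\arg\alpha\notin\Omega_\omega$, $\operatorname{Re}\alpha>0$ and $\sin(\pi s)\neq0$, then $\mathbf K$ grows exponentially as well: $|\mathbf K(m,\alpha,y,s)|\asymp y^me^{y\operatorname{Re}\alpha}$. -/

import Mathlib

open Filter Topology Asymptotics

noncomputable section

/-- The set `Ω_ω` of those arguments in `(-π, π]` that lie on the same side of the branch cut
`ω ℝ_{≥0}` as the positive real axis (used for `ω ∉ [0,∞)`, so that `arg ω ≠ 0`). -/
def Omega (ω : ℂ) : Set ℝ :=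
  if 0 < ω.arg then Set.Ioo (-Real.pi) ω.arg else Set.Ioc ω.arg Real.pi

/-- `sgn (arg ω)`, as a complex number. -/
def sgnArg (ω : ℂ) : ℂ := ((Real.sign ω.arg : ℝ) : ℂ)

open Classical in
/-- The complex logarithm `log(z; ω)` with branch cut `ω ℝ_{≥0}` that extends the real
logarithm. -/
def branchLog (ω z : ℂ) : ℂ :=
  if z.arg ∈ Omega ω then Complex.log z
  else Complex.log z - 2 * (Real.pi : ℂ) * Complex.I * sgnArg ω

/-- The modified Bessel function of the first kind `I_η(z; ω)`. Mathlib's `Complex.Gamma` is `0`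
at its poles, so that the inverse below is the entire function `1/Γ`. -/
def besselI (ω η z : ℂ) : ℂ :=
  Complex.exp (η * branchLog ω (z / 2)) *
    ∑' k : ℕ, ((k.factorial : ℂ) * Complex.Gamma (η + (k : ℂ) + 1))⁻¹ * (z / 2) ^ (2 * k)

/-- The quotient that defines `K_η(z; ω)` for non-integral `η`. -/
def besselKNonint (ω η z : ℂ) : ℂ :=
  (Real.pi : ℂ) / 2 *
    ((besselI ω (-η) z - besselI ω η z) / Complex.sin (η * (Real.pi : ℂ)))

open Classical in
/-- The modified Bessel function of the second kind `K_η(z; ω)`; for integral `η` it is the limit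
of `K_ξ(z; ω)` as `ξ → η` through non-integral indices. -/
def besselK (ω η z : ℂ) : ℂ :=
  if ∃ n : ℤ, η = (n : ℂ) then limUnder (𝓝[≠] η) (fun ξ : ℂ => besselKNonint ω ξ z)
  else besselKNonint ω η z

/-- The function `𝐈(m, α, y, s)` (for the branch cut `ω ℝ_{≥0}`). The derivative is the `m`-th
complex derivative of `a ↦ I_{s-1/2}(a y; ω)` at `a = α`. -/
def boldI (ω : ℂ) (m : ℕ) (α : ℂ) (y : ℝ) (s : ℂ) : ℂ :=
  ((Real.sqrt y : ℝ) : ℂ) / Complex.I ^ m *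
    iteratedDeriv m (fun a : ℂ => besselI ω (s - 1 / 2) (a * (y : ℂ))) α

/-- The function `𝐊(m, α, y, s)` (for the branch cut `ω ℝ_{≥0}`). -/
def boldK (ω : ℂ) (m : ℕ) (α : ℂ) (y : ℝ) (s : ℂ) : ℂ :=
  ((Real.sqrt y : ℝ) : ℂ) / Complex.I ^ m *
    iteratedDeriv m (fun a : ℂ => besselK ω (s - 1 / 2) (a * (y : ℂ))) α

/-- `1/√z`, evaluated with respect to the principal logarithm. -/
def invSqrt (z : ℂ) : ℂ := Complex.exp (-(1 / 2) * Complex.log z)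

/-- `f ∼ ∑ⱼ tⱼ` as `y → ∞`, for a sum of exponential terms with exponents `± α`:
every term is correct to leading order, i.e. `f = ∑ⱼ tⱼ (1 + o(1))`, and, if one of the
exponentials dominates (`Re α ≠ 0`), the quotient of `f` and the sum tends to `1`.
(For `Re α = 0` the terms are oscillating and of the same size, and the sum may have arbitrarily
large zeros.) -/
def AsympTerms (α : ℂ) (f : ℝ → ℂ) {n : ℕ} (t : Fin n → ℝ → ℂ) : Prop :=
  (∃ ε : Fin n → ℝ → ℂ, (∀ j, Tendsto (ε j) atTop (𝓝 0)) ∧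
      ∀ᶠ y in atTop, f y = ∑ j, t j y * (1 + ε j y)) ∧
    (α.re ≠ 0 → f ~[atTop] fun y => ∑ j, t j y)

end

/-! Everything rests on two exact formulas. Put `H(η,z) = Γ(η+1/2)⁻¹ ∫₀^∞ e⁻ᵘ u^(η-1/2)
(1+u/(2z))^(η-1/2) du` for Re η > -1/2. A Fubini argument shows that `H` is even in `η`, so it
continues to an entire function of `η`. It is holomorphic in `z` on the slit plane, and it tends to
1 as |z| → ∞ there, uniformly up to both sides of the cut (`tendsto_macdonaldFactor`).

For the principal branches, `K_η(z) = √(π/(2z)) e^{-z} H(η,z)`, and off the real axis `I_η(z) =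
(2πz)^{-1/2} (e^z H(η,-z) + τ i e^{τiπη} e^{-z} H(η,z))`, with τ = 1 in the upper and τ = -1 in the
lower half plane. The second formula comes from Poisson's integral over [-1,1] at z = ix: the
segment is pushed up to i∞, and the two vertical rays left at ±1 give the two exponentials. The
identity theorem in `η` and then in `z` removes the restrictions. The first formula follows from the
second by subtracting `I_η` from `I_{-η}`.

Derivatives in α cost nothing: if `f_y(a) = e^{cay} G_y(a)` with `G_y` holomorphic and locally
uniformly convergent, then `(cy)⁻¹ f_y'` has the same form with the same limit (`ExpAsymp.deriv`).
On the positive real axis the formula for `I` is not available, but the estimate beside the axis is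
uniform and passes to the axis by continuity.

Near a given α the branch with cut ωℝ≥0 is `e^{-ηκ} I_η(±z)` with principal `I`. Hence `K` becomes
`e^{-ηκ} K_η` plus an entire multiple of `I_{-η}`, which covers integral `η` as well
(`besselK_eq_add`). Inserting the asymptotics leaves trigonometric identities between the
coefficients, and the question which term can carry the error. The delicate cases are α on the
negative axis, where α is reflected to -α, and sin(πs) = 0, where `K` remains recessive off the
principal sector. -/

/-! ### Holomorphy of dominated parameter integrals -/

open MeasureTheory in
/-- An integral of holomorphic functions dominated by a fixed integrable function is
holomorphic. -/
theorem differentiableAt_integral_of_dominated {X : Type*} [MeasurableSpace X] {μ : Measure X}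
    {F : ℂ → X → ℂ} {bound : X → ℝ} {x₀ : ℂ} {r : ℝ} (hr : 0 < r)
    (hmeas : ∀ x ∈ Metric.ball x₀ r, AEStronglyMeasurable (F x) μ)
    (hdiff : ∀ᵐ u ∂μ, DifferentiableOn ℂ (fun x => F x u) (Metric.ball x₀ r))
    (hbound : ∀ᵐ u ∂μ, ∀ x ∈ Metric.ball x₀ r, ‖F x u‖ ≤ bound u)
    (hint : Integrable bound μ) :
    DifferentiableAt ℂ (fun x => ∫ u, F x u ∂μ) x₀ := by
  have hx₀ : x₀ ∈ Metric.ball x₀ r := Metric.mem_ball_self hr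
  have hderiv : ∀ᵐ u ∂μ, ∀ x ∈ Metric.ball x₀ (r / 2),
      HasDerivAt (fun x => F x u) (deriv (fun x => F x u) x) x := by
    filter_upwards [hdiff] with u hu x hx
    exact (hu.differentiableAt (Metric.isOpen_ball.mem_nhds
      (Metric.ball_subset_ball (by linarith) hx))).hasDerivAt
  -- The bound on the derivative is Cauchy's estimate on circles of radius r/3: around points of the
  -- ball of radius r/2 they stay in the ball of radius r, where `bound` is valid.
  refine (hasDerivAt_integral_of_dominated_loc_of_deriv_le (μ := μ) (F := F)
    (F' := fun x u => deriv (fun x => F x u) x) (bound := fun u => bound u / (r / 3))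
    (Metric.ball_mem_nhds x₀ (half_pos hr)) ?_ ?_ ?_ ?_ (hint.div_const _) hderiv).2.differentiableAt
  · filter_upwards [Metric.ball_mem_nhds x₀ hr] with x hx using hmeas x hx
  · exact hint.mono' (hmeas x₀ hx₀) (by filter_upwards [hbound] with u hu using hu x₀ hx₀)
  -- Measurability in `u` of the derivative at `x₀`: it is an a.e. limit of difference quotients
  -- along a sequence of increments, each of which is measurable.
  · have hseq : Tendsto (fun n : ℕ => ((r / 2 / ((n : ℝ) + 1) : ℝ) : ℂ)) atTop (𝓝[≠] 0) := by
      refine tendsto_nhdsWithin_iff.2 ⟨?_, Eventually.of_forall fun n => ?_⟩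
      · have h1 : Tendsto (fun n : ℕ => r / 2 / ((n : ℝ) + 1)) atTop (𝓝 0) := by
          have := (tendsto_one_div_add_atTop_nhds_zero_nat (𝕜 := ℝ)).const_mul (r / 2)
          simpa [div_eq_mul_inv] using this
        exact (Complex.continuous_ofReal.tendsto 0).comp h1
      · have : r / 2 / ((n : ℝ) + 1) ≠ 0 := by positivity
        exact Complex.ofReal_ne_zero.2 this
    refine aestronglyMeasurable_of_tendsto_ae atTop
      (f := fun (n : ℕ) u => ((r / 2 / ((n : ℝ) + 1) : ℝ) : ℂ)⁻¹ •
        (F (x₀ + ((r / 2 / ((n : ℝ) + 1) : ℝ) : ℂ)) u - F x₀ u)) (fun n => ?_) ?_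
    · have hmem : x₀ + ((r / 2 / ((n : ℝ) + 1) : ℝ) : ℂ) ∈ Metric.ball x₀ r := ?_
      · exact ((hmeas _ hmem).sub (hmeas _ hx₀)).const_smul (((r / 2 / ((n : ℝ) + 1) : ℝ) : ℂ)⁻¹)
      have h2 : r / 2 / ((n : ℝ) + 1) ≤ r / 2 :=
        div_le_self (by positivity) (by linarith [n.cast_nonneg (α := ℝ)])
      have h3 : 0 < r / 2 / ((n : ℝ) + 1) := by positivity
      rw [Metric.mem_ball, dist_eq_norm, add_sub_cancel_left, Complex.norm_real, Real.norm_eq_abs,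
        abs_of_pos h3]
      linarith
    · filter_upwards [hderiv] with u hu
      exact (hu x₀ (Metric.mem_ball_self (half_pos hr))).tendsto_slope_zero.comp hseq
  · filter_upwards [hdiff, hbound] with u hu hb x hx
    have hsub : Metric.closedBall x (r / 3) ⊆ Metric.ball x₀ r := fun z hz => by
      rw [Metric.mem_ball] at hx ⊢
      rw [Metric.mem_closedBall] at hz
      linarith [dist_triangle z x x₀]
    refine Complex.norm_deriv_le_of_forall_mem_sphere_norm_le (by positivity) ?_ fun z hz =>
      hb z (hsub (Metric.sphere_subset_closedBall hz))
    exact ((hu.mono hsub).diffContOnCl_ball subset_rfl)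

/-! ### The Tricomi integral: domination and holomorphy in both parameters -/

/-- The integrand of the integral representation of Tricomi's confluent hypergeometric function
with parameters `b + 1` and `2 * b + 2`, as a function of `q`, the reciprocal of its argument. -/
noncomputable def tricomiIntegrand (b q : ℂ) (u : ℝ) : ℂ :=
  Complex.exp (-(u : ℂ)) * (u : ℂ) ^ b * (1 + (u : ℂ) * q) ^ b

/-- `∫₀^∞ e⁻ᵘ uᵇ (1 + u q)ᵇ du`. -/
noncomputable def tricomiIntegral (b q : ℂ) : ℂ :=
  ∫ u in Set.Ioi (0 : ℝ), tricomiIntegrand b q u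

theorem norm_cpow_le_rpow_mul_exp {w : ℂ} (hw : w ≠ 0) (b : ℂ) :
    ‖w ^ b‖ ≤ ‖w‖ ^ b.re * Real.exp (Real.pi * |b.im|) := by
  rw [Complex.norm_cpow_of_ne_zero hw, div_eq_mul_inv, ← Real.exp_neg]
  gcongr
  calc -(w.arg * b.im) ≤ |w.arg * b.im| := neg_le_abs _
    _ = |w.arg| * |b.im| := abs_mul _ _
    _ ≤ Real.pi * |b.im| := by gcongr; exact Complex.abs_arg_le_pi w

theorem one_add_mul_mem_slitPlane {q : ℂ} (hq : q ∈ Complex.slitPlane) {u : ℝ} (hu : 0 ≤ u) :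
    1 + (u : ℂ) * q ∈ Complex.slitPlane := by
  rw [Complex.mem_slitPlane_iff] at hq ⊢
  rcases eq_or_lt_of_le hu with rfl | hu
  · simp
  · rcases hq with h | h
    · left
      have : 0 < u * q.re := mul_pos hu h
      simp
      linarith
    · right
      simpa using ⟨hu.ne', h⟩

/-- The segment from `1` to a point of the slit plane stays away from `0`. -/
theorem exists_mul_le_norm_one_add_mul {q : ℂ} (hq : q ∈ Complex.slitPlane) :
    ∃ c > 0, ∀ u : ℝ, 0 ≤ u → c * (1 + u) ≤ ‖1 + (u : ℂ) * q‖ := by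
  have hcomp : IsCompact (segment ℝ (1 : ℂ) q) := by
    rw [segment_eq_image_lineMap]
    exact isCompact_Icc.image (by fun_prop)
  obtain ⟨w, hw, hmin⟩ := hcomp.exists_isMinOn ⟨1, left_mem_segment ℝ _ _⟩
    continuous_norm.continuousOn
  have hw0 : w ≠ 0 := fun h => Complex.zero_notMem_slitPlane
    (h ▸ (Complex.starConvex_one_slitPlane.segment_subset hq hw))
  refine ⟨‖w‖, norm_pos_iff.2 hw0, fun u hu => ?_⟩
  have h1 : (0 : ℝ) < 1 + u := by linarith
  have hmem : (1 / (1 + u)) • (1 : ℂ) + (u / (1 + u)) • q ∈ segment ℝ (1 : ℂ) q :=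
    ⟨_, _, by positivity, by positivity, by field_simp, rfl⟩
  have h2 := isMinOn_iff.1 hmin _ hmem
  have h3 : (1 / (1 + u)) • (1 : ℂ) + (u / (1 + u)) • q
      = ((1 + u)⁻¹ : ℝ) • (1 + (u : ℂ) * q) := by
    simp only [Complex.real_smul]
    push_cast
    ring
  rw [h3, norm_smul, Real.norm_of_nonneg (by positivity)] at h2
  rw [inv_mul_eq_div, le_div_iff₀ h1] at h2
  exact h2

theorem norm_tricomiIntegrand_le {b q : ℂ} {u : ℝ} (hu : 0 < u) (h : 1 + (u : ℂ) * q ≠ 0) :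
    ‖tricomiIntegrand b q u‖ ≤ Real.exp (Real.pi * |b.im|) *
      (Real.exp (-u) * u ^ b.re * ‖1 + (u : ℂ) * q‖ ^ b.re) := by
  rw [tricomiIntegrand, norm_mul, norm_mul, Complex.norm_cpow_eq_rpow_re_of_pos hu,
    Complex.norm_exp, Complex.neg_re, Complex.ofReal_re]
  calc _ ≤ Real.exp (-u) * u ^ b.re * (‖1 + (u : ℂ) * q‖ ^ b.re * Real.exp (Real.pi * |b.im|)) := by
        gcongr
        exact norm_cpow_le_rpow_mul_exp h b
    _ = _ := by ring

theorem continuousOn_tricomiIntegrand {b q : ℂ} (hq : ∀ u : ℝ, 0 < u →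
    1 + (u : ℂ) * q ∈ Complex.slitPlane) :
    ContinuousOn (tricomiIntegrand b q) (Set.Ioi 0) := by
  intro u hu
  have h1 : ContinuousAt (fun u : ℝ => (u : ℂ) ^ b) u :=
    (Complex.continuous_ofReal.continuousAt (x := u)).cpow continuousAt_const
      (Complex.ofReal_mem_slitPlane.2 hu)
  have h2 : ContinuousAt (fun u : ℝ => (1 + (u : ℂ) * q) ^ b) u :=
    ContinuousAt.cpow (by fun_prop) continuousAt_const (hq u hu)
  have h3 : ContinuousAt (fun u : ℝ => Complex.exp (-(u : ℂ))) u := by fun_prop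
  exact ((h3.mul h1).mul h2).continuousWithinAt

/-- The binomial theorem turns the integrand into a finite sum of Gamma integrands with exponents at
least β. -/
theorem integrableOn_exp_neg_mul_rpow_mul_one_add_pow {β : ℝ} (hβ : -1 < β) (N : ℕ) :
    MeasureTheory.IntegrableOn (fun u : ℝ => Real.exp (-u) * u ^ β * (1 + u) ^ N)
      (Set.Ioi 0) := by
  simp_rw [add_pow, one_pow, one_mul, Finset.mul_sum]
  refine MeasureTheory.integrable_finsetSum _ fun k _ => ?_
  have h1 : -1 < β + ((N - k : ℕ) : ℝ) := by
    have : (0 : ℝ) ≤ ((N - k : ℕ) : ℝ) := Nat.cast_nonneg _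
    linarith
  have h2 := (Real.GammaIntegral_convergent (s := β + ((N - k : ℕ) : ℝ) + 1) (by linarith))
  refine MeasureTheory.IntegrableOn.congr_fun (h2.mul_const ((N.choose k : ℕ) : ℝ)) ?_
    measurableSet_Ioi
  intro u hu
  have hu' : (0 : ℝ) < u := hu
  simp only [add_sub_cancel_right]
  rw [Real.rpow_add hu', Real.rpow_natCast]
  ring

/-- Locally uniform domination of the integrand, in both parameters. -/
theorem exists_bound_tricomiIntegrand {b₀ q₀ : ℂ} (hb : -1 < b₀.re) (hq : q₀ ∈ Complex.slitPlane) :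
    ∃ r > 0, ∃ bound : ℝ → ℝ, MeasureTheory.IntegrableOn bound (Set.Ioi 0) ∧
      ∀ b ∈ Metric.ball b₀ r, ∀ q ∈ Metric.ball q₀ r, q ∈ Complex.slitPlane ∧
        ∀ u : ℝ, 0 < u → ‖tricomiIntegrand b q u‖ ≤ bound u := by
  obtain ⟨c₀, hc₀, hlow⟩ := exists_mul_le_norm_one_add_mul hq
  obtain ⟨r₁, hr₁, hsub⟩ := Metric.isOpen_iff.1 Complex.isOpen_slitPlane q₀ hq
  obtain ⟨N, hN⟩ := exists_nat_ge (|b₀.re| + (b₀.re + 1) / 2)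
  obtain ⟨M, hM⟩ := exists_nat_ge (max (2 / c₀) (1 + (‖q₀‖ + c₀ / 2)))
  have hM1 := (le_max_left _ _).trans hM
  have hM2 := (le_max_right _ _).trans hM
  have hM3 : (1 : ℝ) ≤ M := by
    have := norm_nonneg q₀
    linarith
  -- The three constraints keep `q` in the slit plane, cost at most half of the lower bound `c₀ (1 +
  -- u)`, and keep Re b ≥ (Re b₀ - 1)/2, which is still above -1. The last one also makes |Re b| ≤
  -- N.
  set r := min r₁ (min (c₀ / 2) ((b₀.re + 1) / 2)) with hr
  have hrpos : 0 < r := by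
    rw [hr]
    refine lt_min hr₁ (lt_min (by linarith) (by linarith))
  have hra : r ≤ r₁ := min_le_left _ _
  have hrb : r ≤ c₀ / 2 := (min_le_right _ _).trans (min_le_left _ _)
  have hrc : r ≤ (b₀.re + 1) / 2 := (min_le_right _ _).trans (min_le_right _ _)
  refine ⟨r, hrpos, fun u => Real.exp (Real.pi * (|b₀.im| + r)) * ((M : ℝ) ^ N *
    (Real.exp (-u) * u ^ ((b₀.re - 1) / 2) * (1 + u) ^ N +
      Real.exp (-u) * u ^ (N : ℝ) * (1 + u) ^ N)), ?_, ?_⟩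
  · refine MeasureTheory.Integrable.const_mul (MeasureTheory.Integrable.const_mul
      (MeasureTheory.Integrable.add ?_ ?_) _) _
    · exact integrableOn_exp_neg_mul_rpow_mul_one_add_pow (by linarith) N
    · exact integrableOn_exp_neg_mul_rpow_mul_one_add_pow
        (by linarith [N.cast_nonneg (α := ℝ)]) N
  · intro b hbb q hqq
    refine ⟨hsub (Metric.ball_subset_ball hra hqq), fun u hu => ?_⟩
    rw [Metric.mem_ball, dist_eq_norm] at hbb hqq
    have hlo : c₀ / 2 ≤ ‖1 + (u : ℂ) * q‖ := by
      have e : 1 + (u : ℂ) * q = 1 + (u : ℂ) * q₀ + (u : ℂ) * (q - q₀) := by ring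
      have h1 : ‖(u : ℂ) * (q - q₀)‖ ≤ u * (c₀ / 2) := by
        rw [norm_mul, Complex.norm_real, Real.norm_of_nonneg hu.le]
        gcongr
        linarith
      have h2 := norm_sub_le_norm_add (1 + (u : ℂ) * q₀) ((u : ℂ) * (q - q₀))
      rw [← e] at h2
      have h3 := hlow u hu.le
      nlinarith
    have hup : ‖1 + (u : ℂ) * q‖ ≤ M * (1 + u) := by
      have h1 : ‖q‖ ≤ ‖q₀‖ + c₀ / 2 := by
        have := norm_sub_norm_le q q₀
        linarith
      calc ‖1 + (u : ℂ) * q‖ ≤ ‖(1 : ℂ)‖ + ‖(u : ℂ) * q‖ := norm_add_le _ _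
        _ = 1 + u * ‖q‖ := by
            rw [norm_one, norm_mul, Complex.norm_real, Real.norm_of_nonneg hu.le]
        _ ≤ 1 + u * M := by gcongr; linarith
        _ ≤ M * (1 + u) := by nlinarith
    have hre : |b.re - b₀.re| < r := by
      rw [← Complex.sub_re]
      exact (Complex.abs_re_le_norm _).trans_lt hbb
    have him : |b.im| ≤ |b₀.im| + r := by
      have h1 : |b.im - b₀.im| < r := by
        rw [← Complex.sub_im]
        exact (Complex.abs_im_le_norm _).trans_lt hbb
      linarith [abs_sub_abs_le_abs_sub b.im b₀.im]
    have hre1 : (b₀.re - 1) / 2 ≤ b.re := by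
      have := (abs_lt.1 hre).1
      linarith
    have hre2 : |b.re| ≤ N := by
      linarith [abs_sub_abs_le_abs_sub b.re b₀.re]
    have hpos : 0 < ‖1 + (u : ℂ) * q‖ := lt_of_lt_of_le (by linarith) hlo
    have hpow : ‖1 + (u : ℂ) * q‖ ^ b.re ≤ (M : ℝ) ^ N * (1 + u) ^ N := by
      rw [← mul_pow, ← Real.rpow_natCast]
      have hbig : 1 ≤ (M : ℝ) * (1 + u) := by nlinarith
      rcases le_total 0 b.re with h0 | h0
      · calc ‖1 + (u : ℂ) * q‖ ^ b.re ≤ (M * (1 + u)) ^ b.re := by gcongr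
          _ ≤ _ := Real.rpow_le_rpow_of_exponent_le hbig ((le_abs_self _).trans hre2)
      · have hinv : ‖1 + (u : ℂ) * q‖⁻¹ ≤ M * (1 + u) := by
          calc ‖1 + (u : ℂ) * q‖⁻¹ ≤ (c₀ / 2)⁻¹ := by gcongr
            _ = 2 / c₀ := inv_div _ _
            _ ≤ M := hM1
            _ ≤ M * (1 + u) := by nlinarith
        calc ‖1 + (u : ℂ) * q‖ ^ b.re = ‖1 + (u : ℂ) * q‖⁻¹ ^ (-b.re) := by
              rw [Real.inv_rpow hpos.le, Real.rpow_neg hpos.le, inv_inv]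
          _ ≤ (M * (1 + u)) ^ (-b.re) := by
              gcongr
              linarith
          _ ≤ _ := Real.rpow_le_rpow_of_exponent_le hbig ((neg_le_abs _).trans hre2)
    -- The exponent varies with `b`: the smallest one controls u ≤ 1 and the largest one controls u
    -- ≥ 1, so their sum is a bound on the whole half-line.
    have hpow2 : u ^ b.re ≤ u ^ ((b₀.re - 1) / 2) + u ^ (N : ℝ) := by
      have p1 : 0 ≤ u ^ ((b₀.re - 1) / 2) := by positivity
      have p2 : 0 ≤ u ^ (N : ℝ) := by positivity
      rcases le_total u 1 with h1 | h1
      · linarith [Real.rpow_le_rpow_of_exponent_ge hu h1 hre1]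
      · linarith [Real.rpow_le_rpow_of_exponent_le h1 ((le_abs_self _).trans hre2)]
    refine (norm_tricomiIntegrand_le hu (norm_pos_iff.1 hpos)).trans ?_
    calc _ ≤ Real.exp (Real.pi * (|b₀.im| + r)) * (Real.exp (-u) *
          (u ^ ((b₀.re - 1) / 2) + u ^ (N : ℝ)) * ((M : ℝ) ^ N * (1 + u) ^ N)) := by
          gcongr
      _ = _ := by ring

theorem aestronglyMeasurable_tricomiIntegrand {b q : ℂ} (hq : q ∈ Complex.slitPlane) :
    MeasureTheory.AEStronglyMeasurable (tricomiIntegrand b q)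
      (MeasureTheory.volume.restrict (Set.Ioi 0)) :=
  (continuousOn_tricomiIntegrand fun _ hu =>
    one_add_mul_mem_slitPlane hq (le_of_lt hu)).aestronglyMeasurable measurableSet_Ioi

theorem integrableOn_tricomiIntegrand {b q : ℂ} (hb : -1 < b.re) (hq : q ∈ Complex.slitPlane) :
    MeasureTheory.IntegrableOn (tricomiIntegrand b q) (Set.Ioi 0) := by
  obtain ⟨r, hr, bound, hint, h⟩ := exists_bound_tricomiIntegrand hb hq
  refine MeasureTheory.Integrable.mono' hint (aestronglyMeasurable_tricomiIntegrand hq) ?_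
  filter_upwards [MeasureTheory.ae_restrict_mem measurableSet_Ioi] with u hu
  exact (h b (Metric.mem_ball_self hr) q (Metric.mem_ball_self hr)).2 u hu

theorem differentiableAt_tricomiIntegral_left {b q : ℂ} (hb : -1 < b.re)
    (hq : q ∈ Complex.slitPlane) : DifferentiableAt ℂ (fun b => tricomiIntegral b q) b := by
  obtain ⟨r, hr, bound, hint, h⟩ := exists_bound_tricomiIntegrand hb hq
  refine differentiableAt_integral_of_dominated hr
    (fun x _ => aestronglyMeasurable_tricomiIntegrand hq) ?_ ?_ hint
  · filter_upwards [MeasureTheory.ae_restrict_mem measurableSet_Ioi] with u hu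
    have h1 : (u : ℂ) ≠ 0 := Complex.ofReal_ne_zero.2 (ne_of_gt hu)
    have h2 := Complex.slitPlane_ne_zero (one_add_mul_mem_slitPlane hq (le_of_lt hu))
    intro x _
    unfold tricomiIntegrand
    exact (((differentiableAt_id.const_cpow (Or.inl h1)).const_mul _).mul
      (differentiableAt_id.const_cpow (Or.inl h2))).differentiableWithinAt
  · filter_upwards [MeasureTheory.ae_restrict_mem measurableSet_Ioi] with u hu x hx
    exact (h x hx q (Metric.mem_ball_self hr)).2 u hu

theorem differentiableAt_tricomiIntegral_right {b q : ℂ} (hb : -1 < b.re)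
    (hq : q ∈ Complex.slitPlane) : DifferentiableAt ℂ (fun q => tricomiIntegral b q) q := by
  obtain ⟨r, hr, bound, hint, h⟩ := exists_bound_tricomiIntegrand hb hq
  have hs := fun x hx => (h b (Metric.mem_ball_self hr) x hx).1
  refine differentiableAt_integral_of_dominated hr
    (fun x hx => aestronglyMeasurable_tricomiIntegrand (hs x hx)) ?_ ?_ hint
  · filter_upwards [MeasureTheory.ae_restrict_mem measurableSet_Ioi] with u hu
    intro x hx
    have h2 := one_add_mul_mem_slitPlane (hs x hx) (le_of_lt hu)
    have h3 : DifferentiableAt ℂ (fun x : ℂ => (1 + (u : ℂ) * x) ^ b) x :=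
      DifferentiableAt.cpow_const (f := fun x : ℂ => 1 + (u : ℂ) * x) (by fun_prop) h2
    exact (h3.const_mul _).differentiableWithinAt
  · filter_upwards [MeasureTheory.ae_restrict_mem measurableSet_Ioi] with u hu x hx
    exact (h b (Metric.mem_ball_self hr) x hx).2 u hu

/-! ### The limit of the Tricomi integral as q → 0 in the slit plane -/

theorem integrable_exp_neg_abs_mul_abs_rpow {β : ℝ} (hβ : -1 < β) :
    MeasureTheory.Integrable (fun t : ℝ => |t| ^ β * Real.exp (-(1 / 2 * |t|))) := by
  -- `integral_comp_abs` needs no integrability. If the function were not integrable, its integral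
  -- would be 0 by convention, whereas twice the integral over the half-line is a positive Gamma
  -- value.
  by_contra h
  have h1 := integral_comp_abs (f := fun t : ℝ => t ^ β * Real.exp (-(1 / 2 * t)))
  rw [MeasureTheory.integral_undef h] at h1
  have h2 := Real.integral_rpow_mul_exp_neg_mul_Ioi (a := β + 1) (r := 1 / 2) (by linarith)
    (by norm_num)
  rw [add_sub_cancel_right] at h2
  rw [h2] at h1
  have h3 : 0 < Real.Gamma (β + 1) := Real.Gamma_pos_of_pos (by linarith)
  have h4 : (0 : ℝ) < (1 / (1 / 2)) ^ (β + 1) := by positivity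
  nlinarith [mul_pos h4 h3]

theorem tendsto_tricomiIntegrand (b : ℂ) (u : ℝ) :
    Tendsto (fun q => tricomiIntegrand b q u) (𝓝 0)
      (𝓝 (Complex.exp (-(u : ℂ)) * (u : ℂ) ^ b)) := by
  have h : ContinuousAt (fun q : ℂ => tricomiIntegrand b q u) 0 := by
    unfold tricomiIntegrand
    refine continuousAt_const.mul (ContinuousAt.cpow (by fun_prop) continuousAt_const (by simp))
  simpa [ContinuousAt, tricomiIntegrand] using h

theorem integral_exp_neg_mul_cpow (b : ℂ) :
    ∫ u in Set.Ioi (0 : ℝ), Complex.exp (-(u : ℂ)) * (u : ℂ) ^ b = Complex.GammaIntegral (b + 1) := by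
  simp [Complex.GammaIntegral]

theorem Real.rpow_le_two_rpow_abs {x : ℝ} (h1 : 1 / 2 ≤ x) (h2 : x ≤ 2) (β : ℝ) :
    x ^ β ≤ 2 ^ |β| := by
  rcases le_total 0 β with h | h
  · rw [abs_of_nonneg h]
    exact Real.rpow_le_rpow (by linarith) h2 h
  · rw [abs_of_nonpos h, Real.rpow_neg (by norm_num), ← Real.inv_rpow (by norm_num)]
    exact Real.rpow_le_rpow_of_nonpos (by norm_num) (by linarith) h

/-- For `u` small compared with `1 / ‖q‖` the integrand is dominated uniformly in `q`. -/
theorem tendsto_setIntegral_tricomiIntegrand_Iio {b : ℂ} (hb : -1 < b.re) :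
    Tendsto (fun q => ∫ u in Set.Ioi (0 : ℝ),
        (Set.Iio (1 / (2 * ‖q‖))).indicator (tricomiIntegrand b q) u)
      (𝓝[Complex.slitPlane] 0) (𝓝 (Complex.Gamma (b + 1))) := by
  rw [Complex.Gamma_eq_integral (by simp; linarith), ← integral_exp_neg_mul_cpow]
  have hint := (integrableOn_exp_neg_mul_rpow_mul_one_add_pow hb 0).const_mul
    (Real.exp (Real.pi * |b.im|) * 2 ^ |b.re|)
  refine MeasureTheory.tendsto_integral_filter_of_dominated_convergence _ ?_ ?_ hint ?_
  · filter_upwards [self_mem_nhdsWithin] with q hq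
    exact (aestronglyMeasurable_tricomiIntegrand hq).indicator measurableSet_Iio
  · filter_upwards [self_mem_nhdsWithin] with q hq
    filter_upwards [MeasureTheory.ae_restrict_mem measurableSet_Ioi] with u hu
    have hu' : 0 < u := hu
    have hq0 : 0 < ‖q‖ := norm_pos_iff.2 (Complex.slitPlane_ne_zero hq)
    have hnn : 0 ≤ Real.exp (Real.pi * |b.im|) * 2 ^ |b.re| *
        (Real.exp (-u) * u ^ b.re * (1 + u) ^ 0) := by positivity
    by_cases h : u ∈ Set.Iio (1 / (2 * ‖q‖))
    · rw [Set.indicator_of_mem h]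
      have h1 : ‖(u : ℂ) * q‖ ≤ 1 / 2 := by
        rw [norm_mul, Complex.norm_real, Real.norm_of_nonneg hu'.le]
        have h' : u < 1 / (2 * ‖q‖) := h
        rw [lt_div_iff₀ (by positivity)] at h'
        linarith
      have h2 : 1 / 2 ≤ ‖1 + (u : ℂ) * q‖ := by
        have := norm_sub_le_norm_add (1 : ℂ) ((u : ℂ) * q)
        rw [norm_one] at this
        linarith
      have h3 : ‖1 + (u : ℂ) * q‖ ≤ 2 := by
        have := norm_add_le (1 : ℂ) ((u : ℂ) * q)
        rw [norm_one] at this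
        linarith
      refine (norm_tricomiIntegrand_le hu' (norm_pos_iff.1 (by linarith))).trans ?_
      calc _ ≤ Real.exp (Real.pi * |b.im|) * (Real.exp (-u) * u ^ b.re * 2 ^ |b.re|) := by
            gcongr
            exact Real.rpow_le_two_rpow_abs h2 h3 _
        _ = _ := by ring
    · rwa [Set.indicator_of_notMem h, norm_zero]
  · filter_upwards [MeasureTheory.ae_restrict_mem measurableSet_Ioi] with u hu
    have hu' : 0 < u := hu
    refine ((tendsto_tricomiIntegrand b u).mono_left nhdsWithin_le_nhds).congr' ?_
    have hsmall : ∀ᶠ q : ℂ in 𝓝[Complex.slitPlane] 0, ‖q‖ < 1 / (2 * u) :=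
      (continuous_norm.tendsto' (0 : ℂ) 0 norm_zero).mono_left nhdsWithin_le_nhds
        |>.eventually (gt_mem_nhds (by positivity))
    filter_upwards [self_mem_nhdsWithin, hsmall] with q hq hqs
    have hq0 : 0 < ‖q‖ := norm_pos_iff.2 (Complex.slitPlane_ne_zero hq)
    rw [Set.indicator_of_mem]
    rw [Set.mem_Iio, lt_div_iff₀ (by positivity)]
    rw [lt_div_iff₀ (by positivity)] at hqs
    linarith

/-- The part of the integral near the singularity at `u = -1 / q` is exponentially small. -/
theorem norm_setIntegral_tricomiIntegrand_Ici_le {b : ℂ} (hb : -1 < b.re) (hb0 : b.re ≤ 0) :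
    ∃ C : ℝ, ∀ q ∈ Complex.slitPlane, ‖q‖ ≤ 1 →
      ‖∫ u in Set.Ioi (0 : ℝ), (Set.Iio (1 / (2 * ‖q‖)))ᶜ.indicator (tricomiIntegrand b q) u‖ ≤
        C * ((1 / ‖q‖) ^ (b.re + 1) * Real.exp (-(1 / 4) * (1 / ‖q‖))) := by
  set g : ℝ → ℝ := fun t => |t| ^ b.re * Real.exp (-(1 / 2 * |t|)) with hg
  have hgi := integrable_exp_neg_abs_mul_abs_rpow hb
  refine ⟨Real.exp (Real.pi * |b.im|) * (2 ^ (-b.re) * ∫ t, g t), fun q hq hq1 => ?_⟩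
  have hq0 : 0 < ‖q‖ := norm_pos_iff.2 (Complex.slitPlane_ne_zero hq)
  set p := ‖q‖ with hp
  set K := Real.exp (Real.pi * |b.im|) * ((2 * p) ^ (-b.re) * Real.exp (-(1 / 4) * (1 / p))) with hK
  have hgp : MeasureTheory.Integrable (fun u => K * g (u * p - 1)) :=
    ((hgi.comp_sub_right 1).comp_mul_right' hq0.ne').const_mul K
  have hval : ∫ u, K * g (u * p - 1) = Real.exp (Real.pi * |b.im|) * (2 ^ (-b.re) * ∫ t, g t) *
      ((1 / p) ^ (b.re + 1) * Real.exp (-(1 / 4) * (1 / p))) := by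
    rw [MeasureTheory.integral_const_mul,
      MeasureTheory.Measure.integral_comp_mul_right (fun x => g (x - 1)) p,
      MeasureTheory.integral_sub_right_eq_self g 1, abs_of_pos (inv_pos.2 hq0), smul_eq_mul, hK,
      Real.mul_rpow (by norm_num) hq0.le, Real.rpow_neg hq0.le, Real.div_rpow zero_le_one hq0.le,
      Real.rpow_add hq0, Real.rpow_one, Real.one_rpow]
    field_simp
  rw [← hval]
  refine (MeasureTheory.norm_integral_le_of_norm_le (g := fun u => K * g (u * p - 1))
    hgp.integrableOn ?_).trans ?_
  -- The majorant is singular at u = 1/p, and so is the integrand when q is a negative real number;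
  -- this single point is a null set.
  · have hne : ∀ᵐ u : ℝ ∂(MeasureTheory.volume.restrict (Set.Ioi 0)), u ≠ 1 / p :=
      MeasureTheory.ae_restrict_of_ae (MeasureTheory.Measure.ae_ne _ _)
    filter_upwards [MeasureTheory.ae_restrict_mem measurableSet_Ioi, hne] with u hu hune
    have hu' : 0 < u := hu
    by_cases h : u ∈ (Set.Iio (1 / (2 * p)))ᶜ
    · rw [Set.indicator_of_mem h]
      have h' : 1 / (2 * p) ≤ u := not_lt.1 h
      have hup : 1 / 2 ≤ u * p := by
        rw [div_le_iff₀ (by positivity)] at h'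
        linarith
      have hne1 : 0 < |u * p - 1| := by
        rw [abs_pos, sub_ne_zero]
        exact fun h => hune (by field_simp; linarith)
      have hlow : |u * p - 1| ≤ ‖1 + (u : ℂ) * q‖ := by
        have h1 := abs_norm_sub_norm_le ((u : ℂ) * q) (-1)
        rw [norm_neg, norm_one, norm_mul, Complex.norm_real, Real.norm_of_nonneg hu'.le,
          sub_neg_eq_add, add_comm] at h1
        exact h1
      refine (norm_tricomiIntegrand_le hu' (norm_pos_iff.1 (hne1.trans_le hlow))).trans ?_
      simp only [hK, hg]
      rw [mul_assoc (Real.exp (Real.pi * |b.im|))]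
      refine mul_le_mul_of_nonneg_left ?_ (Real.exp_pos _).le
      have e1 : u ^ b.re ≤ (2 * p) ^ (-b.re) := by
        rw [Real.rpow_neg (by positivity), ← Real.inv_rpow (by positivity), ← one_div]
        exact Real.rpow_le_rpow_of_nonpos (by positivity) h' hb0
      have e2 : ‖1 + (u : ℂ) * q‖ ^ b.re ≤ |u * p - 1| ^ b.re :=
        Real.rpow_le_rpow_of_nonpos hne1 hlow hb0
      -- Half of the exponent, with u ≥ 1/(2p), yields the small factor e^{-1/(4p)}; the other half,
      -- with u ≥ up ≥ |up - 1| (here p ≤ 1 enters), makes the majorant integrable in the variable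
      -- up - 1.
      have e3 : Real.exp (-u) ≤ Real.exp (-(1 / 4) * (1 / p)) *
          Real.exp (-(1 / 2 * |u * p - 1|)) := by
        rw [← Real.exp_add]
        gcongr
        have h4 : |u * p - 1| ≤ u * p := abs_le.2 ⟨by linarith, by linarith⟩
        have h5 : u * p ≤ u := by nlinarith
        have h6 : 1 / 4 * (1 / p) = 1 / 2 * (1 / (2 * p)) := by ring
        linarith
      calc _ ≤ (Real.exp (-(1 / 4) * (1 / p)) * Real.exp (-(1 / 2 * |u * p - 1|))) *
            (2 * p) ^ (-b.re) * |u * p - 1| ^ b.re := by gcongr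
        _ = _ := by ring
    · rw [Set.indicator_of_notMem h, norm_zero]
      positivity
  · refine MeasureTheory.setIntegral_le_integral hgp (Eventually.of_forall fun u => ?_)
    simp only [hg, hK, Pi.zero_apply]
    positivity

/-- No sector is excluded: `q` may approach 0 tangentially to the negative axis, where 1 + uq comes
arbitrarily close to 0. For Re b ≥ 0 this is harmless and (1+u)^N dominates; for Re b ≤ 0 the
integral is split at u = 1/(2‖q‖), below which 1 + uq has modulus at least 1/2 and above which the
contribution is exponentially small. -/
theorem tendsto_tricomiIntegral {b : ℂ} (hb : -1 < b.re) :
    Tendsto (tricomiIntegral b) (𝓝[Complex.slitPlane] 0) (𝓝 (Complex.Gamma (b + 1))) := by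
  have hsmall : ∀ᶠ q : ℂ in 𝓝[Complex.slitPlane] 0, ‖q‖ ≤ 1 :=
    ((continuous_norm.tendsto' (0 : ℂ) 0 norm_zero).mono_left nhdsWithin_le_nhds).eventually
      (ge_mem_nhds one_pos)
  rcases le_total b.re 0 with hb0 | hb0
  · obtain ⟨C, hC⟩ := norm_setIntegral_tricomiIntegrand_Ici_le hb hb0
    have hinv : Tendsto (fun q : ℂ => 1 / ‖q‖) (𝓝[Complex.slitPlane] 0) atTop := by
      simp_rw [one_div]
      refine (tendsto_inv_nhdsGT_zero.comp tendsto_norm_nhdsNE_zero).mono_left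
        (nhdsWithin_mono _ fun q hq => Complex.slitPlane_ne_zero hq)
    have htail : Tendsto (fun q => ∫ u in Set.Ioi (0 : ℝ),
        (Set.Iio (1 / (2 * ‖q‖)))ᶜ.indicator (tricomiIntegrand b q) u)
        (𝓝[Complex.slitPlane] 0) (𝓝 0) := by
      have h1 := ((tendsto_rpow_mul_exp_neg_mul_atTop_nhds_zero (b.re + 1) (1 / 4)
        (by norm_num)).comp hinv).const_mul C
      rw [mul_zero] at h1
      refine squeeze_zero_norm' ?_ h1
      filter_upwards [self_mem_nhdsWithin, hsmall] with q hq hq1 using hC q hq hq1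
    have hsum := (tendsto_setIntegral_tricomiIntegrand_Iio hb).add htail
    rw [add_zero] at hsum
    refine hsum.congr' ?_
    filter_upwards [self_mem_nhdsWithin] with q hq
    have hi := integrableOn_tricomiIntegrand hb hq
    rw [← MeasureTheory.integral_add (hi.indicator measurableSet_Iio)
      (hi.indicator measurableSet_Iio.compl), tricomiIntegral]
    simp_rw [Set.indicator_self_add_compl_apply]
  · rw [Complex.Gamma_eq_integral (by simp; linarith), ← integral_exp_neg_mul_cpow]
    obtain ⟨N, hN⟩ := exists_nat_ge b.re
    have hint := (integrableOn_exp_neg_mul_rpow_mul_one_add_pow hb N).const_mul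
      (Real.exp (Real.pi * |b.im|))
    refine MeasureTheory.tendsto_integral_filter_of_dominated_convergence _ ?_ ?_ hint ?_
    · filter_upwards [self_mem_nhdsWithin] with q hq
      exact aestronglyMeasurable_tricomiIntegrand hq
    · filter_upwards [self_mem_nhdsWithin, hsmall] with q hq hq1
      filter_upwards [MeasureTheory.ae_restrict_mem measurableSet_Ioi] with u hu
      have hu' : 0 < u := hu
      refine (norm_tricomiIntegrand_le hu' (Complex.slitPlane_ne_zero
        (one_add_mul_mem_slitPlane hq hu'.le))).trans ?_
      gcongr
      have h1 : ‖1 + (u : ℂ) * q‖ ≤ 1 + u := by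
        refine (norm_add_le _ _).trans ?_
        rw [norm_one, norm_mul, Complex.norm_real, Real.norm_of_nonneg hu'.le]
        nlinarith
      rw [← Real.rpow_natCast]
      exact (Real.rpow_le_rpow (norm_nonneg _) h1 hb0).trans
        (Real.rpow_le_rpow_of_exponent_le (by linarith) hN)
    · exact Eventually.of_forall fun u =>
        (tendsto_tricomiIntegrand b u).mono_left nhdsWithin_le_nhds

/-! ### Identity theorem along a ray, and the symmetry b ↔ -1-b -/

theorem eqOn_of_eq_on_ray {U : Set ℂ} (hU : IsOpen U) (hconn : IsPreconnected U) {f g : ℂ → ℂ}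
    (hf : DifferentiableOn ℂ f U) (hg : DifferentiableOn ℂ g U) {c : ℂ} (hc : c ∈ U) (hc0 : c ≠ 0)
    (h : ∀ x : ℝ, 0 < x → f (x * c) = g (x * c)) : Set.EqOn f g U := by
  refine (hf.analyticOnNhd hU).eqOn_of_preconnected_of_frequently_eq (hg.analyticOnNhd hU) hconn hc ?_
  have h1 : Tendsto (fun x : ℝ => (x : ℂ) * c) (𝓝[>] 1) (𝓝[≠] c) := by
    refine tendsto_nhdsWithin_iff.2 ⟨?_, ?_⟩
    · have : Continuous fun x : ℝ => (x : ℂ) * c := by fun_prop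
      exact (this.tendsto' 1 c (by simp)).mono_left nhdsWithin_le_nhds
    · filter_upwards [self_mem_nhdsWithin] with x hx
      have hx1 : (1 : ℝ) < x := hx
      intro h2
      have h3 : ((x : ℂ) - 1) * c = 0 := by
        rw [sub_mul, one_mul, sub_eq_zero]
        exact h2
      rcases mul_eq_zero.1 h3 with h4 | h4
      · rw [sub_eq_zero] at h4
        exact hx1.ne' (by exact_mod_cast h4)
      · exact hc0 h4
  refine h1.frequently (Eventually.frequently ?_)
  filter_upwards [self_mem_nhdsWithin] with x hx
  exact h x (zero_lt_one.trans hx)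

theorem isPreconnected_slitPlane : IsPreconnected Complex.slitPlane :=
  (Complex.starConvex_one_slitPlane.isPathConnected
    Complex.one_mem_slitPlane).isConnected.isPreconnected

theorem integral_exp_mul_cpow_eq (b : ℂ) (hb : b.re < 0) {q : ℝ} (hq : 0 < q) {u : ℝ}
    (hu : 0 < u) :
    ∫ v in Set.Ioi (0 : ℝ), Complex.exp (-(u : ℂ)) * (u : ℂ) ^ b *
      ((v : ℂ) ^ (-1 - b) * Complex.exp (-((1 + u * q : ℝ) * v))) =
    tricomiIntegrand b q u * Complex.Gamma (-b) := by
  have hr : 0 < 1 + u * q := by positivity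
  rw [MeasureTheory.integral_const_mul, tricomiIntegrand]
  have h := Complex.integral_cpow_mul_exp_neg_mul_Ioi (a := -b) (r := 1 + u * q)
    (by simpa using hb) hr
  rw [show -b - 1 = -1 - b by ring] at h
  rw [h, one_div, Complex.inv_cpow _ _ (by
    rw [Complex.arg_ofReal_of_nonneg hr.le]; exact Real.pi_pos.ne), Complex.cpow_neg, inv_inv]
  push_cast
  ring

/-- Since uqv > 0, the product of two Gamma integrands with exponents Re b and -1 - Re b is a
majorant. Both exponents exceed -1 exactly in the strip -1 < Re b < 0. -/
theorem integrable_exp_mul_cpow_mul_cpow {b : ℂ} (hb : -1 < b.re) (hb0 : b.re < 0) {q : ℝ}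
    (hq : 0 < q) :
    MeasureTheory.Integrable (Function.uncurry fun u v : ℝ => Complex.exp (-(u : ℂ)) * (u : ℂ) ^ b *
      ((v : ℂ) ^ (-1 - b) * Complex.exp (-((1 + u * q : ℝ) * v))))
      ((MeasureTheory.volume.restrict (Set.Ioi 0)).prod
        (MeasureTheory.volume.restrict (Set.Ioi 0))) := by
  have h1 := (integrableOn_exp_neg_mul_rpow_mul_one_add_pow hb 0)
  have h2 := (integrableOn_exp_neg_mul_rpow_mul_one_add_pow (β := -1 - b.re) (by linarith) 0)
  refine (MeasureTheory.Integrable.mul_prod h1 h2).mono' ?_ ?_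
  · rw [MeasureTheory.Measure.prod_restrict]
    refine ContinuousOn.aestronglyMeasurable ?_ (measurableSet_Ioi.prod measurableSet_Ioi)
    rintro ⟨u, v⟩ ⟨hu, hv⟩
    have c1 : ContinuousAt (fun p : ℝ × ℝ => (p.1 : ℂ) ^ b) (u, v) :=
      ContinuousAt.cpow (f := fun p : ℝ × ℝ => (p.1 : ℂ)) (by fun_prop) continuousAt_const
        (Complex.ofReal_mem_slitPlane.2 hu)
    have c2 : ContinuousAt (fun p : ℝ × ℝ => (p.2 : ℂ) ^ (-1 - b)) (u, v) :=
      ContinuousAt.cpow (f := fun p : ℝ × ℝ => (p.2 : ℂ)) (by fun_prop) continuousAt_const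
        (Complex.ofReal_mem_slitPlane.2 hv)
    have c3 : ContinuousAt (fun p : ℝ × ℝ => Complex.exp (-(p.1 : ℂ))) (u, v) := by fun_prop
    have c4 : ContinuousAt (fun p : ℝ × ℝ => Complex.exp (-((1 + p.1 * q : ℝ) * p.2))) (u, v) := by
      fun_prop
    exact ((c3.mul c1).mul (c2.mul c4)).continuousWithinAt
  · rw [MeasureTheory.Measure.prod_restrict]
    filter_upwards [MeasureTheory.ae_restrict_mem (measurableSet_Ioi.prod measurableSet_Ioi)]
      with p hp
    obtain ⟨hu, hv⟩ := hp
    have hu' : 0 < p.1 := hu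
    have hv' : 0 < p.2 := hv
    simp only [Function.uncurry, norm_mul, Complex.norm_cpow_eq_rpow_re_of_pos hu',
      Complex.norm_cpow_eq_rpow_re_of_pos hv', Complex.norm_exp, pow_zero, mul_one,
      Complex.sub_re, Complex.neg_re, Complex.one_re, Complex.ofReal_re, Complex.re_ofReal_mul]
    rw [mul_comm (p.2 ^ _) (Real.exp _)]
    gcongr
    have : 0 < p.1 * q := by positivity
    nlinarith

/-- The total exponent -(u + v + quv) of the double integral is symmetric in u and v, and exchanging
the variables exchanges the powers b and -1-b. Integrating out either variable first leaves a Gamma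
factor times one of the two Tricomi integrals. -/
theorem tricomiIntegral_symm_of_pos {b : ℂ} (hb : -1 < b.re) (hb0 : b.re < 0) {q : ℝ}
    (hq : 0 < q) : tricomiIntegral b q * Complex.Gamma (-b) =
      tricomiIntegral (-1 - b) q * Complex.Gamma (b + 1) := by
  have h1 := MeasureTheory.integral_integral_swap (integrable_exp_mul_cpow_mul_cpow hb hb0 hq)
  have e1 : ∫ u in Set.Ioi (0 : ℝ), ∫ v in Set.Ioi (0 : ℝ), Complex.exp (-(u : ℂ)) * (u : ℂ) ^ b *
      ((v : ℂ) ^ (-1 - b) * Complex.exp (-((1 + u * q : ℝ) * v))) =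
      tricomiIntegral b q * Complex.Gamma (-b) := by
    rw [tricomiIntegral, ← MeasureTheory.integral_mul_const]
    exact MeasureTheory.setIntegral_congr_fun measurableSet_Ioi fun u hu =>
      integral_exp_mul_cpow_eq b hb0 hq hu
  have e2 : ∫ v in Set.Ioi (0 : ℝ), ∫ u in Set.Ioi (0 : ℝ), Complex.exp (-(u : ℂ)) * (u : ℂ) ^ b *
      ((v : ℂ) ^ (-1 - b) * Complex.exp (-((1 + u * q : ℝ) * v))) =
      tricomiIntegral (-1 - b) q * Complex.Gamma (b + 1) := by
    rw [tricomiIntegral, ← MeasureTheory.integral_mul_const]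
    refine MeasureTheory.setIntegral_congr_fun measurableSet_Ioi fun v hv => ?_
    have h2 := integral_exp_mul_cpow_eq (-1 - b) (by simp; linarith) hq hv
    rw [show -1 - (-1 - b) = b by ring, show -(-1 - b) = b + 1 by ring] at h2
    refine Eq.trans (MeasureTheory.integral_congr_ae (Eventually.of_forall fun u => ?_)) h2
    simp only
    have : Complex.exp (-(u : ℂ)) * Complex.exp (-((1 + u * q : ℝ) * v)) =
        Complex.exp (-(v : ℂ)) * Complex.exp (-((1 + v * q : ℝ) * u)) := by
      rw [← Complex.exp_add, ← Complex.exp_add]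
      congr 1
      push_cast
      ring
    linear_combination ((u : ℂ) ^ b * (v : ℂ) ^ (-1 - b)) * this
  rw [← e1, ← e2]
  exact h1

theorem tricomiIntegral_symm {b : ℂ} (hb : -1 < b.re) (hb0 : b.re < 0) {q : ℂ}
    (hq : q ∈ Complex.slitPlane) : tricomiIntegral b q * Complex.Gamma (-b) =
      tricomiIntegral (-1 - b) q * Complex.Gamma (b + 1) := by
  refine eqOn_of_eq_on_ray (f := fun q => tricomiIntegral b q * Complex.Gamma (-b))
    (g := fun q => tricomiIntegral (-1 - b) q * Complex.Gamma (b + 1)) Complex.isOpen_slitPlane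
    isPreconnected_slitPlane (fun q hq => ?_) (fun q hq => ?_) Complex.one_mem_slitPlane one_ne_zero
    (fun x hx => ?_) hq
  · exact ((differentiableAt_tricomiIntegral_right hb hq).mul_const _).differentiableWithinAt
  · exact ((differentiableAt_tricomiIntegral_right (by simp; linarith) hq).mul_const
      _).differentiableWithinAt
  · simpa using tricomiIntegral_symm_of_pos hb hb0 hx

/-! ### The factor H(η, z): evenness, holomorphy, limit at infinity -/

/-- For `Re η > -1/2`, the factor `H` in `K_η(z) = √(π / (2z)) e^{-z} H(η, z)`. -/
noncomputable def macdonaldFactorRight (η z : ℂ) : ℂ :=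
  (Complex.Gamma (η + 1 / 2))⁻¹ * tricomiIntegral (η - 1 / 2) (2 * z)⁻¹

/-- The factor `H` in `K_η(z) = √(π / (2z)) e^{-z} H(η, z)`; it is even in `η`. -/
noncomputable def macdonaldFactor (η z : ℂ) : ℂ :=
  if 0 ≤ η.re then macdonaldFactorRight η z else macdonaldFactorRight (-η) z

theorem inv_two_mul_mem_slitPlane {z : ℂ} (hz : z ∈ Complex.slitPlane) :
    (2 * z)⁻¹ ∈ Complex.slitPlane := by
  have h : (2 * z) ∈ Complex.slitPlane := by
    rw [Complex.mem_slitPlane_iff] at hz ⊢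
    simpa using hz
  have h0 := Complex.slitPlane_ne_zero h
  rw [Complex.mem_slitPlane_iff] at h ⊢
  have h1 : 0 < Complex.normSq (2 * z) := Complex.normSq_pos.2 h0
  rw [Complex.inv_re, Complex.inv_im]
  rcases h with h | h
  · exact Or.inl (by positivity)
  · exact Or.inr (div_ne_zero (neg_ne_zero.2 h) h1.ne')

/-- This is the symmetry b ↔ -1-b at b = η - 1/2. It makes the two cases in the definition of
`macdonaldFactor` agree on the strip |Re η| < 1/2, so that they glue to an even function. -/
theorem macdonaldFactorRight_neg {η z : ℂ} (h1 : -(1 / 2) < η.re) (h2 : η.re < 1 / 2)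
    (hz : z ∈ Complex.slitPlane) : macdonaldFactorRight (-η) z = macdonaldFactorRight η z := by
  have h := tricomiIntegral_symm (b := η - 1 / 2) (q := (2 * z)⁻¹) (by simp; linarith)
    (by simp; linarith) (inv_two_mul_mem_slitPlane hz)
  rw [show -(η - 1 / 2) = -η + 1 / 2 by ring, show -1 - (η - 1 / 2) = -η - 1 / 2 by ring,
    show η - 1 / 2 + 1 = η + 1 / 2 by ring] at h
  have g1 : Complex.Gamma (-η + 1 / 2) ≠ 0 := Complex.Gamma_ne_zero_of_re_pos (by simp; linarith)
  have g2 : Complex.Gamma (η + 1 / 2) ≠ 0 := Complex.Gamma_ne_zero_of_re_pos (by simp; linarith)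
  rw [macdonaldFactorRight, macdonaldFactorRight]
  rw [inv_mul_eq_div, inv_mul_eq_div, div_eq_div_iff g1 g2]
  linear_combination -h

theorem macdonaldFactor_eq_right {η z : ℂ} (h : -(1 / 2) < η.re) (hz : z ∈ Complex.slitPlane) :
    macdonaldFactor η z = macdonaldFactorRight η z := by
  rw [macdonaldFactor]
  split_ifs with h0
  · rfl
  · exact macdonaldFactorRight_neg h (by linarith) hz

theorem macdonaldFactor_neg (η : ℂ) {z : ℂ} (hz : z ∈ Complex.slitPlane) :
    macdonaldFactor (-η) z = macdonaldFactor η z := by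
  rcases lt_trichotomy η.re 0 with h | h | h
  · rw [macdonaldFactor, macdonaldFactor, if_pos (by simpa using h.le), if_neg (by linarith)]
  · rw [macdonaldFactor, macdonaldFactor, if_pos (by simp [h]), if_pos h.ge]
    exact macdonaldFactorRight_neg (by linarith) (by linarith) hz
  · rw [macdonaldFactor, macdonaldFactor, if_neg (by simpa using h), if_pos h.le, neg_neg]

theorem differentiableAt_macdonaldFactorRight_left {η z : ℂ} (h : -(1 / 2) < η.re)
    (hz : z ∈ Complex.slitPlane) :
    DifferentiableAt ℂ (fun η => macdonaldFactorRight η z) η := by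
  unfold macdonaldFactorRight
  refine DifferentiableAt.mul ?_ ?_
  · exact DifferentiableAt.comp η (f := fun η : ℂ => η + 1 / 2)
      Complex.differentiable_one_div_Gamma.differentiableAt (by fun_prop)
  · exact DifferentiableAt.comp η (f := fun η : ℂ => η - 1 / 2)
      (g := fun b => tricomiIntegral b (2 * z)⁻¹)
      (differentiableAt_tricomiIntegral_left (by simp; linarith) (inv_two_mul_mem_slitPlane hz))
      (by fun_prop)

/-- On Re η > -1/2 the function is a single holomorphic expression, despite the case distinction at
Re η = 0. Evenness carries this to Re η < 1/2, and the two half planes cover everything. -/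
theorem differentiable_macdonaldFactor_left {z : ℂ} (hz : z ∈ Complex.slitPlane) :
    Differentiable ℂ fun η => macdonaldFactor η z := by
  have key : ∀ η : ℂ, -(1 / 2) < η.re → DifferentiableAt ℂ (fun η => macdonaldFactor η z) η := by
    intro η hη
    refine (differentiableAt_macdonaldFactorRight_left hη hz).congr_of_eventuallyEq ?_
    filter_upwards [(isOpen_lt continuous_const Complex.continuous_re).mem_nhds hη] with ξ hξ
    exact macdonaldFactor_eq_right hξ hz
  intro η
  rcases lt_or_ge (-(1 / 2)) η.re with h | h
  · exact key η h
  · have h1 : DifferentiableAt ℂ (fun η => macdonaldFactor (-η) z) η :=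
      DifferentiableAt.comp η (f := fun η : ℂ => -η) (g := fun η => macdonaldFactor η z)
        (key (-η) (by simp; linarith)) (by fun_prop)
    simpa only [macdonaldFactor_neg _ hz] using h1

theorem differentiableAt_macdonaldFactorRight_right {η z : ℂ} (h : -(1 / 2) < η.re)
    (hz : z ∈ Complex.slitPlane) :
    DifferentiableAt ℂ (fun z => macdonaldFactorRight η z) z := by
  unfold macdonaldFactorRight
  refine DifferentiableAt.const_mul ?_ _
  refine DifferentiableAt.comp z (f := fun z : ℂ => (2 * z)⁻¹)
    (g := fun q => tricomiIntegral (η - 1 / 2) q)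
    (differentiableAt_tricomiIntegral_right (by simp; linarith) (inv_two_mul_mem_slitPlane hz)) ?_
  exact DifferentiableAt.inv (by fun_prop) (mul_ne_zero two_ne_zero (Complex.slitPlane_ne_zero hz))

theorem differentiableOn_macdonaldFactor_right (η : ℂ) :
    DifferentiableOn ℂ (fun z => macdonaldFactor η z) Complex.slitPlane := by
  intro z hz
  unfold macdonaldFactor
  split_ifs with h
  · exact (differentiableAt_macdonaldFactorRight_right (by linarith) hz).differentiableWithinAt
  · exact (differentiableAt_macdonaldFactorRight_right (by simp; linarith)
      hz).differentiableWithinAt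

theorem tendsto_macdonaldFactorRight {η : ℂ} (h : -(1 / 2) < η.re) :
    Tendsto (macdonaldFactorRight η) (Filter.comap norm atTop ⊓ 𝓟 Complex.slitPlane) (𝓝 1) := by
  have h1 : Tendsto (fun z : ℂ => (2 * z)⁻¹) (Filter.comap norm atTop ⊓ 𝓟 Complex.slitPlane)
      (𝓝[Complex.slitPlane] 0) := by
    refine tendsto_inf.2 ⟨?_, ?_⟩
    · refine Tendsto.mono_left ?_ inf_le_left
      rw [tendsto_zero_iff_norm_tendsto_zero]
      have : Tendsto (fun z : ℂ => ‖z‖) (Filter.comap norm atTop) atTop := tendsto_comap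
      refine (tendsto_inv_atTop_zero.comp (this.const_mul_atTop (two_pos (α := ℝ)))).congr
        fun z => ?_
      simp
    · exact tendsto_principal.2 (mem_inf_of_right fun z hz => inv_two_mul_mem_slitPlane hz)
  have h2 := ((tendsto_tricomiIntegral (b := η - 1 / 2) (by simp; linarith)).comp h1).const_mul
    (Complex.Gamma (η + 1 / 2))⁻¹
  rw [show η - 1 / 2 + 1 = η + 1 / 2 by ring, inv_mul_cancel₀
    (Complex.Gamma_ne_zero_of_re_pos (by simp; linarith))] at h2
  exact h2

theorem tendsto_macdonaldFactor (η : ℂ) :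
    Tendsto (macdonaldFactor η) (Filter.comap norm atTop ⊓ 𝓟 Complex.slitPlane) (𝓝 1) := by
  rcases le_or_gt 0 η.re with h | h
  · refine (tendsto_macdonaldFactorRight (η := η) (by linarith)).congr fun z => ?_
    rw [macdonaldFactor, if_pos h]
  · refine (tendsto_macdonaldFactorRight (η := -η) (by simp; linarith)).congr fun z => ?_
    rw [macdonaldFactor, if_neg (by linarith)]

/-! ### The power series and the principal branch of I -/

/-- The entire factor `∑ (z/2)^{2k} / (k! Γ(η+k+1))` of the modified Bessel function `I_η(z)`. -/
noncomputable def besselSeries (η z : ℂ) : ℂ :=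
  ∑' k : ℕ, ((k.factorial : ℂ) * Complex.Gamma (η + (k : ℂ) + 1))⁻¹ * (z / 2) ^ (2 * k)

theorem exists_norm_inv_Gamma_add_nat_le (R : ℝ) :
    ∃ M : ℝ, ∀ k : ℕ, ∀ η : ℂ, ‖η‖ ≤ R → ‖(Complex.Gamma (η + (k : ℂ) + 1))⁻¹‖ ≤ M := by
  have hcont : ∀ k : ℕ, ∃ M : ℝ, ∀ η : ℂ, ‖η‖ ≤ R →
      ‖(Complex.Gamma (η + (k : ℂ) + 1))⁻¹‖ ≤ M := by
    intro k
    have hc : Continuous fun η : ℂ => (Complex.Gamma (η + (k : ℂ) + 1))⁻¹ :=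
      Complex.differentiable_one_div_Gamma.continuous.comp
        (by fun_prop : Continuous fun η : ℂ => η + (k : ℂ) + 1)
    obtain ⟨M, hM⟩ := (isCompact_closedBall (0 : ℂ) R).exists_bound_of_continuousOn hc.continuousOn
    exact ⟨M, fun η hη => hM η (by simpa using hη)⟩
  have hfin : ∀ N : ℕ, ∃ M : ℝ, ∀ k ≤ N, ∀ η : ℂ, ‖η‖ ≤ R →
      ‖(Complex.Gamma (η + (k : ℂ) + 1))⁻¹‖ ≤ M := by
    intro N
    choose M hM using hcont
    refine ⟨∑ k ∈ Finset.range (N + 1), |M k|, fun k hk η hη => (hM k η hη).trans ?_⟩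
    refine (le_abs_self _).trans (Finset.single_le_sum (f := fun k => |M k|)
      (fun _ _ => abs_nonneg _) (Finset.mem_range.2 (by omega)))
  obtain ⟨N, hN⟩ := exists_nat_ge (R + 1)
  obtain ⟨M, hM⟩ := hfin N
  refine ⟨M, fun k => ?_⟩
  rcases le_total k N with hk | hk
  · exact hM k hk
  -- From `N ≥ R + 1` on, the recurrence 1/Γ(w+1) = w⁻¹ · 1/Γ(w) has |w| ≥ 1 throughout ‖η‖ ≤ R, so
  -- the suprema no longer increase; the finitely many earlier indices are bounded by compactness.
  · induction k, hk using Nat.le_induction with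
    | base => exact hM N le_rfl
    | succ k hk ih =>
      intro η hη
      have hkR : R + 1 ≤ (k : ℝ) := hN.trans (by exact_mod_cast hk)
      have h1 : 1 ≤ ‖η + (k : ℂ) + 1‖ := by
        have h2 := norm_sub_norm_le ((k + 1 : ℕ) : ℂ) (-η)
        rw [norm_neg, Complex.norm_natCast, sub_neg_eq_add] at h2
        push_cast at h2
        rw [show η + (k : ℂ) + 1 = (k : ℂ) + 1 + η by ring]
        linarith
      have h0 : η + (k : ℂ) + 1 ≠ 0 := norm_pos_iff.1 (by linarith)
      have h3 : η + ((k + 1 : ℕ) : ℂ) + 1 = (η + (k : ℂ) + 1) + 1 := by push_cast; ring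
      rw [h3, Complex.Gamma_add_one _ h0, mul_inv, norm_mul, norm_inv]
      calc _ ≤ 1 * ‖(Complex.Gamma (η + (k : ℂ) + 1))⁻¹‖ := by
            gcongr
            exact inv_le_one_of_one_le₀ h1
        _ ≤ M := by rw [one_mul]; exact ih η hη

theorem exists_summable_bound_besselSeries (R : ℝ) :
    ∃ v : ℕ → ℝ, Summable v ∧ ∀ k : ℕ, ∀ η z : ℂ, ‖η‖ ≤ R → ‖z‖ ≤ R →
      ‖((k.factorial : ℂ) * Complex.Gamma (η + (k : ℂ) + 1))⁻¹ * (z / 2) ^ (2 * k)‖ ≤ v k := by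
  obtain ⟨M, hM⟩ := exists_norm_inv_Gamma_add_nat_le R
  refine ⟨fun k => M * (((R / 2) ^ 2) ^ k / k.factorial),
    (Real.summable_pow_div_factorial _).mul_left M, fun k η z hη hz => ?_⟩
  have h1 : ‖(z / 2) ^ (2 * k)‖ ≤ ((R / 2) ^ 2) ^ k := by
    rw [norm_pow, ← pow_mul]
    gcongr
    rw [norm_div, Complex.norm_ofNat]
    gcongr
  rw [norm_mul, mul_inv, norm_mul, norm_inv (k.factorial : ℂ), Complex.norm_natCast]
  have hM0 : 0 ≤ M := (norm_nonneg _).trans (hM k η hη)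
  calc _ ≤ (k.factorial : ℝ)⁻¹ * M * ((R / 2) ^ 2) ^ k := by
        gcongr
        exact hM k η hη
    _ = _ := by ring

theorem differentiable_besselSeries_left (z : ℂ) : Differentiable ℂ fun η => besselSeries η z := by
  intro η
  set R := max (‖η‖ + 1) ‖z‖
  obtain ⟨v, hv, hb⟩ := exists_summable_bound_besselSeries R
  have h := Complex.differentiableOn_tsum_of_summable_norm (U := Metric.ball 0 (‖η‖ + 1))
    (F := fun (k : ℕ) (η : ℂ) =>
      ((k.factorial : ℂ) * Complex.Gamma (η + (k : ℂ) + 1))⁻¹ * (z / 2) ^ (2 * k)) hv (fun k => ?_)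
    Metric.isOpen_ball (fun k w hw => hb k w z ?_ (le_max_right _ _))
  · exact h.differentiableAt (Metric.isOpen_ball.mem_nhds (by simp))
  · refine Differentiable.differentiableOn ?_
    simp_rw [mul_inv]
    refine (Differentiable.const_mul ?_ _).mul_const _
    exact Complex.differentiable_one_div_Gamma.comp
      (by fun_prop : Differentiable ℂ fun η : ℂ => η + (k : ℂ) + 1)
  · rw [mem_ball_zero_iff] at hw
    exact hw.le.trans (le_max_left _ _)

theorem differentiable_besselSeries_right (η : ℂ) : Differentiable ℂ fun z => besselSeries η z := by
  intro z
  set R := max (‖z‖ + 1) ‖η‖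
  obtain ⟨v, hv, hb⟩ := exists_summable_bound_besselSeries R
  have h := Complex.differentiableOn_tsum_of_summable_norm (U := Metric.ball 0 (‖z‖ + 1))
    (F := fun (k : ℕ) (z : ℂ) =>
      ((k.factorial : ℂ) * Complex.Gamma (η + (k : ℂ) + 1))⁻¹ * (z / 2) ^ (2 * k)) hv
    (fun k => by fun_prop)
    Metric.isOpen_ball (fun k w hw => hb k η w (le_max_right _ _) ?_)
  · exact h.differentiableAt (Metric.isOpen_ball.mem_nhds (by simp))
  · rw [mem_ball_zero_iff] at hw
    exact hw.le.trans (le_max_left _ _)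

theorem besselSeries_neg (η z : ℂ) : besselSeries η (-z) = besselSeries η z := by
  unfold besselSeries
  congr 1
  ext k
  rw [neg_div, Even.neg_pow (by simp)]

/-- The principal branch of the modified Bessel function `I_η(z)`. -/
noncomputable def principalBesselI (η z : ℂ) : ℂ :=
  Complex.exp (η * Complex.log (z / 2)) * besselSeries η z

theorem div_two_mem_slitPlane {z : ℂ} (hz : z ∈ Complex.slitPlane) :
    z / 2 ∈ Complex.slitPlane := by
  rw [Complex.mem_slitPlane_iff] at hz ⊢
  simpa using hz

theorem differentiableOn_principalBesselI_right (η : ℂ) :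
    DifferentiableOn ℂ (fun z => principalBesselI η z) Complex.slitPlane := by
  intro z hz
  refine DifferentiableAt.differentiableWithinAt (DifferentiableAt.mul ?_
    (differentiable_besselSeries_right η z))
  exact ((DifferentiableAt.clog (f := fun z : ℂ => z / 2)
    (differentiableAt_id.div_const 2) (div_two_mem_slitPlane hz)).const_mul η).cexp

theorem differentiable_principalBesselI_left (z : ℂ) :
    Differentiable ℂ fun η => principalBesselI η z := by
  refine Differentiable.mul ?_ (differentiable_besselSeries_left z)
  fun_prop

/-! ### Poisson's integral for I -/

theorem integral_pow_mul_one_sub_sq_cpow (b : ℂ) (k : ℕ) :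
    ∫ t in (0 : ℝ)..1, 2 * ((t : ℂ) ^ (2 * k) * (1 - (t : ℂ) ^ 2) ^ b) =
      Complex.betaIntegral ((k : ℂ) + 1 / 2) (b + 1) := by
  -- The substitution x = t² in the Beta integral, cut off to (0,1] by an indicator since the change
  -- of variables is stated on the half-line.
  have h := MeasureTheory.integral_comp_rpow_Ioi (fun y : ℝ => (Set.Ioc (0 : ℝ) 1).indicator
    (fun x : ℝ => (x : ℂ) ^ ((k : ℂ) + 1 / 2 - 1) * (1 - (x : ℂ)) ^ (b + 1 - 1)) y)
    (p := 2) two_ne_zero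
  rw [Complex.betaIntegral, intervalIntegral.integral_of_le zero_le_one,
    intervalIntegral.integral_of_le zero_le_one,
    ← MeasureTheory.integral_indicator measurableSet_Ioc,
    ← MeasureTheory.integral_indicator measurableSet_Ioc]
  rw [← MeasureTheory.integral_indicator measurableSet_Ioi,
    ← MeasureTheory.integral_indicator measurableSet_Ioi] at h
  refine Eq.trans ?_ (h.trans ?_)
  · congr 1
    ext t
    by_cases ht : t ∈ Set.Ioc (0 : ℝ) 1
    · have ht0 : 0 < t := ht.1
      have ht2 : t ^ (2 : ℝ) ∈ Set.Ioc (0 : ℝ) 1 := by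
        rw [Real.rpow_two]
        exact ⟨by positivity, pow_le_one₀ ht.1.le ht.2⟩
      rw [Set.indicator_of_mem ht, Set.indicator_of_mem (show t ∈ Set.Ioi (0 : ℝ) from ht0),
        Set.indicator_of_mem ht2, Real.rpow_two, abs_two, show (2 : ℝ) - 1 = 1 by norm_num,
        Real.rpow_one, Complex.real_smul, add_sub_cancel_right]
      have e1 : ((t ^ 2 : ℝ) : ℂ) ^ ((k : ℂ) + 1 / 2 - 1) * t = (t : ℂ) ^ (2 * k) := by
        have h0 : (t : ℂ) ≠ 0 := Complex.ofReal_ne_zero.2 ht0.ne'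
        rw [pow_two, Complex.ofReal_mul, Complex.mul_cpow_ofReal_nonneg ht0.le ht0.le,
          ← Complex.cpow_add _ _ h0]
        nth_rewrite 2 [← Complex.cpow_one (t : ℂ)]
        rw [← Complex.cpow_add _ _ h0, ← Complex.cpow_natCast]
        congr 1
        push_cast
        ring
      rw [← e1]
      push_cast
      ring
    · rw [Set.indicator_of_notMem ht]
      symm
      rw [Set.indicator_apply_eq_zero]
      intro ht0
      have ht0' : 0 < t := ht0
      rw [Set.indicator_of_notMem, smul_zero]
      rw [Real.rpow_two]
      rintro ⟨_, h2⟩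
      exact ht ⟨ht0', by nlinarith⟩
  · congr 1
    ext t
    rw [Set.indicator_indicator, Set.inter_eq_self_of_subset_right Set.Ioc_subset_Ioi_self]

theorem norm_one_sub_sq_cpow_le {b : ℂ} (hb : 0 < b.re) {t : ℝ} (h0 : 0 ≤ t) (h1 : t ≤ 1) :
    ‖(1 - (t : ℂ) ^ 2) ^ b‖ ≤ 1 := by
  have h2 : 0 ≤ 1 - t ^ 2 := by nlinarith
  have h3 : (1 - (t : ℂ) ^ 2) = ((1 - t ^ 2 : ℝ) : ℂ) := by push_cast; ring
  rw [h3, Complex.norm_cpow_eq_rpow_re_of_nonneg h2 hb.ne']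
  exact Real.rpow_le_one h2 (by nlinarith) hb.le

/-- In the strip |Re t| ≤ 1 the value 1 - t² meets the cut (-∞, 0] only at t = ±1, where it
vanishes; there Re b > 0 gives continuity. Thus the contour below may have corners at the branch
points. -/
theorem continuous_one_sub_sq_cpow {b : ℂ} (hb : 0 < b.re) :
    ContinuousOn (fun t : ℂ => (1 - t ^ 2) ^ b) {t | |t.re| ≤ 1 } := by
  intro t ht
  refine ContinuousAt.continuousWithinAt ?_
  by_cases h : 1 - t ^ 2 = 0
  · have h1 := (Complex.continuousAt_cpow_zero_of_re_pos hb)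
    rw [← h] at h1
    exact ContinuousAt.comp (f := fun t : ℂ => ((1 - t ^ 2, b) : ℂ × ℂ)) h1 (by fun_prop)
  · refine ContinuousAt.cpow (by fun_prop) continuousAt_const ?_
    rw [Complex.mem_slitPlane_iff]
    by_contra! hcon
    obtain ⟨h2, h3⟩ := hcon
    have ht' : t.re ^ 2 ≤ 1 := (sq_le_one_iff_abs_le_one _).2 ht
    simp only [pow_two, Complex.sub_re, Complex.one_re, Complex.mul_re, Complex.sub_im,
      Complex.one_im, Complex.mul_im] at h2 h3
    have him : t.im ^ 2 = 0 := by nlinarith [sq_nonneg t.im]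
    have him0 : t.im = 0 := by simpa using him
    apply h
    apply Complex.ext
    · simp only [pow_two, Complex.sub_re, Complex.one_re, Complex.mul_re, Complex.zero_re]
      rw [him0] at h2 ⊢
      nlinarith
    · simp [pow_two, him0]

/-- Expand cosh and integrate termwise: each term is a Beta integral, and the Gamma quotients match
the coefficients of the series. The assumption Re b > 0 makes the weight bounded by 1, which gives
the domination. -/
theorem besselSeries_eq_integral {b : ℂ} (hb : 0 < b.re) (z : ℂ) :
    besselSeries (b + 1 / 2) z * (((Real.sqrt Real.pi : ℝ) : ℂ) * Complex.Gamma (b + 1)) =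
      ∫ t in (0 : ℝ)..1, 2 * (Complex.cosh (z * t) * (1 - (t : ℂ) ^ 2) ^ b) := by
  have hsum : HasSum (fun k : ℕ => ∫ t in (0 : ℝ)..1,
      (z ^ (2 * k) / ((2 * k).factorial : ℂ)) * (2 * ((t : ℂ) ^ (2 * k) * (1 - (t : ℂ) ^ 2) ^ b)))
      (∫ t in (0 : ℝ)..1, 2 * (Complex.cosh (z * t) * (1 - (t : ℂ) ^ 2) ^ b)) := by
    have hs : Summable fun k : ℕ => ‖z‖ ^ (2 * k) / ((2 * k).factorial : ℝ) :=
      (Real.summable_pow_div_factorial ‖z‖).comp_injective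
        (i := fun k => 2 * k) fun a c h => by simpa using h
    refine intervalIntegral.hasSum_integral_of_dominated_convergence
      (fun k _ => (‖z‖ ^ (2 * k) / ((2 * k).factorial : ℝ)) * 2) (fun k => ?_) (fun k => ?_) ?_ ?_ ?_
    · refine ContinuousOn.aestronglyMeasurable ?_ measurableSet_uIoc
      refine continuousOn_const.mul (continuousOn_const.mul (ContinuousOn.mul (by fun_prop) ?_))
      refine (continuous_one_sub_sq_cpow hb).comp Complex.continuous_ofReal.continuousOn
        fun t ht => ?_
      rw [Set.uIoc_of_le zero_le_one] at ht
      simpa using abs_le.2 ⟨by linarith [ht.1], ht.2⟩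
    · refine Eventually.of_forall fun t ht => ?_
      rw [Set.uIoc_of_le zero_le_one] at ht
      rw [norm_mul, norm_mul, norm_mul, norm_div, norm_pow, norm_pow, Complex.norm_natCast,
        Complex.norm_ofNat, Complex.norm_real, Real.norm_of_nonneg ht.1.le]
      have h1 : t ^ (2 * k) ≤ 1 := pow_le_one₀ ht.1.le ht.2
      have h2 := norm_one_sub_sq_cpow_le hb ht.1.le ht.2
      have h3 : t ^ (2 * k) * ‖(1 - (t : ℂ) ^ 2) ^ b‖ ≤ 1 := mul_le_one₀ h1 (norm_nonneg _) h2
      gcongr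
      linarith
    · exact Eventually.of_forall fun t _ => hs.mul_right _
    · exact intervalIntegrable_const
    · refine Eventually.of_forall fun t _ => ?_
      have h := ((Complex.hasSum_cosh (z * t)).mul_right ((1 - (t : ℂ) ^ 2) ^ b)).mul_left 2
      refine h.congr_fun fun k => ?_
      rw [mul_pow]
      ring
  rw [← hsum.tsum_eq, besselSeries, ← tsum_mul_right]
  congr 1
  ext k
  rw [intervalIntegral.integral_const_mul, integral_pow_mul_one_sub_sq_cpow]
  have hk : (0 : ℝ) ≤ k := k.cast_nonneg
  have h1 := Complex.Gamma_mul_Gamma_eq_betaIntegral (s := (k : ℂ) + 1 / 2) (t := b + 1)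
    (by simp; positivity) (by simp; linarith)
  -- Legendre duplication in the form Γ(k+1/2) k! = 4^{-k} √π (2k)!, which trades the (2k)! of cosh
  -- for the k! of the Bessel series.
  have h2 := Complex.Gamma_mul_Gamma_add_half ((k : ℂ) + 1 / 2)
  rw [show (k : ℂ) + 1 / 2 + 1 / 2 = k + 1 by ring,
    show 2 * ((k : ℂ) + 1 / 2) = ((2 * k : ℕ) : ℂ) + 1 by push_cast; ring,
    Complex.Gamma_nat_eq_factorial, Complex.Gamma_nat_eq_factorial,
    show (1 : ℂ) - (((2 * k : ℕ) : ℂ) + 1) = -((2 * k : ℕ) : ℂ) by ring, Complex.cpow_neg,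
    Complex.cpow_natCast] at h2
  rw [show (k : ℂ) + 1 / 2 + (b + 1) = b + 1 / 2 + k + 1 by ring] at h1
  have hG : Complex.Gamma (b + 1 / 2 + k + 1) ≠ 0 :=
    Complex.Gamma_ne_zero_of_re_pos (by simp; positivity)
  have hf1 : (k.factorial : ℂ) ≠ 0 := Nat.cast_ne_zero.2 k.factorial_ne_zero
  have hf2 : ((2 * k).factorial : ℂ) ≠ 0 := Nat.cast_ne_zero.2 (Nat.factorial_ne_zero _)
  rw [div_pow, mul_inv]
  generalize Complex.Gamma (b + 1 / 2 + k + 1) = G at h1 hG ⊢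
  generalize Complex.Gamma ((k : ℂ) + 1 / 2) = G₁ at h1 h2 ⊢
  generalize Complex.betaIntegral ((k : ℂ) + 1 / 2) (b + 1) = B at h1 ⊢
  generalize Complex.Gamma (b + 1) = G₂ at h1 ⊢
  field_simp at h2 ⊢
  linear_combination (z ^ (2 * k) * 2 ^ (2 * k) * (k.factorial : ℂ)) * h1 - z ^ (2 * k) * G₂ * h2

/-! ### Shifting the contour to i∞ -/

/-- The arguments add up to something strictly between -π and π, so the principal logarithm is
additive here. -/
theorem mul_cpow_of_abs_arg {z w : ℂ} (hz0 : z ≠ 0) (hz : |z.arg| ≤ Real.pi / 2) (hw : 0 < w.re)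
    (b : ℂ) : (z * w) ^ b = z ^ b * w ^ b := by
  have hw0 : w ≠ 0 := fun h => by simp [h] at hw
  have hw1 : |w.arg| < Real.pi / 2 := Complex.abs_arg_lt_pi_div_two_iff.2 (Or.inl hw)
  have h := (Complex.log_mul_eq_add_log_iff hz0 hw0).2 ⟨by
    linarith [(abs_le.1 hz).1, (abs_lt.1 hw1).1], by linarith [(abs_le.1 hz).2, (abs_lt.1 hw1).2]⟩
  rw [Complex.cpow_def_of_ne_zero (mul_ne_zero hz0 hw0), Complex.cpow_def_of_ne_zero hz0,
    Complex.cpow_def_of_ne_zero hw0, h, add_mul, Complex.exp_add]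

theorem ofReal_pos_mul_cpow {y : ℝ} (hy : 0 < y) {w : ℂ} (hw : w ≠ 0) (b : ℂ) :
    ((y : ℂ) * w) ^ b = (y : ℂ) ^ b * w ^ b := by
  have hy0 : (y : ℂ) ≠ 0 := Complex.ofReal_ne_zero.2 hy.ne'
  rw [Complex.cpow_def_of_ne_zero (mul_ne_zero hy0 hw), Complex.cpow_def_of_ne_zero hy0,
    Complex.cpow_def_of_ne_zero hw, Complex.log_ofReal_mul hy hw, Complex.ofReal_log hy.le,
    add_mul, Complex.exp_add]

/-- The integrand on the vertical rays through `±1`, for `c = ± i`. -/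
theorem exp_mul_cpow_eq_tricomiIntegrand {c : ℂ} (hc : c * c = -1) (hc1 : |c.arg| ≤ Real.pi / 2)
    (hcre : c.re = 0) (b : ℂ) {x : ℝ} (hx : 0 < x) {y : ℝ} (hy : 0 < y) :
    Complex.exp (-((x : ℂ) * y)) * ((y : ℂ) ^ 2 + 2 * c * y) ^ b =
      (2 * c) ^ b * (x : ℂ) ^ (-b) * tricomiIntegrand b (2 * (c * x))⁻¹ (x * y) := by
  have hx0 : (x : ℂ) ≠ 0 := Complex.ofReal_ne_zero.2 hx.ne'
  have hc0 : c ≠ 0 := fun h => by simp [h] at hc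
  have e1 : (y : ℂ) ^ 2 + 2 * c * y = (y : ℂ) * ((2 * c) * (1 + ((x * y : ℝ) : ℂ) * (2 * (c * x))⁻¹)) := by
    have : c⁻¹ * c = 1 := inv_mul_cancel₀ hc0
    push_cast
    field_simp
    ring
  -- As c⁻¹ = -c and c is imaginary, this factor has real part 1, so its power splits off from that
  -- of 2c without a change of branch.
  have e2 : (1 + ((x * y : ℝ) : ℂ) * (2 * (c * x))⁻¹) = 1 - c * ((y / 2 : ℝ) : ℂ) := by
    have h3 : c⁻¹ = -c := by
      rw [inv_eq_iff_eq_inv, ← mul_eq_one_iff_eq_inv₀ (neg_ne_zero.2 hc0)]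
      linear_combination -hc
    rw [mul_inv, mul_inv, h3]
    push_cast
    field_simp
    ring
  have hre : 0 < (1 + ((x * y : ℝ) : ℂ) * (2 * (c * x))⁻¹).re := by
    rw [e2, Complex.sub_re, Complex.one_re, mul_comm, Complex.re_ofReal_mul, hcre]
    norm_num
  have e3 : ((2 : ℝ) * c).arg = c.arg := Complex.arg_real_mul c two_pos
  push_cast at e3
  rw [e1, ofReal_pos_mul_cpow hy (mul_ne_zero (mul_ne_zero two_ne_zero hc0)
      fun h => by rw [h, Complex.zero_re] at hre; exact lt_irrefl _ hre),
    mul_cpow_of_abs_arg (mul_ne_zero two_ne_zero hc0) (by rwa [e3]) hre, tricomiIntegrand,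
    Complex.ofReal_mul, Complex.mul_cpow_ofReal_nonneg hx.le hy.le, Complex.cpow_neg]
  have hxb : (x : ℂ) ^ b ≠ 0 := by simp [Complex.cpow_eq_zero_iff, hx0]
  field_simp

theorem integral_exp_mul_cpow_ray {c : ℂ} (hc : c * c = -1) (hc1 : |c.arg| ≤ Real.pi / 2)
    (hcre : c.re = 0) {b : ℂ} (hb : -1 < b.re) {x : ℝ} (hx : 0 < x) :
    MeasureTheory.IntegrableOn (fun y : ℝ => Complex.exp (-((x : ℂ) * y)) *
      ((y : ℂ) ^ 2 + 2 * c * y) ^ b) (Set.Ioi 0) ∧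
    ∫ y in Set.Ioi (0 : ℝ), Complex.exp (-((x : ℂ) * y)) * ((y : ℂ) ^ 2 + 2 * c * y) ^ b =
      (2 * c) ^ b * (x : ℂ) ^ (-b - 1) * tricomiIntegral b (2 * (c * x))⁻¹ := by
  have hx0 : (x : ℂ) ≠ 0 := Complex.ofReal_ne_zero.2 hx.ne'
  have hq : (2 * (c * x))⁻¹ ∈ Complex.slitPlane := by
    refine inv_two_mul_mem_slitPlane ?_
    rw [Complex.mem_slitPlane_iff]
    right
    have hc0 : c ≠ 0 := fun h => by simp [h] at hc
    have : c.im ≠ 0 := fun h => hc0 (Complex.ext hcre h)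
    simpa using ⟨this, hx.ne'⟩
  have hcongr : Set.EqOn (fun y : ℝ => Complex.exp (-((x : ℂ) * y)) * ((y : ℂ) ^ 2 + 2 * c * y) ^ b)
      (fun y : ℝ => (2 * c) ^ b * (x : ℂ) ^ (-b) * tricomiIntegrand b (2 * (c * x))⁻¹ (x * y))
      (Set.Ioi 0) := fun y hy => exp_mul_cpow_eq_tricomiIntegrand hc hc1 hcre b hx hy
  constructor
  · refine MeasureTheory.IntegrableOn.congr_fun ?_ hcongr.symm measurableSet_Ioi
    refine MeasureTheory.Integrable.const_mul ?_ _
    have := (MeasureTheory.integrableOn_Ioi_comp_mul_left_iff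
      (tricomiIntegrand b (2 * (c * x))⁻¹) 0 hx).2
    rw [mul_zero] at this
    exact this (integrableOn_tricomiIntegrand hb hq)
  · rw [MeasureTheory.setIntegral_congr_fun measurableSet_Ioi hcongr,
      MeasureTheory.integral_const_mul,
      MeasureTheory.integral_comp_mul_left_Ioi (tricomiIntegrand b (2 * (c * x))⁻¹) 0 hx, mul_zero,
      ← tricomiIntegral, Complex.real_smul, Complex.cpow_sub _ _ hx0, Complex.cpow_one]
    push_cast
    ring

/-- At height R the exponential has modulus e^{-xR}, while the power grows at most like R^{2 Re b}.
-/
theorem tendsto_integral_horizontal {b : ℂ} (hb : 0 < b.re) {x : ℝ} (hx : 0 < x) :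
    Tendsto (fun R : ℝ => ∫ t in (-1 : ℝ)..1, Complex.exp (Complex.I * x * (t + R * Complex.I)) *
      (1 - (t + R * Complex.I) ^ 2) ^ b) atTop (𝓝 0) := by
  have hlim := ((tendsto_rpow_mul_exp_neg_mul_atTop_nhds_zero (2 * b.re) x hx).const_mul
    (5 ^ b.re * Real.exp (Real.pi * |b.im|) * |(1 : ℝ) - (-1)|))
  rw [mul_zero] at hlim
  refine squeeze_zero_norm' ?_ hlim
  filter_upwards [eventually_ge_atTop 1] with R hR
  refine (intervalIntegral.norm_integral_le_of_norm_le_const (C := 5 ^ b.re *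
    Real.exp (Real.pi * |b.im|) * (R ^ (2 * b.re) * Real.exp (-x * R))) fun t ht => ?_).trans
      (le_of_eq (by ring))
  rw [Set.uIoc_of_le (by norm_num)] at ht
  have hne : (1 : ℂ) - (t + R * Complex.I) ^ 2 ≠ 0 := by
    intro h
    have h1 := congrArg Complex.re h
    simp [pow_two] at h1
    nlinarith [ht.1, ht.2]
  have hn : ‖(1 : ℂ) - (t + R * Complex.I) ^ 2‖ ≤ 5 * R ^ 2 := by
    have h1 : ‖(t : ℂ) + R * Complex.I‖ ≤ 1 + R := by
      refine (norm_add_le _ _).trans ?_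
      rw [norm_mul, Complex.norm_I, mul_one, Complex.norm_real, Complex.norm_real,
        Real.norm_of_nonneg (by linarith : 0 ≤ R)]
      gcongr
      exact abs_le.2 ⟨by linarith [ht.1], ht.2⟩
    refine (norm_sub_le _ _).trans ?_
    rw [norm_one, norm_pow]
    have h2 : ‖(t : ℂ) + R * Complex.I‖ ^ 2 ≤ (1 + R) ^ 2 := by gcongr
    nlinarith
  rw [norm_mul]
  have e1 : ‖Complex.exp (Complex.I * x * (t + R * Complex.I))‖ = Real.exp (-x * R) := by
    rw [Complex.norm_exp]
    congr 1
    simp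
  rw [e1]
  calc _ ≤ Real.exp (-x * R) * ((5 * R ^ 2) ^ b.re * Real.exp (Real.pi * |b.im|)) := by
        gcongr
        refine (norm_cpow_le_rpow_mul_exp hne b).trans ?_
        gcongr
    _ = _ := by
        rw [Real.mul_rpow (by norm_num) (by positivity), ← Real.rpow_natCast,
          ← Real.rpow_mul (by linarith)]
        push_cast
        ring

/-- Cauchy's theorem on the rectangle over [-1, 1] of height R. With t = ±1 + iy one has 1 - t² = y²
∓ 2iy and e^{ixt} = e^{±ix} e^{-xy}, so the vertical sides become the ray integrals with c = ∓i as R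
→ ∞, and the top side disappears. -/
theorem integral_exp_mul_one_sub_sq_cpow {b : ℂ} (hb : 0 < b.re) {x : ℝ} (hx : 0 < x) :
    ∫ t in (-1 : ℝ)..1, Complex.exp (Complex.I * x * t) * (1 - (t : ℂ) ^ 2) ^ b =
      Complex.I * Complex.exp (-(Complex.I * x)) * ((2 * Complex.I) ^ b * (x : ℂ) ^ (-b - 1) *
        tricomiIntegral b (2 * (Complex.I * x))⁻¹) -
      Complex.I * Complex.exp (Complex.I * x) * ((2 * -Complex.I) ^ b * (x : ℂ) ^ (-b - 1) *
        tricomiIntegral b (2 * (-Complex.I * x))⁻¹) := by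
  set f : ℂ → ℂ := fun t => Complex.exp (Complex.I * x * t) * (1 - t ^ 2) ^ b with hf
  obtain ⟨i1, v1⟩ := integral_exp_mul_cpow_ray (c := Complex.I) (by simp) (by
    rw [Complex.arg_I, abs_of_pos (by positivity)]) (by simp) (by linarith : -1 < b.re) hx
  obtain ⟨i2, v2⟩ := integral_exp_mul_cpow_ray (c := -Complex.I) (by simp) (by
    rw [Complex.arg_neg_I, abs_neg, abs_of_pos (by positivity)]) (by simp)
      (by linarith : -1 < b.re) hx
  have hcauchy : ∀ R : ℝ, 0 < R → (∫ t in (-1 : ℝ)..1, f t) =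
      (∫ t in (-1 : ℝ)..1, f (t + R * Complex.I)) -
      Complex.I * Complex.exp (Complex.I * x) * (∫ y in (0 : ℝ)..R, Complex.exp (-((x : ℂ) * y)) *
        ((y : ℂ) ^ 2 + 2 * -Complex.I * y) ^ b) +
      Complex.I * Complex.exp (-(Complex.I * x)) * (∫ y in (0 : ℝ)..R, Complex.exp (-((x : ℂ) * y)) *
        ((y : ℂ) ^ 2 + 2 * Complex.I * y) ^ b) := by
    intro R hR
    have h := Complex.integral_boundary_rect_eq_zero_of_continuousOn_of_differentiableOn f
      (-1) (1 + R * Complex.I) ?_ ?_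
    · simp only [Complex.neg_re, Complex.one_re, Complex.add_re, Complex.mul_re, Complex.ofReal_re,
        Complex.I_re, mul_zero, Complex.ofReal_im, Complex.I_im, mul_one, sub_self, add_zero,
        Complex.neg_im, Complex.one_im, neg_zero, Complex.add_im, Complex.mul_im, zero_add,
        Complex.ofReal_zero, zero_mul, Complex.ofReal_one, Complex.ofReal_neg, smul_eq_mul] at h
      have r1 : ∫ y in (0 : ℝ)..R, f (1 + y * Complex.I) = Complex.exp (Complex.I * x) *
          ∫ y in (0 : ℝ)..R, Complex.exp (-((x : ℂ) * y)) *
            ((y : ℂ) ^ 2 + 2 * -Complex.I * y) ^ b := by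
        rw [← intervalIntegral.integral_const_mul]
        congr 1
        ext y
        rw [hf, ← mul_assoc, ← Complex.exp_add]
        simp only
        congr 2
        · linear_combination (x * y : ℂ) * Complex.I_sq
        · linear_combination (-y ^ 2 : ℂ) * Complex.I_sq
      have r2 : ∫ y in (0 : ℝ)..R, f (-1 + y * Complex.I) = Complex.exp (-(Complex.I * x)) *
          ∫ y in (0 : ℝ)..R, Complex.exp (-((x : ℂ) * y)) *
            ((y : ℂ) ^ 2 + 2 * Complex.I * y) ^ b := by
        rw [← intervalIntegral.integral_const_mul]
        congr 1
        ext y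
        rw [hf, ← mul_assoc, ← Complex.exp_add]
        simp only
        congr 2
        · linear_combination (x * y : ℂ) * Complex.I_sq
        · linear_combination (-y ^ 2 : ℂ) * Complex.I_sq
      rw [r1, r2] at h
      linear_combination h
    · refine ContinuousOn.mul (by fun_prop) ((continuous_one_sub_sq_cpow hb).mono ?_)
      intro t ht
      have h1 := (Complex.mem_reProdIm.1 ht).1
      simp only [Complex.neg_re, Complex.one_re, Complex.add_re, Complex.mul_re, Complex.ofReal_re,
        Complex.I_re, mul_zero, Complex.ofReal_im, Complex.I_im, mul_one, sub_self, add_zero] at h1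
      rw [Set.uIcc_of_le (by norm_num)] at h1
      exact abs_le.2 h1
    · intro t ht
      have h1 := (Complex.mem_reProdIm.1 ht).1
      simp only [Complex.neg_re, Complex.one_re, Complex.add_re, Complex.mul_re, Complex.ofReal_re,
        Complex.I_re, mul_zero, Complex.ofReal_im, Complex.I_im, mul_one, sub_self, add_zero] at h1
      rw [min_eq_left (by norm_num), max_eq_right (by norm_num)] at h1
      have h2 : 1 - t ^ 2 ∈ Complex.slitPlane := by
        rw [Complex.mem_slitPlane_iff]
        left
        simp only [pow_two, Complex.sub_re, Complex.one_re, Complex.mul_re]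
        nlinarith [h1.1, h1.2]
      have h3 : DifferentiableAt ℂ (fun t : ℂ => (1 - t ^ 2) ^ b) t :=
        DifferentiableAt.cpow_const (f := fun t : ℂ => 1 - t ^ 2) (by fun_prop) h2
      exact (DifferentiableAt.mul (by fun_prop) h3).differentiableWithinAt
  have t0 := tendsto_integral_horizontal hb hx
  have t1 := MeasureTheory.intervalIntegral_tendsto_integral_Ioi 0 i1 tendsto_id
  have t2 := MeasureTheory.intervalIntegral_tendsto_integral_Ioi 0 i2 tendsto_id
  rw [v1] at t1
  rw [v2] at t2
  have hT := (t0.sub (t2.const_mul (Complex.I * Complex.exp (Complex.I * x)))).add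
    (t1.const_mul (Complex.I * Complex.exp (-(Complex.I * x))))
  have hconst : Tendsto (fun _ : ℝ => ∫ t in (-1 : ℝ)..1, f t) atTop (𝓝 (∫ t in (-1 : ℝ)..1, f t)) :=
    tendsto_const_nhds
  have := tendsto_nhds_unique (hconst.congr' (by
    filter_upwards [eventually_gt_atTop 0] with R hR using hcauchy R hR)) hT
  rw [this]
  ring

theorem integral_cosh_eq_integral_exp {b : ℂ} (hb : 0 < b.re) (x : ℝ) :
    ∫ t in (0 : ℝ)..1, 2 * (Complex.cosh (Complex.I * x * t) * (1 - (t : ℂ) ^ 2) ^ b) =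
      ∫ t in (-1 : ℝ)..1, Complex.exp (Complex.I * x * t) * (1 - (t : ℂ) ^ 2) ^ b := by
  set f : ℝ → ℂ := fun t => Complex.exp (Complex.I * x * t) * (1 - (t : ℂ) ^ 2) ^ b with hf
  have hc : ContinuousOn f (Set.Icc (-1) 1) := by
    refine ContinuousOn.mul (by fun_prop) ?_
    exact (continuous_one_sub_sq_cpow hb).comp Complex.continuous_ofReal.continuousOn
      fun t ht => by simpa using abs_le.2 ht
  have hi : ∀ a c : ℝ, a ∈ Set.Icc (-1 : ℝ) 1 → c ∈ Set.Icc (-1 : ℝ) 1 →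
      IntervalIntegrable f MeasureTheory.volume a c := fun a c ha hc' =>
    (hc.mono (Set.ordConnected_Icc.uIcc_subset ha hc')).intervalIntegrable
  have m1 : (-1 : ℝ) ∈ Set.Icc (-1 : ℝ) 1 := by norm_num
  have m2 : (0 : ℝ) ∈ Set.Icc (-1 : ℝ) 1 := by norm_num
  have m3 : (1 : ℝ) ∈ Set.Icc (-1 : ℝ) 1 := by norm_num
  rw [← intervalIntegral.integral_add_adjacent_intervals (hi _ _ m1 m2) (hi _ _ m2 m3)]
  have hneg : ∫ t in (-1 : ℝ)..0, f t = ∫ t in (0 : ℝ)..1, f (-t) := by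
    rw [intervalIntegral.integral_comp_neg, neg_zero]
  have hi2 : IntervalIntegrable (fun t => f (-t)) MeasureTheory.volume 0 1 := by
    refine (hc.comp continuous_neg.continuousOn fun t ht => ?_).intervalIntegrable
    rw [Set.uIcc_of_le zero_le_one] at ht
    exact ⟨by linarith [ht.2], by linarith [ht.1]⟩
  rw [hneg, ← intervalIntegral.integral_add hi2 (hi _ _ m2 m3)]
  congr 1
  ext t
  simp only [hf, Complex.cosh]
  push_cast
  rw [neg_sq, show Complex.I * x * -(t : ℂ) = -(Complex.I * x * t) by ring]
  ring

/-! ### The connection formula for I -/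

/-- The connection formula expressing `I_η` through the two exponential solutions in the upper
half plane; for `τ = -1` it holds in the lower half plane. -/
noncomputable def connectionI (τ η z : ℂ) : ℂ :=
  invSqrt z / ((Real.sqrt (2 * Real.pi) : ℝ) : ℂ) * (Complex.exp z * macdonaldFactor η (-z) +
    τ * Complex.I * Complex.exp (τ * Complex.I * Real.pi * η) * Complex.exp (-z) *
      macdonaldFactor η z)

/-- Poisson's integral with b = η - 1/2 at z = ix, evaluated by the contour shift: the rays at -1
and +1 give e^{-z} H(η,z) and e^z H(η,-z). What remains is to match the constants. -/
theorem principalBesselI_imaginary_of_re {η : ℂ} (hη : 1 / 2 < η.re) {x : ℝ} (hx : 0 < x) :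
    principalBesselI η (x * Complex.I) = connectionI 1 η (x * Complex.I) := by
  have hb : 0 < (η - 1 / 2).re := by simp; linarith
  have h1 := besselSeries_eq_integral hb (Complex.I * x)
  rw [integral_cosh_eq_integral_exp hb, integral_exp_mul_one_sub_sq_cpow hb hx] at h1
  rw [show η - 1 / 2 + 1 / 2 = η by ring, show η - 1 / 2 + 1 = η + 1 / 2 by ring] at h1
  have hG : Complex.Gamma (η + 1 / 2) ≠ 0 := Complex.Gamma_ne_zero_of_re_pos (by simp; linarith)
  have hW : ∀ z : ℂ, tricomiIntegral (η - 1 / 2) (2 * z)⁻¹ =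
      Complex.Gamma (η + 1 / 2) * macdonaldFactorRight η z := by
    intro z
    rw [macdonaldFactorRight, mul_inv_cancel_left₀ hG]
  rw [hW, hW] at h1
  have hx0 : (x : ℂ) ≠ 0 := Complex.ofReal_ne_zero.2 hx.ne'
  have hz : ∀ c : ℂ, c.im ≠ 0 → c * x ∈ Complex.slitPlane := by
    intro c hc
    rw [Complex.mem_slitPlane_iff]
    right
    simpa using ⟨hc, hx.ne'⟩
  rw [← macdonaldFactor_eq_right (by linarith) (hz _ (by simp)),
    ← macdonaldFactor_eq_right (by linarith) (hz _ (by simp))] at h1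
  have hS : besselSeries η (Complex.I * x) * ((Real.sqrt Real.pi : ℝ) : ℂ) =
      Complex.I * Complex.exp (-(Complex.I * x)) * ((2 * Complex.I) ^ (η - 1 / 2) *
        (x : ℂ) ^ (-(η - 1 / 2) - 1) * macdonaldFactor η (Complex.I * x)) -
      Complex.I * Complex.exp (Complex.I * x) * ((2 * -Complex.I) ^ (η - 1 / 2) *
        (x : ℂ) ^ (-(η - 1 / 2) - 1) * macdonaldFactor η (-Complex.I * x)) := by
    apply mul_right_cancel₀ hG
    linear_combination h1
  have hpi : ((Real.sqrt Real.pi : ℝ) : ℂ) ≠ 0 :=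
    Complex.ofReal_ne_zero.2 (Real.sqrt_pos.2 Real.pi_pos).ne'
  have hpi2 : ((Real.sqrt (2 * Real.pi) : ℝ) : ℂ) =
      Complex.exp (Real.log 2 / 2) * ((Real.sqrt Real.pi : ℝ) : ℂ) := by
    rw [Real.sqrt_mul (by norm_num), Complex.ofReal_mul]
    congr 1
    rw [Real.sqrt_eq_rpow, Real.rpow_def_of_pos two_pos]
    push_cast
    congr 1
    ring
  have l1 : Complex.log (x * Complex.I) = Real.log x + Real.pi / 2 * Complex.I := by
    rw [Complex.log_ofReal_mul hx Complex.I_ne_zero, Complex.log_I]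
  have l2 : Complex.log (x * Complex.I / 2) =
      Real.log x - Real.log 2 + Real.pi / 2 * Complex.I := by
    rw [show (x : ℂ) * Complex.I / 2 = ((x / 2 : ℝ) : ℂ) * Complex.I by push_cast; ring,
      Complex.log_ofReal_mul (by positivity) Complex.I_ne_zero, Complex.log_I,
      Real.log_div hx.ne' two_ne_zero]
    push_cast
    ring
  have l3 : Complex.log (2 * Complex.I) = Real.log 2 + Real.pi / 2 * Complex.I := by
    rw [show (2 : ℂ) * Complex.I = ((2 : ℝ) : ℂ) * Complex.I by push_cast; ring,
      Complex.log_ofReal_mul two_pos Complex.I_ne_zero, Complex.log_I]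
  have l4 : Complex.log (2 * -Complex.I) = Real.log 2 - Real.pi / 2 * Complex.I := by
    rw [show (2 : ℂ) * -Complex.I = ((2 : ℝ) : ℂ) * -Complex.I by push_cast; ring,
      Complex.log_ofReal_mul two_pos (neg_ne_zero.2 Complex.I_ne_zero), Complex.log_neg_I]
    ring
  have l5 : Complex.log (x : ℂ) = Real.log x := (Complex.ofReal_log hx.le).symm
  have hI : Complex.I = Complex.exp (Real.pi / 2 * Complex.I) := (Complex.exp_pi_div_two_mul_I).symm
  have hnI : -Complex.I = Complex.exp (-(Real.pi / 2 * Complex.I)) := by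
    rw [Complex.exp_neg, ← hI, Complex.inv_I]
  rw [Complex.cpow_def_of_ne_zero (by simp), Complex.cpow_def_of_ne_zero hx0,
    Complex.cpow_def_of_ne_zero (by simp), l3, l4, l5] at hS
  rw [principalBesselI, connectionI, invSqrt, l1, l2, hpi2, mul_comm (x : ℂ) Complex.I,
    ← neg_mul, one_mul]
  have ha0 := Complex.exp_ne_zero ((Real.log 2 : ℂ) / 2)
  rw [div_mul_eq_mul_div (Complex.exp (-(1 / 2) * (Real.log x + Real.pi / 2 * Complex.I))),
    eq_div_iff (mul_ne_zero ha0 hpi)]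
  generalize macdonaldFactor η (Complex.I * x) = A at hS ⊢
  generalize macdonaldFactor η (-Complex.I * x) = B at hS ⊢
  -- With all powers and the factors ±i written as exponentials of logarithms, the coefficients of
  -- e^z (here) and of e^{-z} (in `c2`) are compared by adding exponents.
  have c1 : Complex.exp (η * (Real.log x - Real.log 2 + Real.pi / 2 * Complex.I)) *
      Complex.exp (Real.log 2 / 2) * (Complex.exp ((Real.log 2 - Real.pi / 2 * Complex.I) *
        (η - 1 / 2)) * Complex.exp (Real.log x * (-(η - 1 / 2) - 1))) * -Complex.I =
      Complex.exp (-(1 / 2) * (Real.log x + Real.pi / 2 * Complex.I)) := by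
    rw [hnI, ← Complex.exp_add, ← Complex.exp_add, ← Complex.exp_add, ← Complex.exp_add]
    congr 1
    ring
  have c2 : Complex.exp (η * (Real.log x - Real.log 2 + Real.pi / 2 * Complex.I)) *
      Complex.exp (Real.log 2 / 2) * (Complex.exp ((Real.log 2 + Real.pi / 2 * Complex.I) *
        (η - 1 / 2)) * Complex.exp (Real.log x * (-(η - 1 / 2) - 1))) * Complex.I =
      Complex.exp (-(1 / 2) * (Real.log x + Real.pi / 2 * Complex.I)) *
        (Complex.I * Complex.exp (Complex.I * Real.pi * η)) := by
    rw [hI, ← Complex.exp_add, ← Complex.exp_add, ← Complex.exp_add, ← Complex.exp_add,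
      ← Complex.exp_add, ← hI, ← Complex.exp_add]
    congr 1
    ring
  rw [neg_mul Complex.I (x : ℂ)]
  linear_combination (Complex.exp (η * (Real.log x - Real.log 2 + Real.pi / 2 * Complex.I)) *
    Complex.exp (Real.log 2 / 2)) * hS + Complex.exp (Complex.I * x) * B * c1 +
      Complex.exp (-(Complex.I * x)) * A * c2

theorem neg_mem_slitPlane_of_im_ne_zero {z : ℂ} (hz : z.im ≠ 0) : -z ∈ Complex.slitPlane :=
  Complex.mem_slitPlane_iff.2 (Or.inr (by simpa using hz))

theorem mem_slitPlane_of_im_ne_zero {z : ℂ} (hz : z.im ≠ 0) : z ∈ Complex.slitPlane :=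
  Complex.mem_slitPlane_iff.2 (Or.inr hz)

/-- For fixed z = ix both sides are entire in η and agree on the half plane Re η > 1/2. -/
theorem principalBesselI_imaginary (η : ℂ) {x : ℝ} (hx : 0 < x) :
    principalBesselI η (x * Complex.I) = connectionI 1 η (x * Complex.I) := by
  have him : ((x : ℂ) * Complex.I).im ≠ 0 := by simpa using hx.ne'
  have h1 : Differentiable ℂ fun η => connectionI 1 η (x * Complex.I) := by
    unfold connectionI
    have d1 := differentiable_macdonaldFactor_left (mem_slitPlane_of_im_ne_zero him)
    have d2 := differentiable_macdonaldFactor_left (neg_mem_slitPlane_of_im_ne_zero him)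
    refine Differentiable.const_mul ((d2.const_mul _).add (Differentiable.mul ?_ d1)) _
    fun_prop
  have h2 := (Complex.analyticOnNhd_univ_iff_differentiable.2
    (differentiable_principalBesselI_left (x * Complex.I))).eq_of_eventuallyEq
    (Complex.analyticOnNhd_univ_iff_differentiable.2 h1) (z₀ := 1) (by
      filter_upwards [(isOpen_lt continuous_const Complex.continuous_re).mem_nhds
        (show (1 / 2 : ℝ) < (1 : ℂ).re by norm_num)] with ξ hξ
      exact principalBesselI_imaginary_of_re hξ hx)
  exact congrFun h2 η

theorem differentiableOn_invSqrt : DifferentiableOn ℂ invSqrt Complex.slitPlane := by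
  intro z hz
  exact ((DifferentiableAt.clog differentiableAt_id hz).const_mul
    (-(1 / 2))).cexp.differentiableWithinAt

theorem differentiableOn_connectionI (τ η : ℂ) {U : Set ℂ} (hU : ∀ z ∈ U, z.im ≠ 0) :
    DifferentiableOn ℂ (connectionI τ η) U := by
  have hs : U ⊆ Complex.slitPlane := fun z hz => mem_slitPlane_of_im_ne_zero (hU z hz)
  have d1 := (differentiableOn_macdonaldFactor_right η).mono hs
  have d2 : DifferentiableOn ℂ (fun z => macdonaldFactor η (-z)) U :=
    (differentiableOn_macdonaldFactor_right η).comp (differentiableOn_neg _)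
      fun z hz => neg_mem_slitPlane_of_im_ne_zero (hU z hz)
  have d3 := differentiableOn_invSqrt.mono hs
  unfold connectionI
  refine DifferentiableOn.mul (d3.div_const _) (DifferentiableOn.add ?_ ?_)
  · exact DifferentiableOn.mul (by fun_prop) d2
  · exact DifferentiableOn.mul (by fun_prop) d1

theorem principalBesselI_eq_of_im_pos (η : ℂ) {z : ℂ} (hz : 0 < z.im) :
    principalBesselI η z = connectionI 1 η z := by
  have hopen : IsOpen {z : ℂ | 0 < z.im} := isOpen_lt continuous_const Complex.continuous_im
  have hconv : Convex ℝ {z : ℂ | 0 < z.im} := convex_halfSpace_im_gt 0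
  exact eqOn_of_eq_on_ray hopen hconv.isPreconnected
    ((differentiableOn_principalBesselI_right η).mono
      fun z hz => mem_slitPlane_of_im_ne_zero (ne_of_gt hz))
    (differentiableOn_connectionI 1 η fun z hz => ne_of_gt hz) (c := Complex.I) (by simp)
    Complex.I_ne_zero (fun x hx => principalBesselI_imaginary η hx) hz

theorem log_neg_of_im_neg {z : ℂ} (hz : z.im < 0) :
    Complex.log (-z) = Complex.log z + Real.pi * Complex.I := by
  rw [Complex.log, Complex.log, norm_neg, Complex.arg_neg_eq_arg_add_pi_of_im_neg hz]
  push_cast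
  ring

/-- Apply the upper half plane formula at -z. The series is even, the logarithm changes by πi, so I
is multiplied by e^{iπη} and 1/√z by -i, while the two exponentials trade places. -/
theorem principalBesselI_eq_of_im_neg (η : ℂ) {z : ℂ} (hz : z.im < 0) :
    principalBesselI η z = connectionI (-1) η z := by
  have h := principalBesselI_eq_of_im_pos η (z := -z) (by simpa using hz)
  have l1 := log_neg_of_im_neg hz
  have l2 := log_neg_of_im_neg (z := z / 2) (by simpa using by linarith)
  rw [principalBesselI, besselSeries_neg, neg_div, l2, connectionI, invSqrt, l1, neg_neg,
    mul_add η, mul_add (-(1 / 2) : ℂ), Complex.exp_add, Complex.exp_add] at h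
  have e1 : Complex.exp (-(1 / 2) * (Real.pi * Complex.I)) = -Complex.I := by
    rw [show -(1 / 2) * (Real.pi * Complex.I) = -(Real.pi / 2 * Complex.I) by ring, Complex.exp_neg,
      Complex.exp_pi_div_two_mul_I, Complex.inv_I]
  have e2 : Complex.exp (-1 * Complex.I * Real.pi * η) * Complex.exp (η * (Real.pi * Complex.I)) =
      1 := by
    rw [← Complex.exp_add, show -1 * Complex.I * Real.pi * η + η * (Real.pi * Complex.I) = 0 by
      ring, Complex.exp_zero]
  have e3 : Complex.exp (1 * Complex.I * Real.pi * η) = Complex.exp (η * (Real.pi * Complex.I)) := by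
    congr 1
    ring
  rw [e1, e3] at h
  rw [principalBesselI, connectionI, invSqrt]
  generalize Complex.exp (-1 * Complex.I * Real.pi * η) = u at e2 ⊢
  generalize Complex.exp (η * (Real.pi * Complex.I)) = v at e2 h
  generalize Complex.exp (η * Complex.log (z / 2)) = w at h ⊢
  generalize Complex.exp (-(1 / 2) * Complex.log z) = r at h ⊢
  generalize macdonaldFactor η z = A at h ⊢
  generalize macdonaldFactor η (-z) = B at h ⊢
  generalize Complex.exp (-z) = p at h ⊢
  generalize Complex.exp z = q at h ⊢
  generalize ((Real.sqrt (2 * Real.pi) : ℝ) : ℂ) = C at h ⊢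
  linear_combination u * h - (w * besselSeries η z - r / C * B * q) * e2 -
    r / C * q * B * u * v * Complex.I_sq

/-! ### The principal branch of K, and K on an arbitrary branch -/

/-- The principal branch of the modified Bessel function `K_η(z)`, in factored form. -/
noncomputable def principalBesselK (η z : ℂ) : ℂ :=
  Real.pi / ((Real.sqrt (2 * Real.pi) : ℝ) : ℂ) * invSqrt z * Complex.exp (-z) *
    macdonaldFactor η z

theorem differentiableOn_principalBesselK_right (η : ℂ) :
    DifferentiableOn ℂ (fun z => principalBesselK η z) Complex.slitPlane := by
  unfold principalBesselK
  exact ((differentiableOn_invSqrt.const_mul _).mul (by fun_prop)).mul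
    (differentiableOn_macdonaldFactor_right η)

theorem differentiable_principalBesselK_left {z : ℂ} (hz : z ∈ Complex.slitPlane) :
    Differentiable ℂ fun η => principalBesselK η z :=
  (differentiable_macdonaldFactor_left hz).const_mul _

/-- On the positive imaginary axis the terms with e^z cancel, because H is even in η, and those with
e^{-z} combine to a sine. Both sides are holomorphic on the slit plane, which gives the rest.
Multiplied out by the sine, the identity also makes sense for integral η. -/
theorem principalBesselI_neg_sub (η : ℂ) {z : ℂ} (hz : z ∈ Complex.slitPlane) :
    Real.pi / 2 * (principalBesselI (-η) z - principalBesselI η z) =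
      Complex.sin (η * Real.pi) * principalBesselK η z := by
  refine eqOn_of_eq_on_ray
    (f := fun z => Real.pi / 2 * (principalBesselI (-η) z - principalBesselI η z))
    (g := fun z => Complex.sin (η * Real.pi) * principalBesselK η z) Complex.isOpen_slitPlane
    isPreconnected_slitPlane (((differentiableOn_principalBesselI_right (-η)).sub
      (differentiableOn_principalBesselI_right η)).const_mul _)
    ((differentiableOn_principalBesselK_right η).const_mul _) (c := Complex.I)
    (mem_slitPlane_of_im_ne_zero (by simp)) Complex.I_ne_zero (fun x hx => ?_) hz
  have him : ((x : ℂ) * Complex.I).im ≠ 0 := by simpa using hx.ne'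
  rw [principalBesselI_imaginary _ hx, principalBesselI_imaginary _ hx, connectionI, connectionI,
    macdonaldFactor_neg _ (mem_slitPlane_of_im_ne_zero him),
    macdonaldFactor_neg _ (neg_mem_slitPlane_of_im_ne_zero him), principalBesselK, Complex.sin]
  rw [show 1 * Complex.I * Real.pi * -η = -(η * Real.pi) * Complex.I by ring,
    show 1 * Complex.I * Real.pi * η = (η * Real.pi) * Complex.I by ring]
  ring

theorem eventually_not_int (n : ℤ) : ∀ᶠ ξ : ℂ in 𝓝[≠] (n : ℂ), ¬ ∃ k : ℤ, ξ = (k : ℂ) := by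
  filter_upwards [self_mem_nhdsWithin, mem_nhdsWithin_of_mem_nhds
    (Metric.ball_mem_nhds (n : ℂ) one_pos)] with ξ hne hξ
  rintro ⟨k, rfl⟩
  rw [Metric.mem_ball, dist_eq_norm, ← Int.cast_sub, Complex.norm_intCast] at hξ
  have h1 : |k - n| < 1 := by exact_mod_cast hξ
  have h2 : k = n := by
    have := Int.abs_lt_one_iff.1 h1
    omega
  exact hne (by rw [h2]; rfl)

/-- Near an integer all other indices are non-integral, so a continuous function agreeing with the
quotient there takes the limit that defines K at integral index. -/
theorem besselK_eq_of_continuous {ω z : ℂ} {F : ℂ → ℂ} (hF : Continuous F)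
    (h : ∀ ξ : ℂ, (¬ ∃ k : ℤ, ξ = (k : ℂ)) → besselKNonint ω ξ z = F ξ) (η : ℂ) :
    besselK ω η z = F η := by
  rw [besselK]
  split_ifs with hη
  · obtain ⟨n, rfl⟩ := hη
    refine Tendsto.limUnder_eq ?_
    refine ((hF.tendsto (n : ℂ)).mono_left nhdsWithin_le_nhds).congr' ?_
    filter_upwards [eventually_not_int n] with ξ hξ using (h ξ hξ).symm
  · exact h η hη

/-- If the branch of `I` differs from the principal one by the factor `e^{-ηκ}`, then `K` is
obtained from the principal branches of `K` and `I`. -/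
theorem besselK_eq_add {ω z w κ : ℂ} (hI : ∀ ξ, besselI ω ξ z =
      Complex.exp (-(ξ * κ)) * principalBesselI ξ w) (hw : w ∈ Complex.slitPlane)
    {M : ℂ → ℂ} (hM : Continuous M) (hMs : ∀ ξ, M ξ * Complex.sin (ξ * Real.pi) =
      Real.pi / 2 * (Complex.exp (ξ * κ) - Complex.exp (-(ξ * κ)))) (η : ℂ) :
    besselK ω η z = Complex.exp (-(η * κ)) * principalBesselK η w +
      M η * principalBesselI (-η) w := by
  refine besselK_eq_of_continuous (F := fun η => Complex.exp (-(η * κ)) * principalBesselK η w +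
      M η * principalBesselI (-η) w) ?_ (fun ξ hξ => ?_) η
  · have c1 := (differentiable_principalBesselK_left hw).continuous
    have c2 : Continuous fun η => principalBesselI (-η) w :=
      (differentiable_principalBesselI_left w).continuous.comp continuous_neg
    exact (Continuous.mul (by fun_prop) c1).add (hM.mul c2)
  · have hsin : Complex.sin (ξ * Real.pi) ≠ 0 := by
      rw [Ne, Complex.sin_eq_zero_iff]
      rintro ⟨k, hk⟩
      exact hξ ⟨k, mul_right_cancel₀ (Complex.ofReal_ne_zero.2 Real.pi_ne_zero) hk⟩
    rw [besselKNonint, hI, hI, neg_mul, neg_neg, ← mul_div_assoc, div_eq_iff hsin]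
    -- With P the principal I, the difference e^{ξκ} P_{-ξ} - e^{-ξκ} P_ξ is split as e^{-ξκ}(P_{-ξ}
    -- - P_ξ) + (e^{ξκ} - e^{-ξκ}) P_{-ξ}; `M` is the quotient of the last bracket by the sine, up
    -- to π/2, with its singularities removed.
    linear_combination Complex.exp (-(ξ * κ)) * principalBesselI_neg_sub ξ hw -
      principalBesselI (-ξ) w * hMs ξ

/-! ### Exponential asymptotics that survive differentiation -/

theorem tendstoLocallyUniformlyOn_const {ι : Type*} {l : Filter ι} (g : ℂ → ℂ) (U : Set ℂ) :
    TendstoLocallyUniformlyOn (fun _ : ι => g) g l U := fun _ hu _ _ =>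
  ⟨U, self_mem_nhdsWithin, Eventually.of_forall fun _ _ _ => refl_mem_uniformity hu⟩

/-- `f y a = e^{c a y} G y a` for holomorphic functions `G y` that converge locally uniformly
to `g` as `y → ∞`. -/
def ExpAsymp (U : Set ℂ) (c : ℂ) (g : ℂ → ℂ) (f : ℝ → ℂ → ℂ) : Prop :=
  ∃ G : ℝ → ℂ → ℂ, (∀ᶠ y in atTop, DifferentiableOn ℂ (G y) U) ∧
    TendstoLocallyUniformlyOn G g atTop U ∧
    ∀ᶠ y in atTop, ∀ a ∈ U, f y a = Complex.exp (c * a * (y : ℝ)) * G y a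

namespace ExpAsymp

variable {U : Set ℂ} {c : ℂ} {g : ℂ → ℂ} {f : ℝ → ℂ → ℂ}

theorem differentiableOn (h : ExpAsymp U c g f) : ∀ᶠ y in atTop, DifferentiableOn ℂ (f y) U := by
  obtain ⟨G, hd, _, he⟩ := h
  filter_upwards [hd, he] with y hy1 hy2
  have : DifferentiableOn ℂ (fun a => Complex.exp (c * a * y) * G y a) U :=
    DifferentiableOn.mul (by fun_prop) hy1
  exact this.congr hy2

/-- (cy)⁻¹ ∂ₐ(e^{cay} G_y) = e^{cay}(G_y + (cy)⁻¹ G_y'). By Weierstrass, G_y' converges locally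
uniformly too, so its contribution vanishes and the limit g is unchanged. -/
theorem deriv (hU : IsOpen U) (hc : c ≠ 0) (h : ExpAsymp U c g f) :
    ExpAsymp U c g fun y a => (c * (y : ℂ))⁻¹ * deriv (f y) a := by
  obtain ⟨G, hd, hl, he⟩ := h
  have hgd : DifferentiableOn ℂ g U := hl.differentiableOn hd hU
  refine ⟨fun y a => G y a + (c * (y : ℂ))⁻¹ * _root_.deriv (G y) a, ?_, ?_, ?_⟩
  · filter_upwards [hd] with y hy
    exact hy.add ((hy.deriv hU).const_mul _)
  · have h1 := hl.deriv hd hU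
    have h2 : TendstoLocallyUniformlyOn (fun (y : ℝ) (_ : ℂ) => (c * (y : ℂ))⁻¹)
        (fun _ => 0) atTop U := by
      have h3 : Tendsto (fun y : ℝ => (c * (y : ℂ))⁻¹) atTop (𝓝 0) := by
        have := (Complex.continuous_ofReal.tendsto 0).comp tendsto_inv_atTop_zero
        have h4 := this.const_mul c⁻¹
        simpa [Function.comp_def, mul_inv, mul_comm] using h4
      rw [Metric.tendstoLocallyUniformlyOn_iff]
      intro ε hε x _
      refine ⟨U, self_mem_nhdsWithin, ?_⟩
      filter_upwards [Metric.tendsto_nhds.1 h3 ε hε] with y hy a _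
      rwa [dist_comm]
    have h5 := hl.add (h2.mul₀ h1 continuousOn_const (hgd.deriv hU).continuousOn)
    have e : (g + (fun _ => 0) * _root_.deriv g) = g := by ext; simp
    rw [e] at h5
    exact h5
  · filter_upwards [hd, he, eventually_gt_atTop 0] with y hy1 hy2 hy0 a ha
    have hn := hU.mem_nhds ha
    have hcy : c * (y : ℂ) ≠ 0 := mul_ne_zero hc (Complex.ofReal_ne_zero.2 hy0.ne')
    have h1 : f y =ᶠ[𝓝 a] fun a => Complex.exp (c * a * y) * G y a := by
      filter_upwards [hn] with b hb using hy2 b hb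
    have h2 : HasDerivAt (fun a : ℂ => Complex.exp (c * a * y))
        (Complex.exp (c * a * y) * (c * y)) a := by
      have := ((hasDerivAt_id a).const_mul c).mul_const (y : ℂ)
      simpa using this.cexp
    rw [h1.deriv_eq, (h2.fun_mul (hy1.differentiableAt hn).hasDerivAt).deriv]
    linear_combination (Complex.exp (c * a * y) * G y a) * inv_mul_cancel₀ hcy

theorem iteratedDeriv (hU : IsOpen U) (hc : c ≠ 0) (h : ExpAsymp U c g f) (m : ℕ) :
    ExpAsymp U c g fun y a => ((c * (y : ℂ)) ^ m)⁻¹ * iteratedDeriv m (f y) a := by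
  induction m with
  | zero => simpa using h
  | succ m ih =>
    convert ih.deriv hU hc using 3 with y a
    rw [iteratedDeriv_succ, deriv_const_mul_field, pow_succ, mul_inv]
    ring

theorem isLittleO (hU : IsOpen U) (hc : c ≠ 0) (h : ExpAsymp U c g f) (m : ℕ) {α : ℂ}
    (hα : α ∈ U) :
    (fun y : ℝ => _root_.iteratedDeriv m (f y) α -
      c ^ m * g α * ((y : ℂ) ^ m * Complex.exp (c * α * y))) =o[atTop]
      fun y : ℝ => (y : ℂ) ^ m * Complex.exp (c * α * y) := by
  obtain ⟨G, _, hl, he⟩ := h.iteratedDeriv hU hc m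
  have h1 : Tendsto (fun y => G y α) atTop (𝓝 (g α)) := hl.tendsto_at hα
  have h2 : Tendsto (fun y => c ^ m * (G y α - g α)) atTop (𝓝 0) := by
    have := (h1.sub_const (g α)).const_mul (c ^ m)
    simpa using this
  have h3 := ((isLittleO_one_iff ℂ).2 h2).mul_isBigO
    (isBigO_refl (fun y : ℝ => (y : ℂ) ^ m * Complex.exp (c * α * y)) atTop)
  simp only [one_mul] at h3
  refine h3.congr' ?_ EventuallyEq.rfl
  filter_upwards [he, eventually_gt_atTop 0] with y hy hy0
  have hcy : (c * (y : ℂ)) ^ m ≠ 0 :=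
    pow_ne_zero _ (mul_ne_zero hc (Complex.ofReal_ne_zero.2 hy0.ne'))
  have h4 := hy α hα
  rw [inv_mul_eq_iff_eq_mul₀ hcy] at h4
  rw [h4, mul_pow]
  ring

end ExpAsymp

theorem ofReal_mul_mem_slitPlane {z : ℂ} (hz : z ∈ Complex.slitPlane) {y : ℝ} (hy : 0 < y) :
    z * y ∈ Complex.slitPlane := by
  rw [Complex.mem_slitPlane_iff] at hz ⊢
  simpa [hy, hy.ne'] using hz

theorem exists_norm_macdonaldFactor_sub_one_lt (η : ℂ) {ε : ℝ} (hε : 0 < ε) :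
    ∃ R : ℝ, ∀ z ∈ Complex.slitPlane, R ≤ ‖z‖ → ‖macdonaldFactor η z - 1‖ < ε := by
  have h := Metric.tendsto_nhds.1 (tendsto_macdonaldFactor η) ε hε
  rw [Filter.eventually_inf_principal, Filter.eventually_comap, Filter.eventually_atTop] at h
  obtain ⟨R, hR⟩ := h
  exact ⟨R, fun z hz hRz => by simpa [dist_eq_norm] using hR ‖z‖ hRz z rfl hz⟩

/-- The threshold for H to be close to 1 depends on |z| alone, and |a| is bounded below near any
point of U. -/
theorem tendstoLocallyUniformlyOn_macdonaldFactor (η : ℂ) {c : ℂ} (hc : ‖c‖ = 1) {U : Set ℂ}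
    (hU : ∀ a ∈ U, c * a ∈ Complex.slitPlane) :
    TendstoLocallyUniformlyOn (fun (y : ℝ) a => macdonaldFactor η (c * a * y)) (fun _ => 1)
      atTop U := by
  rw [Metric.tendstoLocallyUniformlyOn_iff]
  intro ε hε x hx
  obtain ⟨R, hR⟩ := exists_norm_macdonaldFactor_sub_one_lt η hε
  have hx0 : 0 < ‖x‖ := norm_pos_iff.2 fun h => Complex.slitPlane_ne_zero (hU x hx) (by simp [h])
  refine ⟨U ∩ {a | ‖x‖ / 2 < ‖a‖}, inter_mem_nhdsWithin _
    ((isOpen_lt continuous_const continuous_norm).mem_nhds (half_lt_self hx0)), ?_⟩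
  filter_upwards [eventually_gt_atTop 0, eventually_ge_atTop (R / (‖x‖ / 2))] with y hy0 hy a ha
  rw [dist_comm, dist_eq_norm]
  refine hR _ (ofReal_mul_mem_slitPlane (hU a ha.1) hy0) ?_
  rw [norm_mul, norm_mul, hc, one_mul, Complex.norm_real, Real.norm_of_nonneg hy0.le]
  rw [div_le_iff₀ (by positivity)] at hy
  have h1 : ‖x‖ / 2 < ‖a‖ := ha.2
  nlinarith

theorem invSqrt_mul_ofReal {a : ℂ} (ha : a ≠ 0) {y : ℝ} (hy : 0 < y) :
    ((Real.sqrt y : ℝ) : ℂ) * invSqrt (a * y) = invSqrt a := by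
  rw [invSqrt, invSqrt, mul_comm a, Complex.log_ofReal_mul hy ha, mul_add, Complex.exp_add,
    Real.sqrt_eq_rpow, Real.rpow_def_of_pos hy]
  push_cast
  rw [← mul_assoc, ← Complex.exp_add, show (Real.log y : ℂ) * (1 / 2) + -(1 / 2) * Real.log y = 0 by
    ring, Complex.exp_zero, one_mul]

theorem differentiableOn_macdonaldFactor_comp (η : ℂ) {c : ℂ} {U : Set ℂ}
    (hU : ∀ a ∈ U, c * a ∈ Complex.slitPlane) {y : ℝ} (hy : 0 < y) :
    DifferentiableOn ℂ (fun a => macdonaldFactor η (c * a * y)) U :=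
  (differentiableOn_macdonaldFactor_right η).comp (f := fun a => c * a * y) (by fun_prop)
    fun a ha => ofReal_mul_mem_slitPlane (hU a ha) hy

/-- The basic building block: `e^{∓ay} g(a) H(η, ± a y)`. -/
theorem expAsymp_macdonaldFactor (η : ℂ) {c : ℂ} (hc : ‖c‖ = 1) {U : Set ℂ}
    (hU : ∀ a ∈ U, c * a ∈ Complex.slitPlane) {g : ℂ → ℂ} (hg : DifferentiableOn ℂ g U) :
    ExpAsymp U (-c) g
      fun y a => Complex.exp (-(c * a * y)) * (g a * macdonaldFactor η (c * a * y)) := by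
  refine ⟨fun y a => g a * macdonaldFactor η (c * a * y), ?_, ?_, ?_⟩
  · filter_upwards [eventually_gt_atTop 0] with y hy
    exact hg.mul (differentiableOn_macdonaldFactor_comp η hU hy)
  · have h := (tendstoLocallyUniformlyOn_const (l := (atTop : Filter ℝ)) g U).mul₀
      (tendstoLocallyUniformlyOn_macdonaldFactor η hc hU) hg.continuousOn continuousOn_const
    have e : (g * fun _ => (1 : ℂ)) = g := by ext; simp
    rw [e] at h
    exact h
  · exact Eventually.of_forall fun y a _ => by
      rw [show -c * a * (y : ℂ) = -(c * a * y) by ring]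

theorem expAsymp_principalBesselK (η : ℂ) :
    ExpAsymp Complex.slitPlane (-1)
      (fun a => Real.pi / ((Real.sqrt (2 * Real.pi) : ℝ) : ℂ) * invSqrt a)
      fun y a => ((Real.sqrt y : ℝ) : ℂ) * principalBesselK η (a * y) := by
  obtain ⟨G, h1, h2, h3⟩ := expAsymp_macdonaldFactor η (c := 1) (by simp)
    (U := Complex.slitPlane) (by simp) (g := fun a => Real.pi / ((Real.sqrt (2 * Real.pi) : ℝ) : ℂ) *
      invSqrt a) (differentiableOn_invSqrt.const_mul _)
  refine ⟨G, h1, h2, ?_⟩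
  filter_upwards [h3, eventually_gt_atTop 0] with y hy hy0 a ha
  rw [← hy a ha, principalBesselK, ← invSqrt_mul_ofReal (Complex.slitPlane_ne_zero ha) hy0]
  simp only [one_mul]
  ring

/-- The two exponential parts of `I` off the real axis. -/
theorem exists_expAsymp_connectionI (τ η : ℂ) {U : Set ℂ} (hU : ∀ z ∈ U, z.im ≠ 0) :
    ∃ f₁ f₂ : ℝ → ℂ → ℂ,
      ExpAsymp U 1 (fun a => invSqrt a / ((Real.sqrt (2 * Real.pi) : ℝ) : ℂ)) f₁ ∧
      ExpAsymp U (-1) (fun a => invSqrt a / ((Real.sqrt (2 * Real.pi) : ℝ) : ℂ) *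
        (τ * Complex.I * Complex.exp (τ * Complex.I * Real.pi * η))) f₂ ∧
      ∀ y : ℝ, 0 < y → ∀ a ∈ U,
        ((Real.sqrt y : ℝ) : ℂ) * connectionI τ η (a * y) = f₁ y a + f₂ y a := by
  have hs : DifferentiableOn ℂ invSqrt U :=
    differentiableOn_invSqrt.mono fun z hz => mem_slitPlane_of_im_ne_zero (hU z hz)
  refine ⟨fun y a => Complex.exp (-(-1 * a * y)) * (invSqrt a /
    ((Real.sqrt (2 * Real.pi) : ℝ) : ℂ) * macdonaldFactor η (-1 * a * y)), _, ?_, expAsymp_macdonaldFactor η (c := 1) (by simp)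
    (fun a ha => by simpa using mem_slitPlane_of_im_ne_zero (hU a ha))
    ((hs.div_const _).mul_const _), fun y hy a ha => ?_⟩
  · have := expAsymp_macdonaldFactor η (c := -1) (by simp)
      (fun a ha => by simpa using neg_mem_slitPlane_of_im_ne_zero (hU a ha)) (hs.div_const
        ((Real.sqrt (2 * Real.pi) : ℝ) : ℂ))
    rwa [neg_neg] at this
  · have ha0 := Complex.slitPlane_ne_zero (mem_slitPlane_of_im_ne_zero (hU a ha))
    simp only [neg_mul, one_mul, neg_neg]
    rw [connectionI, ← invSqrt_mul_ofReal ha0 hy]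
    ring

theorem principalBesselI_eq_connectionI (η : ℂ) {z : ℂ} (hz : z.im ≠ 0) :
    ∃ τ : ℂ, (τ = 1 ∨ τ = -1) ∧ principalBesselI η z = connectionI τ η z := by
  rcases lt_or_gt_of_ne hz with h | h
  · exact ⟨-1, Or.inr rfl, principalBesselI_eq_of_im_neg η h⟩
  · exact ⟨1, Or.inl rfl, principalBesselI_eq_of_im_pos η h⟩

/-- A neighbourhood of a positive real point is needed in order to differentiate, yet the connection
formula has a different sign τ on each side and fails on the axis. For Re a > 0 the term containing
τ is exponentially small, and H(η,-ay) is near 1 uniformly up to its cut. -/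
theorem expAsymp_principalBesselI_of_re_pos (η : ℂ) :
    ExpAsymp {a | 0 < a.re} 1 (fun a => invSqrt a / ((Real.sqrt (2 * Real.pi) : ℝ) : ℂ))
      fun y a => ((Real.sqrt y : ℝ) : ℂ) * principalBesselI η (a * y) := by
  have hslit : ∀ a : ℂ, 0 < a.re → a ∈ Complex.slitPlane := fun a ha =>
    Complex.mem_slitPlane_iff.2 (Or.inl ha)
  set g : ℂ → ℂ := fun a => invSqrt a / ((Real.sqrt (2 * Real.pi) : ℝ) : ℂ) with hg
  have hgc : ContinuousOn g {a | 0 < a.re} :=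
    (differentiableOn_invSqrt.continuousOn.mono fun a ha => hslit a ha).div_const _
  set G : ℝ → ℂ → ℂ := fun y a =>
    Complex.exp (-(a * y)) * (((Real.sqrt y : ℝ) : ℂ) * principalBesselI η (a * y)) with hG
  have hGd : ∀ y : ℝ, 0 < y → DifferentiableOn ℂ (G y) {a | 0 < a.re} := by
    intro y hy
    refine DifferentiableOn.mul (by fun_prop) (DifferentiableOn.const_mul ?_ _)
    exact (differentiableOn_principalBesselI_right η).comp (f := fun a : ℂ => a * y) (by fun_prop)
      fun a ha => ofReal_mul_mem_slitPlane (hslit a ha) hy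
  refine ⟨G, ?_, ?_, Eventually.of_forall fun y a _ => ?_⟩
  · filter_upwards [eventually_gt_atTop 0] with y hy using hGd y hy
  · obtain ⟨C, hC⟩ : ∃ C : ℝ, ∀ τ : ℂ, (τ = 1 ∨ τ = -1) →
        ‖τ * Complex.I * Complex.exp (τ * Complex.I * Real.pi * η)‖ ≤ C := by
      refine ⟨max ‖1 * Complex.I * Complex.exp (1 * Complex.I * Real.pi * η)‖
        ‖-1 * Complex.I * Complex.exp (-1 * Complex.I * Real.pi * η)‖, ?_⟩
      rintro τ (rfl | rfl)
      · exact le_max_left _ _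
      · exact le_max_right _ _
    have hC0 : 0 ≤ C := (norm_nonneg _).trans (hC 1 (Or.inl rfl))
    rw [Metric.tendstoLocallyUniformlyOn_iff]
    intro ε hε x hx
    have hx' : 0 < x.re := hx
    have hx0 : 0 < ‖x‖ := norm_pos_iff.2 (Complex.slitPlane_ne_zero (hslit x hx))
    set B := ‖g x‖ + 1 with hB
    have hB0 : 0 < B := by positivity
    obtain ⟨R₁, hR₁⟩ := exists_norm_macdonaldFactor_sub_one_lt η
      (show 0 < min 1 (ε / (4 * B)) by positivity)
    have hdec : ∀ᶠ y : ℝ in atTop, Real.exp (-(x.re * y)) < ε / (4 * B * (2 * (C + 1))) := by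
      have h1 : Tendsto (fun y : ℝ => Real.exp (-(x.re * y))) atTop (𝓝 0) :=
        Real.tendsto_exp_neg_atTop_nhds_zero.comp (tendsto_id.const_mul_atTop hx')
      exact h1.eventually (gt_mem_nhds (by positivity))
    have hgx : {a | ‖g a‖ < B} ∈ 𝓝 x := by
      have hUo : IsOpen {a : ℂ | 0 < a.re} := isOpen_lt continuous_const Complex.continuous_re
      have h1 : ContinuousAt (fun a => ‖g a‖) x := (hgc.continuousAt (hUo.mem_nhds hx)).norm
      exact h1.eventually (gt_mem_nhds (by simp [hB]))
    obtain ⟨V, hVsub, hVo, hxV⟩ := mem_nhds_iff.1 (inter_mem hgx (inter_mem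
      ((isOpen_lt continuous_const continuous_norm).mem_nhds (half_lt_self hx0) :
        {a : ℂ | ‖x‖ / 2 < ‖a‖} ∈ 𝓝 x)
      ((isOpen_lt continuous_const Complex.continuous_re).mem_nhds
        (half_lt_self hx') : {a : ℂ | x.re / 2 < a.re} ∈ 𝓝 x)))
    refine ⟨V, mem_nhdsWithin_of_mem_nhds (hVo.mem_nhds hxV), ?_⟩
    filter_upwards [hdec, eventually_gt_atTop 0, eventually_ge_atTop (R₁ / (‖x‖ / 2))]
      with y hy1 hy0 hyR
    have hoff : ∀ a ∈ V, a.im ≠ 0 → dist (g a) (G y a) ≤ ε / 2 := by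
      intro a ha him
      obtain ⟨h1, h2, h3⟩ := hVsub ha
      have h1' : ‖g a‖ < B := h1
      have h2' : ‖x‖ / 2 < ‖a‖ := h2
      have h3' : x.re / 2 < a.re := h3
      have him' : (a * (y : ℂ)).im ≠ 0 := by simpa using ⟨him, hy0.ne'⟩
      obtain ⟨τ, hτ, hI⟩ := principalBesselI_eq_connectionI η him'
      have ha0 : a ≠ 0 := fun h => him (by simp [h])
      have hRa : R₁ ≤ ‖a * (y : ℂ)‖ := by
        rw [norm_mul, Complex.norm_real, Real.norm_of_nonneg hy0.le]
        rw [div_le_iff₀ (by positivity)] at hyR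
        nlinarith
      have b1 := hR₁ _ (neg_mem_slitPlane_of_im_ne_zero him') (by rwa [norm_neg])
      have b2 := hR₁ _ (mem_slitPlane_of_im_ne_zero him') hRa
      have b1' : ‖macdonaldFactor η (-(a * y)) - 1‖ ≤ ε / (4 * B) := b1.le.trans (min_le_right _ _)
      have b2' : ‖macdonaldFactor η (a * y)‖ ≤ 2 := by
        have h5 := norm_sub_norm_le (macdonaldFactor η (a * y)) 1
        rw [norm_one] at h5
        linarith [b2.le.trans (min_le_left _ _)]
      -- The exact error relative to g: the deviation of H from 1, and the Stokes term damped by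
      -- e^{-2ay}. Each is made at most about ε/(4B), whence the constants above.
      have e1 : G y a - g a = g a * ((macdonaldFactor η (-(a * y)) - 1) +
          τ * Complex.I * Complex.exp (τ * Complex.I * Real.pi * η) *
            (Complex.exp (-(2 * (a * y))) * macdonaldFactor η (a * y))) := by
        simp only [hG, hg]
        rw [hI, connectionI, ← invSqrt_mul_ofReal ha0 hy0]
        have e2 : Complex.exp (-(a * y)) * Complex.exp (a * y) = 1 := by
          rw [← Complex.exp_add, neg_add_cancel, Complex.exp_zero]
        have e3 : Complex.exp (-(2 * (a * y))) = Complex.exp (-(a * y)) * Complex.exp (-(a * y)) := by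
          rw [← Complex.exp_add]
          congr 1
          ring
        rw [e3]
        linear_combination (((Real.sqrt y : ℝ) : ℂ) * invSqrt (a * y) /
          ((Real.sqrt (2 * Real.pi) : ℝ) : ℂ) * macdonaldFactor η (-(a * y))) * e2
      have e4 : ‖Complex.exp (-(2 * (a * y)))‖ ≤ Real.exp (-(x.re * y)) := by
        rw [Complex.norm_exp]
        gcongr
        simp
        nlinarith
      rw [dist_comm, dist_eq_norm, e1, norm_mul]
      calc ‖g a‖ * _ ≤ B * (ε / (4 * B) + C * (ε / (4 * B * (2 * (C + 1))) * 2)) := by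
            gcongr
            refine (norm_add_le _ _).trans (add_le_add b1' ?_)
            rw [norm_mul, norm_mul (Complex.exp _)]
            gcongr
            · exact hC τ hτ
            · exact e4.trans hy1.le
        _ ≤ B * (ε / (4 * B) + (C + 1) * (ε / (4 * B * (2 * (C + 1))) * 2)) := by
            gcongr
            linarith
        _ = ε / 2 := by
            field_simp
            ring
    -- G y and g are continuous across the real axis, so the non-strict bound extends to real points
    -- by approaching them vertically; this is why ε/2 was kept in reserve.
    have hclosed : ∀ a ∈ V, dist (g a) (G y a) ≤ ε / 2 := by
      intro a ha
      have ha' : 0 < a.re := by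
        have h3 : x.re / 2 < a.re := (hVsub ha).2.2
        linarith
      have hUo : IsOpen {a : ℂ | 0 < a.re} := isOpen_lt continuous_const Complex.continuous_re
      have hcont : ContinuousAt (fun a => dist (g a) (G y a)) a :=
        (hgc.continuousAt (hUo.mem_nhds ha')).dist
          ((hGd y hy0).continuousOn.continuousAt (hUo.mem_nhds ha'))
      by_cases him : a.im = 0
      · have hpath : Tendsto (fun t : ℝ => a + t * Complex.I) (𝓝[≠] 0) (𝓝 a) := by
          have : Continuous fun t : ℝ => a + t * Complex.I := by fun_prop
          exact (this.tendsto' 0 a (by simp)).mono_left nhdsWithin_le_nhds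
        refine le_of_tendsto (hcont.tendsto.comp hpath) ?_
        filter_upwards [self_mem_nhdsWithin, hpath.eventually (hVo.mem_nhds ha)] with t ht htV
        exact hoff _ htV (by simpa [him] using ht)
      · exact hoff a ha him
    intro a ha
    exact (hclosed a ha).trans_lt (half_lt_self hε)
  · simp only [hG]
    rw [← mul_assoc, ← Complex.exp_add, one_mul, add_neg_cancel, Complex.exp_zero, one_mul]

/-! ### Calculus of two-term asymptotics -/

/-- `y^m e^{c y}`. -/
noncomputable def expTerm (m : ℕ) (c : ℂ) (y : ℝ) : ℂ := (y : ℂ) ^ m * Complex.exp (c * y)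

theorem norm_expTerm (m : ℕ) (c : ℂ) {y : ℝ} (hy : 0 ≤ y) :
    ‖expTerm m c y‖ = y ^ m * Real.exp (c.re * y) := by
  rw [expTerm, norm_mul, norm_pow, Complex.norm_real, Real.norm_of_nonneg hy, Complex.norm_exp]
  simp

/-- The size `y^m e^{|Re α| y}` of the larger one of the two exponentials. -/
noncomputable def domTerm (m : ℕ) (α : ℂ) (y : ℝ) : ℝ := y ^ m * Real.exp (|α.re| * y)

theorem expTerm_isBigO_domTerm (m : ℕ) {α c : ℂ} (hc : c.re ≤ |α.re|) :
    expTerm m c =O[atTop] domTerm m α := by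
  refine IsBigO.of_bound 1 ?_
  filter_upwards [eventually_ge_atTop 0] with y hy
  rw [norm_expTerm m c hy, one_mul, domTerm, Real.norm_of_nonneg (by positivity)]
  gcongr

theorem domTerm_isBigO_expTerm (m : ℕ) {α c : ℂ} (hc : |α.re| ≤ c.re) :
    domTerm m α =O[atTop] expTerm m c := by
  refine IsBigO.of_bound 1 ?_
  filter_upwards [eventually_ge_atTop 0] with y hy
  rw [norm_expTerm m c hy, one_mul, domTerm, Real.norm_of_nonneg (by positivity)]
  gcongr

theorem domTerm_isBigO_const_mul_expTerm (m : ℕ) {α c k : ℂ} (hc : |α.re| ≤ c.re) (hk : k ≠ 0) :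
    domTerm m α =O[atTop] fun y => k * expTerm m c y :=
  (domTerm_isBigO_expTerm m hc).trans (isBigO_const_mul_self k⁻¹ _ _ |>.congr_left fun y => by
    rw [inv_mul_cancel_left₀ hk])

theorem expTerm_isLittleO_domTerm (m : ℕ) {α c : ℂ} (hc : c.re < |α.re|) :
    expTerm m c =o[atTop] domTerm m α := by
  have h1 : Tendsto (fun y : ℝ => Real.exp (-((|α.re| - c.re) * y))) atTop (𝓝 0) :=
    Real.tendsto_exp_neg_atTop_nhds_zero.comp
      (tendsto_id.const_mul_atTop (sub_pos.2 hc))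
  have h2 := ((isLittleO_one_iff ℝ).2 h1).mul_isBigO (isBigO_refl (domTerm m α) atTop)
  simp only [one_mul] at h2
  refine IsBigO.trans_isLittleO ?_ h2
  refine IsBigO.of_bound 1 ?_
  filter_upwards [eventually_ge_atTop 0] with y hy
  rw [norm_expTerm m c hy, one_mul, domTerm, Real.norm_of_nonneg (by positivity)]
  refine le_of_eq ?_
  rw [mul_left_comm, ← Real.exp_add]
  congr 2
  ring

/-- `f = A y^m e^{α y} + B y^m e^{-α y}` up to an error that is small compared with the larger
exponential. -/
def TwoTermAsymp (m : ℕ) (α A B : ℂ) (f : ℝ → ℂ) : Prop :=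
  (fun y => f y - (A * expTerm m α y + B * expTerm m (-α) y)) =o[atTop] domTerm m α

/-- The whole error is charged to one term that is eventually nonzero and dominates it; all other εⱼ
are 0. -/
theorem asympTerms_of_isLittleO {α : ℂ} {f : ℝ → ℂ} {n : ℕ} {t : Fin n → ℝ → ℂ} (j₀ : Fin n)
    (hsum : (fun y => f y - ∑ j, t j y) =o[atTop] t j₀) (hne : ∀ᶠ y in atTop, t j₀ y ≠ 0)
    (hequiv : α.re ≠ 0 → f ~[atTop] fun y => ∑ j, t j y) : AsympTerms α f t := by
  refine ⟨⟨fun j y => if j = j₀ then (f y - ∑ j, t j y) / t j₀ y else 0, fun j => ?_, ?_⟩, hequiv⟩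
  · by_cases hj : j = j₀
    · simp only [hj, if_true]
      exact hsum.tendsto_div_nhds_zero
    · simp only [hj, if_false]
      exact tendsto_const_nhds
  · filter_upwards [hne] with y hy
    simp_rw [mul_add, mul_one, mul_ite, mul_zero]
    rw [Finset.sum_add_distrib, Finset.sum_ite_eq' Finset.univ j₀]
    simp only [Finset.mem_univ, if_true]
    rw [mul_div_cancel₀ _ hy]
    ring

namespace TwoTermAsymp

variable {m : ℕ} {α A B : ℂ} {f : ℝ → ℂ}

theorem congr' (h : TwoTermAsymp m α A B f) {f' : ℝ → ℂ} (hf : f =ᶠ[atTop] f') :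
    TwoTermAsymp m α A B f' :=
  IsLittleO.congr' h (by filter_upwards [hf] with y hy; rw [hy]) EventuallyEq.rfl

theorem const_mul (h : TwoTermAsymp m α A B f) (k : ℂ) :
    TwoTermAsymp m α (k * A) (k * B) fun y => k * f y :=
  (IsLittleO.const_mul_left h k).congr_left fun y => by ring

theorem add (h : TwoTermAsymp m α A B f) {A' B' : ℂ} {f' : ℝ → ℂ}
    (h' : TwoTermAsymp m α A' B' f') :
    TwoTermAsymp m α (A + A') (B + B') fun y => f y + f' y :=
  (IsLittleO.add h h').congr_left fun y => by ring

/-- For Re α > 0 the exponential e^{-αy} lies below the admitted error, so its coefficient may be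
replaced at will; this reconciles formulas that differ only in a recessive term. -/
theorem change_right (h : TwoTermAsymp m α A B f) (hα : 0 < α.re) (B' : ℂ) :
    TwoTermAsymp m α A B' f := by
  have h1 := (expTerm_isLittleO_domTerm m (α := α) (c := -α) (by
    rw [Complex.neg_re, abs_of_pos hα]; linarith)).const_mul_left (B - B')
  exact (IsLittleO.add h h1).congr_left fun y => by ring

theorem change_left (h : TwoTermAsymp m α A B f) (hα : α.re < 0) (A' : ℂ) :
    TwoTermAsymp m α A' B f := by
  have h1 := (expTerm_isLittleO_domTerm m (α := α) (c := α) (by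
    rw [abs_of_neg hα]; linarith)).const_mul_left (A - A')
  exact (IsLittleO.add h h1).congr_left fun y => by ring

theorem neg (h : TwoTermAsymp m α A B f) : TwoTermAsymp m (-α) B A f := by
  unfold TwoTermAsymp domTerm at *
  rw [neg_neg, Complex.neg_re, abs_neg]
  exact h.congr_left fun y => by ring

theorem domTerm_isBigO (h : α.re ≠ 0) (hA : 0 < α.re → A ≠ 0) (hB : α.re < 0 → B ≠ 0) :
    domTerm m α =O[atTop] fun y => A * expTerm m α y + B * expTerm m (-α) y := by
  rcases lt_or_gt_of_ne h with h0 | h0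
  · have h1 := domTerm_isBigO_const_mul_expTerm m (α := α) (c := -α) (k := B)
      (by rw [Complex.neg_re, abs_of_neg h0]) (hB h0)
    have h2 : (fun y => A * expTerm m α y) =o[atTop] fun y => B * expTerm m (-α) y :=
      ((expTerm_isLittleO_domTerm m (α := α) (c := α)
        (by rw [abs_of_neg h0]; linarith)).const_mul_left A).trans_isBigO h1
    refine h1.trans ?_
    have h3 := h2.right_isBigO_add
    exact h3.congr_right fun y => rfl
  · have h1 := domTerm_isBigO_const_mul_expTerm m (α := α) (c := α) (k := A)
      (by rw [abs_of_pos h0]) (hA h0)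
    have h2 : (fun y => B * expTerm m (-α) y) =o[atTop] fun y => A * expTerm m α y :=
      ((expTerm_isLittleO_domTerm m (α := α) (c := -α)
        (by rw [Complex.neg_re, abs_of_pos h0]; linarith)).const_mul_left B).trans_isBigO h1
    refine h1.trans ?_
    have h3 := h2.right_isBigO_add
    exact h3.congr_right fun y => add_comm _ _

theorem isEquivalent (h : TwoTermAsymp m α A B f) (h0 : α.re ≠ 0) (hA : 0 < α.re → A ≠ 0)
    (hB : α.re < 0 → B ≠ 0) : f ~[atTop] fun y => A * expTerm m α y + B * expTerm m (-α) y :=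
  IsLittleO.trans_isBigO h (domTerm_isBigO h0 hA hB)

theorem isTheta (h : TwoTermAsymp m α A B f) (h0 : α.re ≠ 0) (hA : 0 < α.re → A ≠ 0)
    (hB : α.re < 0 → B ≠ 0) : (fun y => ‖f y‖) =Θ[atTop] domTerm m α := by
  refine IsTheta.norm_left ((h.isEquivalent h0 hA hB).isTheta.trans ⟨?_, domTerm_isBigO h0 hA hB⟩)
  refine ((expTerm_isBigO_domTerm m (le_abs_self _)).const_mul_left A).add
    ((expTerm_isBigO_domTerm m ?_).const_mul_left B)
  rw [Complex.neg_re]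
  exact neg_le_abs _

theorem asympTerms (h : TwoTermAsymp m α A B f) {n : ℕ} {t : Fin n → ℝ → ℂ}
    (ht : ∀ y, ∑ j, t j y = A * expTerm m α y + B * expTerm m (-α) y) (j₀ : Fin n)
    (hj₀ : domTerm m α =O[atTop] t j₀) (hA : 0 < α.re → A ≠ 0) (hB : α.re < 0 → B ≠ 0) :
    AsympTerms α f t := by
  refine asympTerms_of_isLittleO j₀
    ((IsLittleO.congr_left h fun y => by rw [ht]).trans_isBigO hj₀) ?_ fun h0 =>
    (h.isEquivalent h0 hA hB).congr_right (Eventually.of_forall fun y => (ht y).symm)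
  filter_upwards [hj₀.eq_zero_imp, eventually_gt_atTop 0] with y hy hy0 h0
  have h2 : 0 < domTerm m α y := by
    rw [domTerm]
    positivity
  exact h2.ne' (hy h0)

end TwoTermAsymp

/-! ### Asymptotics of the principal branches -/

/-- `y^{1/2} ∂_a^m [F (a y)]` at `a = α`. -/
noncomputable def scaledDeriv (F : ℂ → ℂ) (m : ℕ) (α : ℂ) (y : ℝ) : ℂ :=
  ((Real.sqrt y : ℝ) : ℂ) * iteratedDeriv m (fun a : ℂ => F (a * (y : ℂ))) α

theorem scaledDeriv_eq (F : ℂ → ℂ) (m : ℕ) (α : ℂ) (y : ℝ) :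
    scaledDeriv F m α y =
      iteratedDeriv m (fun a : ℂ => ((Real.sqrt y : ℝ) : ℂ) * F (a * (y : ℂ))) α := by
  rw [scaledDeriv, iteratedDeriv_const_mul_field]

theorem iteratedDeriv_add_of_differentiableOn {U : Set ℂ} (hU : IsOpen U) {f g : ℂ → ℂ}
    (hf : DifferentiableOn ℂ f U) (hg : DifferentiableOn ℂ g U) (m : ℕ) {α : ℂ} (hα : α ∈ U) :
    iteratedDeriv m (fun a => f a + g a) α = iteratedDeriv m f α + iteratedDeriv m g α :=
  iteratedDeriv_fun_add ((hf.contDiffOn hU).contDiffAt (hU.mem_nhds hα))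
    ((hg.contDiffOn hU).contDiffAt (hU.mem_nhds hα))

theorem twoTermAsymp_of_expAsymp_one {U : Set ℂ} (hU : IsOpen U) {g : ℂ → ℂ} {f : ℝ → ℂ → ℂ}
    (h : ExpAsymp U 1 g f) (m : ℕ) {α : ℂ} (hα : α ∈ U) :
    TwoTermAsymp m α (g α) 0 fun y => iteratedDeriv m (f y) α := by
  have h1 := h.isLittleO hU one_ne_zero m hα
  have h2 : expTerm m α =O[atTop] domTerm m α := expTerm_isBigO_domTerm m (le_abs_self _)
  simp only [one_mul, one_pow] at h1
  exact (h1.trans_isBigO h2).congr_left fun y => by rw [expTerm]; ring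

theorem twoTermAsymp_of_expAsymp_neg_one {U : Set ℂ} (hU : IsOpen U) {g : ℂ → ℂ}
    {f : ℝ → ℂ → ℂ} (h : ExpAsymp U (-1) g f) (m : ℕ) {α : ℂ} (hα : α ∈ U) :
    TwoTermAsymp m α 0 ((-1) ^ m * g α) fun y => iteratedDeriv m (f y) α := by
  have h1 := h.isLittleO hU (by norm_num) m hα
  have h2 : expTerm m (-α) =O[atTop] domTerm m α :=
    expTerm_isBigO_domTerm m (by rw [Complex.neg_re]; exact neg_le_abs _)
  simp only [neg_mul, one_mul] at h1
  refine (h1.trans_isBigO ?_).congr_left fun y => ?_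
  · refine h2.congr_left fun y => ?_
    rw [expTerm, neg_mul]
  · simp only [expTerm, neg_mul]
    ring

/-- The amplitude `1 / √(2 π α)`. -/
noncomputable def amplitude (α : ℂ) : ℂ := invSqrt α / ((Real.sqrt (2 * Real.pi) : ℝ) : ℂ)

theorem amplitude_ne_zero (α : ℂ) : amplitude α ≠ 0 :=
  div_ne_zero (Complex.exp_ne_zero _) (Complex.ofReal_ne_zero.2 (by positivity))

/-- The sign in the Stokes multiplier `e^{± iπ(η + 1/2)}` of the second exponential of `I_η`. -/
def StokesSign (α τ : ℂ) : Prop :=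
  (τ = 1 ∧ -(Real.pi / 2) < α.arg) ∨ (τ = -1 ∧ α.arg ≤ -(Real.pi / 2))

theorem twoTermAsymp_principalBesselI_of_im_ne_zero (η τ : ℂ) (m : ℕ) {U : Set ℂ} (hU : IsOpen U)
    (him : ∀ z ∈ U, z.im ≠ 0) (hscale : ∀ z ∈ U, ∀ y : ℝ, 0 < y → z * y ∈ U)
    (hI : ∀ z ∈ U, principalBesselI η z = connectionI τ η z) {α : ℂ} (hα : α ∈ U) :
    TwoTermAsymp m α (amplitude α) ((-1) ^ m * (amplitude α *
      (τ * Complex.I * Complex.exp (τ * Complex.I * Real.pi * η))))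
      (scaledDeriv (principalBesselI η) m α) := by
  obtain ⟨f₁, f₂, h1, h2, h3⟩ := exists_expAsymp_connectionI τ η him
  have hs := (twoTermAsymp_of_expAsymp_one hU h1 m hα).add
    (twoTermAsymp_of_expAsymp_neg_one hU h2 m hα)
  rw [add_zero, zero_add] at hs
  refine hs.congr' ?_
  filter_upwards [h1.differentiableOn, h2.differentiableOn, eventually_gt_atTop 0]
    with y hy1 hy2 hy0
  rw [scaledDeriv_eq, ← iteratedDeriv_add_of_differentiableOn hU hy1 hy2 m hα]
  refine Filter.EventuallyEq.iteratedDeriv_eq m ?_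
  filter_upwards [hU.mem_nhds hα] with a ha
  rw [← h3 y hy0 a ha, hI _ (hscale a ha y hy0)]

theorem twoTermAsymp_principalBesselI_of_re_pos (η : ℂ) (m : ℕ) {α : ℂ} (hα : 0 < α.re) :
    TwoTermAsymp m α (amplitude α) 0 (scaledDeriv (principalBesselI η) m α) := by
  refine (twoTermAsymp_of_expAsymp_one (isOpen_lt continuous_const Complex.continuous_re)
    (expAsymp_principalBesselI_of_re_pos η) m hα).congr' (Eventually.of_forall fun y => ?_)
  rw [scaledDeriv_eq]

/-- If Re α > 0 the coefficient carrying τ is irrelevant. Otherwise α is off the real axis, and the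
condition on its argument says precisely which half plane contains it. -/
theorem twoTermAsymp_principalBesselI (η : ℂ) (m : ℕ) {α τ : ℂ} (hα : α ∈ Complex.slitPlane)
    (hτ : StokesSign α τ) :
    TwoTermAsymp m α (amplitude α) ((-1) ^ m * (amplitude α *
      (τ * Complex.I * Complex.exp (τ * Complex.I * Real.pi * η))))
      (scaledDeriv (principalBesselI η) m α) := by
  by_cases hre : 0 < α.re
  · exact (twoTermAsymp_principalBesselI_of_re_pos η m hre).change_right hre _
  · have him : α.im ≠ 0 := (Complex.mem_slitPlane_iff.1 hα).resolve_left hre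
    rcases hτ with ⟨rfl, h⟩ | ⟨rfl, h⟩
    · have h1 := (Complex.neg_pi_div_two_lt_arg_iff.1 h).resolve_left hre
      exact twoTermAsymp_principalBesselI_of_im_ne_zero η 1 m (U := {z : ℂ | 0 < z.im})
        (isOpen_lt continuous_const Complex.continuous_im) (fun z hz => ne_of_gt hz)
        (fun z hz y hy => by
          have : 0 < z.im := hz
          simpa using mul_pos this hy)
        (fun z hz => principalBesselI_eq_of_im_pos η hz) (lt_of_le_of_ne h1 him.symm)
    · have h1 : α.im < 0 := by
        by_contra! hcon
        exact absurd (Complex.neg_pi_div_two_lt_arg_iff.2 (Or.inr hcon)) (not_lt.2 h)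
      exact twoTermAsymp_principalBesselI_of_im_ne_zero η (-1) m (U := {z : ℂ | z.im < 0})
        (isOpen_lt Complex.continuous_im continuous_const) (fun z hz => ne_of_lt hz)
        (fun z hz y hy => by
          have : z.im < 0 := hz
          simpa using mul_neg_of_neg_of_pos this hy)
        (fun z hz => principalBesselI_eq_of_im_neg η hz) h1

/-- The error is measured against e^{-αy} itself, even where that exponential is recessive. This is
stronger than `TwoTermAsymp` and is what the decay of K requires. -/
theorem isLittleO_principalBesselK (η : ℂ) (m : ℕ) {α : ℂ} (hα : α ∈ Complex.slitPlane) :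
    (fun y => scaledDeriv (principalBesselK η) m α y -
      (-1) ^ m * (Real.pi * amplitude α) * expTerm m (-α) y) =o[atTop] expTerm m (-α) := by
  have h := (expAsymp_principalBesselK η).isLittleO Complex.isOpen_slitPlane (by norm_num) m hα
  simp only [neg_mul, one_mul] at h
  refine IsLittleO.congr h (fun y => ?_) (fun y => ?_)
  · rw [scaledDeriv_eq, amplitude, expTerm, neg_mul]
    ring
  · rw [expTerm, neg_mul]

theorem twoTermAsymp_principalBesselK (η : ℂ) (m : ℕ) {α : ℂ} (hα : α ∈ Complex.slitPlane) :
    TwoTermAsymp m α 0 ((-1) ^ m * (Real.pi * amplitude α))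
      (scaledDeriv (principalBesselK η) m α) := by
  have h2 : expTerm m (-α) =O[atTop] domTerm m α :=
    expTerm_isBigO_domTerm m (by rw [Complex.neg_re]; exact neg_le_abs _)
  exact ((isLittleO_principalBesselK η m hα).trans_isBigO h2).congr_left fun y => by ring

theorem scaledDeriv_congr {F G : ℂ → ℂ} (m : ℕ) {α : ℂ} {y : ℝ}
    (h : ∀ᶠ a in 𝓝 α, F (a * y) = G (a * y)) : scaledDeriv F m α y = scaledDeriv G m α y := by
  rw [scaledDeriv, scaledDeriv, Filter.EventuallyEq.iteratedDeriv_eq m h]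

theorem scaledDeriv_const_mul (k : ℂ) (F : ℂ → ℂ) (m : ℕ) (α : ℂ) (y : ℝ) :
    scaledDeriv (fun z => k * F z) m α y = k * scaledDeriv F m α y := by
  rw [scaledDeriv, scaledDeriv, iteratedDeriv_const_mul_field]
  ring

theorem scaledDeriv_comp_neg (F : ℂ → ℂ) (m : ℕ) (α : ℂ) (y : ℝ) :
    scaledDeriv (fun z => F (-z)) m α y = (-1) ^ m * scaledDeriv F m (-α) y := by
  have h := iteratedDeriv_comp_neg m (fun a : ℂ => F (a * y)) α
  simp only [neg_mul] at h
  rw [scaledDeriv, scaledDeriv, h, smul_eq_mul]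
  ring

theorem scaledDeriv_comp_sign {ε : ℂ} (hε : ε = 1 ∨ ε = -1) (F : ℂ → ℂ) (m : ℕ) (α : ℂ) (y : ℝ) :
    scaledDeriv (fun z => F (ε * z)) m α y = ε ^ m * scaledDeriv F m (ε * α) y := by
  rcases hε with rfl | rfl
  · simp
  · simpa using scaledDeriv_comp_neg F m α y

theorem scaledDeriv_add {F G : ℂ → ℂ} (hF : DifferentiableOn ℂ F Complex.slitPlane)
    (hG : DifferentiableOn ℂ G Complex.slitPlane) (m : ℕ) {α : ℂ} (hα : α ∈ Complex.slitPlane)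
    {y : ℝ} (hy : 0 < y) :
    scaledDeriv (fun z => F z + G z) m α y = scaledDeriv F m α y + scaledDeriv G m α y := by
  rw [scaledDeriv, scaledDeriv, scaledDeriv, ← mul_add]
  congr 1
  refine iteratedDeriv_add_of_differentiableOn Complex.isOpen_slitPlane ?_ ?_ m hα
  · exact hF.comp (f := fun a : ℂ => a * y) (by fun_prop) fun a ha => ofReal_mul_mem_slitPlane ha hy
  · exact hG.comp (f := fun a : ℂ => a * y) (by fun_prop) fun a ha => ofReal_mul_mem_slitPlane ha hy

/-! ### Local comparison with the principal branch -/

/-- Near `α` the branch of `I` is a multiple of the principal branch, up to a reflection. -/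
def LocalBranch (ω α ε κ : ℂ) : Prop :=
  (ε = 1 ∨ ε = -1) ∧ ε * α ∈ Complex.slitPlane ∧ ∀ᶠ a in 𝓝 α, ∀ y : ℝ, 0 < y → ∀ ξ : ℂ,
    besselI ω ξ (a * y) = Complex.exp (-(ξ * κ)) * principalBesselI ξ (ε * (a * y))

namespace LocalBranch

variable {ω α ε κ : ℂ}

theorem scaledDeriv_besselI (h : LocalBranch ω α ε κ) (η : ℂ) (m : ℕ) {y : ℝ} (hy : 0 < y) :
    scaledDeriv (besselI ω η) m α y =
      Complex.exp (-(η * κ)) * (ε ^ m * scaledDeriv (principalBesselI η) m (ε * α) y) := by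
  rw [← scaledDeriv_comp_sign h.1, ← scaledDeriv_const_mul]
  refine scaledDeriv_congr m ?_
  filter_upwards [h.2.2] with a ha using ha y hy η

theorem scaledDeriv_besselK (h : LocalBranch ω α ε κ) {M : ℂ → ℂ} (hM : Continuous M)
    (hMs : ∀ ξ, M ξ * Complex.sin (ξ * Real.pi) =
      Real.pi / 2 * (Complex.exp (ξ * κ) - Complex.exp (-(ξ * κ)))) (η : ℂ) (m : ℕ) {y : ℝ}
    (hy : 0 < y) :
    scaledDeriv (besselK ω η) m α y =
      ε ^ m * (Complex.exp (-(η * κ)) * scaledDeriv (principalBesselK η) m (ε * α) y +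
        M η * scaledDeriv (principalBesselI (-η)) m (ε * α) y) := by
  rw [← scaledDeriv_const_mul, ← scaledDeriv_const_mul, ← scaledDeriv_add
    ((differentiableOn_principalBesselK_right η).const_mul _)
    ((differentiableOn_principalBesselI_right (-η)).const_mul _) m h.2.1 hy,
    ← scaledDeriv_comp_sign h.1]
  refine scaledDeriv_congr m ?_
  have hcont : ContinuousAt (fun a : ℂ => ε * a) α := by fun_prop
  filter_upwards [h.2.2, hcont.eventually (Complex.isOpen_slitPlane.mem_nhds h.2.1)] with a ha has
  refine besselK_eq_add (fun ξ => ha y hy ξ) ?_ hM hMs η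
  rw [← mul_assoc]
  exact ofReal_mul_mem_slitPlane has hy

end LocalBranch

theorem arg_ne_zero_of_not_nonneg {ω : ℂ} (hω : ∀ r : ℝ, 0 ≤ r → ω ≠ (r : ℂ)) : ω.arg ≠ 0 := by
  intro h
  obtain ⟨h1, h2⟩ := Complex.arg_eq_zero_iff.1 h
  exact hω ω.re h1 (Complex.ext (by simp) (by simpa using h2))

theorem sgnArg_of_pos {ω : ℂ} (h : 0 < ω.arg) : sgnArg ω = 1 := by
  rw [sgnArg, Real.sign_of_pos h, Complex.ofReal_one]

theorem sgnArg_of_neg {ω : ℂ} (h : ω.arg < 0) : sgnArg ω = -1 := by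
  rw [sgnArg, Real.sign_of_neg h, Complex.ofReal_neg, Complex.ofReal_one]

theorem ne_zero_and_arg_ne {ω α : ℂ} (hω : ∀ r : ℝ, 0 ≤ r → ω ≠ (r : ℂ))
    (hα : ∀ r : ℝ, 0 ≤ r → α ≠ ω * (r : ℂ)) : α ≠ 0 ∧ α.arg ≠ ω.arg := by
  have h0 : ω ≠ 0 := by simpa using hω 0 le_rfl
  have hα0 : α ≠ 0 := by simpa using hα 0 le_rfl
  refine ⟨hα0, fun h => ?_⟩
  have h1 := (Complex.arg_eq_arg_iff h0 hα0).1 h.symm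
  refine hα (‖α‖ / ‖ω‖) (by positivity) ?_
  refine h1.symm.trans ?_
  push_cast
  ring

theorem mem_Omega_iff_of_pos {ω : ℂ} (h : 0 < ω.arg) (z : ℂ) : z.arg ∈ Omega ω ↔ z.arg < ω.arg := by
  rw [Omega, if_pos h]
  exact ⟨fun h => h.2, fun h => ⟨Complex.neg_pi_lt_arg z, h⟩⟩

theorem mem_Omega_iff_of_neg {ω : ℂ} (h : ω.arg < 0) (z : ℂ) : z.arg ∈ Omega ω ↔ ω.arg < z.arg := by
  rw [Omega, if_neg h.le.not_gt]
  exact ⟨fun h => h.1, fun h => ⟨h, Complex.arg_le_pi z⟩⟩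

theorem eventually_mem_Omega_iff {ω α : ℂ} (h0 : ω.arg ≠ 0) (hne : α.arg ≠ ω.arg)
    (hα : α ∈ Complex.slitPlane) : ∀ᶠ a in 𝓝 α, (a.arg ∈ Omega ω ↔ α.arg ∈ Omega ω) := by
  have hc := Complex.continuousAt_arg hα
  rcases lt_or_gt_of_ne h0 with h | h
  · simp_rw [mem_Omega_iff_of_neg h]
    rcases lt_or_gt_of_ne hne with h1 | h1
    · filter_upwards [hc.eventually (gt_mem_nhds h1)] with a ha
      exact iff_of_false ha.le.not_gt h1.le.not_gt
    · filter_upwards [hc.eventually (lt_mem_nhds h1)] with a ha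
      exact iff_of_true ha h1
  · simp_rw [mem_Omega_iff_of_pos h]
    rcases lt_or_gt_of_ne hne with h1 | h1
    · filter_upwards [hc.eventually (gt_mem_nhds h1)] with a ha
      exact iff_of_true ha h1
    · filter_upwards [hc.eventually (lt_mem_nhds h1)] with a ha
      exact iff_of_false ha.le.not_gt h1.le.not_gt

theorem besselI_eq_of_branchLog {ω z w κ : ℂ} (h : branchLog ω (z / 2) = Complex.log (w / 2) - κ)
    (hw : w = z ∨ w = -z) (ξ : ℂ) :
    besselI ω ξ z = Complex.exp (-(ξ * κ)) * principalBesselI ξ w := by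
  have hS : besselSeries ξ w = besselSeries ξ z := by
    rcases hw with rfl | rfl
    · rfl
    · exact besselSeries_neg ξ z
  rw [besselI, h, principalBesselI, hS, besselSeries, ← mul_assoc, ← Complex.exp_add]
  congr 2
  ring

theorem arg_mul_div_two (a : ℂ) {y : ℝ} (hy : 0 < y) : (a * y / 2).arg = a.arg := by
  rw [show a * (y : ℂ) / 2 = a * ((y / 2 : ℝ) : ℂ) by push_cast; ring,
    Complex.arg_mul_real (by positivity)]

-- Away from the negative axis and the cut, membership of arg a in Ω_ω is locally constant and
-- unaffected by positive scaling, so one constant shift of the logarithm serves a whole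
-- neighbourhood.
open Classical in
theorem localBranch_of_mem_slitPlane {ω α : ℂ} (h0 : ω.arg ≠ 0) (hne : α.arg ≠ ω.arg)
    (hα : α ∈ Complex.slitPlane) :
    LocalBranch ω α 1 (if α.arg ∈ Omega ω then 0 else 2 * Real.pi * Complex.I * sgnArg ω) := by
  refine ⟨Or.inl rfl, by rwa [one_mul], ?_⟩
  filter_upwards [eventually_mem_Omega_iff h0 hne hα] with a ha y hy ξ
  refine besselI_eq_of_branchLog ?_ (Or.inl (one_mul _)) ξ
  rw [branchLog, arg_mul_div_two a hy, one_mul]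
  by_cases h : α.arg ∈ Omega ω
  · rw [if_pos (ha.2 h), if_pos h, sub_zero]
  · rw [if_neg (fun h1 => h (ha.1 h1)), if_neg h]

theorem log_neg_of_re_neg_of_im_nonneg {z : ℂ} (hre : z.re < 0) (him : 0 ≤ z.im) :
    Complex.log (-z) = Complex.log z - Real.pi * Complex.I := by
  have harg : (-z).arg = z.arg - Real.pi := by
    rcases eq_or_lt_of_le him with h | h
    · have h1 : z = ((z.re : ℝ) : ℂ) := Complex.ext (by simp) (by simp [← h])
      rw [h1, ← Complex.ofReal_neg, Complex.arg_ofReal_of_nonneg (by linarith),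
        Complex.arg_ofReal_of_neg hre, sub_self]
    · exact Complex.arg_neg_eq_arg_sub_pi_of_im_pos h
  rw [Complex.log, Complex.log, norm_neg, harg]
  push_cast
  ring

/-- The principal logarithm jumps at α but the one with cut ωℝ≥0 does not: whichever side of the
negative axis lies in Ω_ω, the two prescriptions both amount to Log(-z) - πiσ. -/
theorem localBranch_of_neg {ω α : ℂ} (h0 : ω.arg ≠ 0) (hpi : ω.arg ≠ Real.pi) (hre : α.re < 0)
    (him : α.im = 0) : LocalBranch ω α (-1) (Real.pi * Complex.I * sgnArg ω) := by
  have hαpi : (-α) ∈ Complex.slitPlane := Complex.mem_slitPlane_iff.2 (Or.inl (by simpa using hre))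
  have hreO : ∀ᶠ a : ℂ in 𝓝 α, a.re < 0 :=
    Complex.continuous_re.continuousAt.eventually (gt_mem_nhds hre)
  have hargO : ∀ᶠ a : ℂ in 𝓝 α, (0 ≤ a.im → |ω.arg| < a.arg) ∧ (a.im < 0 → a.arg < -|ω.arg|) := by
    have h1 : Tendsto (fun a : ℂ => (-a).arg) (𝓝 α) (𝓝 0) := by
      have h2 : ContinuousAt (fun a : ℂ => (-a).arg) α :=
        ContinuousAt.comp (f := fun a : ℂ => -a) (Complex.continuousAt_arg hαpi) (by fun_prop)
      have h3 : (-α).arg = 0 := Complex.arg_eq_zero_iff.2 ⟨by simpa using hre.le, by simp [him]⟩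
      rw [ContinuousAt, h3] at h2
      exact h2
    have hlt : |ω.arg| < Real.pi := lt_of_le_of_ne (Complex.abs_arg_le_pi ω) fun h => by
      rcases abs_eq (Real.pi_pos.le) |>.1 h with h | h
      · exact hpi h
      · exact absurd (Complex.neg_pi_lt_arg ω) (by rw [h]; exact lt_irrefl _)
    filter_upwards [Metric.tendsto_nhds.1 h1 _ (sub_pos.2 hlt), hreO] with a ha hare
    rw [dist_zero_right, Real.norm_eq_abs, abs_lt] at ha
    refine ⟨fun hi => ?_, fun hi => ?_⟩
    · have h4 := congrArg Complex.im (log_neg_of_re_neg_of_im_nonneg hare hi)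
      simp [Complex.log_im] at h4
      linarith [ha.1]
    · have h4 := congrArg Complex.im (log_neg_of_im_neg hi)
      simp [Complex.log_im] at h4
      linarith [ha.2]
  refine ⟨Or.inr rfl, by simpa using hαpi, ?_⟩
  filter_upwards [hreO, hargO] with a hare haarg y hy ξ
  refine besselI_eq_of_branchLog ?_ (Or.inr (by ring)) ξ
  have hzre : (a * (y : ℂ) / 2).re < 0 := by
    simpa using div_neg_of_neg_of_pos (mul_neg_of_neg_of_pos hare hy) two_pos
  have e : -1 * (a * (y : ℂ)) / 2 = -(a * y / 2) := by ring
  rw [branchLog, arg_mul_div_two a hy, e]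
  rcases le_or_gt 0 a.im with hi | hi
  · have hl := log_neg_of_re_neg_of_im_nonneg hzre (by
      simpa using div_nonneg (mul_nonneg hi hy.le) zero_le_two)
    have h5 := haarg.1 hi
    rcases lt_or_gt_of_ne h0 with h | h
    · rw [if_pos ((mem_Omega_iff_of_neg h a).2 (by linarith [abs_nonneg ω.arg])), hl,
        sgnArg_of_neg h]
      ring
    · rw [if_neg (fun hm => by
        linarith [(mem_Omega_iff_of_pos h a).1 hm, le_abs_self ω.arg]), hl, sgnArg_of_pos h]
      ring
  · have hl := log_neg_of_im_neg (z := a * (y : ℂ) / 2) (by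
      simpa using div_neg_of_neg_of_pos (mul_neg_of_neg_of_pos hi hy) two_pos)
    have h5 := haarg.2 hi
    rcases lt_or_gt_of_ne h0 with h | h
    · rw [if_neg (fun hm => by
        linarith [(mem_Omega_iff_of_neg h a).1 hm, neg_abs_le ω.arg]), hl, sgnArg_of_neg h]
      ring
    · rw [if_pos ((mem_Omega_iff_of_pos h a).2 (by linarith [abs_nonneg ω.arg])), hl,
        sgnArg_of_pos h]
      ring

/-! ### Coefficients and asymptotics on the branch with cut ωℝ≥0 -/

open Classical in
/-- The exponent `κ` in the factor `e^{-ηκ}` relating the branch of `I_η` to the principal one. -/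
noncomputable def branchShift (ω α : ℂ) : ℂ :=
  if α.arg ∈ Omega ω then 0 else 2 * Real.pi * Complex.I * sgnArg ω

theorem invSqrt_ofReal_mul {r : ℝ} (hr : 0 < r) {α : ℂ} (hα : α ≠ 0) :
    invSqrt (r * α) = invSqrt α / ((Real.sqrt r : ℝ) : ℂ) := by
  have h := invSqrt_mul_ofReal hα hr
  rw [eq_div_iff (Complex.ofReal_ne_zero.2 (Real.sqrt_pos.2 hr).ne'), ← h, mul_comm α]
  ring

theorem invSqrt_two_pi_mul {α : ℂ} (hα : α ≠ 0) :
    invSqrt (2 * (Real.pi : ℂ) * α) = amplitude α := by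
  have h := invSqrt_ofReal_mul (r := 2 * Real.pi) (by positivity) hα
  push_cast at h
  exact h

theorem sqrt_pi_mul_invSqrt_two_mul {α : ℂ} (hα : α ≠ 0) :
    ((Real.sqrt Real.pi : ℝ) : ℂ) * invSqrt (2 * α) = Real.pi * amplitude α := by
  have h := invSqrt_ofReal_mul two_pos hα
  rw [Complex.ofReal_ofNat] at h
  have h1 : ((Real.sqrt Real.pi : ℝ) : ℂ) * ((Real.sqrt Real.pi : ℝ) : ℂ) = Real.pi := by
    rw [← Complex.ofReal_mul, Real.mul_self_sqrt Real.pi_pos.le]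
  have h2 : ((Real.sqrt Real.pi : ℝ) : ℂ) ≠ 0 := Complex.ofReal_ne_zero.2 (by positivity)
  rw [h, amplitude, Real.sqrt_mul (by norm_num), Complex.ofReal_mul, ← h1]
  field_simp

theorem sqrt_two_pi_mul_invSqrt (α : ℂ) :
    ((Real.sqrt (2 * Real.pi) : ℝ) : ℂ) * invSqrt α = 2 * Real.pi * amplitude α := by
  have h1 : ((Real.sqrt (2 * Real.pi) : ℝ) : ℂ) * ((Real.sqrt (2 * Real.pi) : ℝ) : ℂ) =
      2 * Real.pi := by
    rw [← Complex.ofReal_mul, Real.mul_self_sqrt (by positivity)]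
    push_cast
    ring
  have h2 : ((Real.sqrt (2 * Real.pi) : ℝ) : ℂ) ≠ 0 := Complex.ofReal_ne_zero.2 (by positivity)
  rw [amplitude, ← h1]
  field_simp

theorem amplitude_neg {α : ℂ} (hre : α.re < 0) (him : α.im = 0) :
    amplitude (-α) = Complex.I * amplitude α := by
  rw [amplitude, amplitude, invSqrt, invSqrt, log_neg_of_re_neg_of_im_nonneg hre him.ge, mul_sub,
    Complex.exp_sub, show -(1 / 2) * (Real.pi * Complex.I) = -(Real.pi / 2 * Complex.I) by ring,
    Complex.exp_neg, Complex.exp_pi_div_two_mul_I, div_inv_eq_mul]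
  ring

theorem exp_I_mul_pi_mul (s : ℂ) : Complex.exp (Complex.I * Real.pi * s) =
    Complex.I * Complex.exp (Complex.I * Real.pi * (s - 1 / 2)) := by
  rw [show Complex.I * Real.pi * s = Real.pi / 2 * Complex.I + Complex.I * Real.pi * (s - 1 / 2) by
    ring, Complex.exp_add, Complex.exp_pi_div_two_mul_I]

theorem exp_neg_I_mul_pi_mul (s : ℂ) : Complex.exp (-Complex.I * Real.pi * s) =
    -Complex.I * Complex.exp (-Complex.I * Real.pi * (s - 1 / 2)) := by
  rw [show -Complex.I * Real.pi * s =
    -(Real.pi / 2 * Complex.I) + -Complex.I * Real.pi * (s - 1 / 2) by ring, Complex.exp_add,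
    Complex.exp_neg, Complex.exp_pi_div_two_mul_I, Complex.inv_I]

theorem sin_pi_mul_eq_cos_sub_half (s : ℂ) :
    Complex.sin (Real.pi * s) = Complex.cos (Real.pi * (s - 1 / 2)) := by
  rw [← Complex.cos_sub_pi_div_two]
  congr 1
  ring

/-- The exponential factor of the second term of `I`, common to both sectors. -/
theorem stokes_factor_ne_zero {α τ : ℂ} (hτ : StokesSign α τ) (η : ℂ) :
    τ * Complex.I * Complex.exp (τ * Complex.I * Real.pi * η) ≠ 0 := by
  refine mul_ne_zero (mul_ne_zero ?_ Complex.I_ne_zero) (Complex.exp_ne_zero _)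
  rcases hτ with ⟨rfl, _⟩ | ⟨rfl, _⟩ <;> norm_num

theorem exists_stokesSign (α : ℂ) : ∃ τ, StokesSign α τ := by
  rcases lt_or_ge (-(Real.pi / 2)) α.arg with h | h
  · exact ⟨1, Or.inl ⟨rfl, h⟩⟩
  · exact ⟨-1, Or.inr ⟨rfl, h⟩⟩

section

variable {ω α : ℂ}

theorem slitPlane_or_neg (hα : α ≠ 0) :
    α ∈ Complex.slitPlane ∨ (α.re < 0 ∧ α.im = 0 ∧ α.arg = Real.pi) := by
  by_cases h : α ∈ Complex.slitPlane
  · exact Or.inl h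
  · right
    have h1 : α.arg = Real.pi := by
      by_contra h2
      exact h (Complex.mem_slitPlane_iff_arg.2 ⟨h2, hα⟩)
    exact ⟨(Complex.arg_eq_pi_iff.1 h1).1, (Complex.arg_eq_pi_iff.1 h1).2, h1⟩

theorem StokesSign.eq_one {τ : ℂ} (hτ : StokesSign α τ) (h : -(Real.pi / 2) < α.arg) : τ = 1 := by
  rcases hτ with ⟨rfl, _⟩ | ⟨_, h1⟩
  · rfl
  · exact absurd h (not_lt.2 h1)

theorem twoTermAsymp_besselI (h0 : ω.arg ≠ 0) (hα0 : α ≠ 0) (hne : α.arg ≠ ω.arg) (η : ℂ) (m : ℕ)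
    {τ : ℂ} (hτ : StokesSign α τ) :
    TwoTermAsymp m α (Complex.exp (-(η * branchShift ω α)) * amplitude α)
      (Complex.exp (-(η * branchShift ω α)) * ((-1) ^ m * (amplitude α *
        (τ * Complex.I * Complex.exp (τ * Complex.I * Real.pi * η)))))
      (scaledDeriv (besselI ω η) m α) := by
  rcases slitPlane_or_neg hα0 with hs | ⟨hre, him, harg⟩
  · have hL := localBranch_of_mem_slitPlane h0 hne hs
    refine ((twoTermAsymp_principalBesselI η m hs hτ).const_mul _).congr' ?_
    filter_upwards [eventually_gt_atTop 0] with y hy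
    rw [hL.scaledDeriv_besselI η m hy, one_pow, one_mul, one_mul]
    rfl
  · obtain rfl := hτ.eq_one (by rw [harg]; linarith [Real.pi_pos])
    have hL := localBranch_of_neg h0 (fun h => hne (harg.trans h.symm)) hre him
    -- At -α > 0 only the growing exponential is known, and after reflection it is e^{-αy}; the
    -- coefficient of e^{αy} is free and is set to the value in the statement.
    have h1 := ((twoTermAsymp_principalBesselI_of_re_pos η m (α := -α)
      (by simpa using hre)).neg.const_mul (Complex.exp (-(η * (Real.pi * Complex.I * sgnArg ω))) *
        (-1) ^ m)).change_left (by simpa using hre)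
        (Complex.exp (-(η * branchShift ω α)) * amplitude α)
    rw [neg_neg] at h1
    have hB : Complex.exp (-(η * (Real.pi * Complex.I * sgnArg ω))) * (-1) ^ m * amplitude (-α) =
        Complex.exp (-(η * branchShift ω α)) * ((-1) ^ m * (amplitude α *
        (1 * Complex.I * Complex.exp (1 * Complex.I * Real.pi * η)))) := by
      rw [amplitude_neg hre him]
      have h2 : Complex.exp (-(η * (Real.pi * Complex.I * sgnArg ω))) =
          Complex.exp (-(η * branchShift ω α)) * Complex.exp (1 * Complex.I * Real.pi * η) := by
        rw [← Complex.exp_add]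
        congr 1
        rcases lt_or_gt_of_ne h0 with h | h
        · rw [branchShift, if_pos ((mem_Omega_iff_of_neg h α).2 (by rw [harg]; linarith
            [Real.pi_pos])), sgnArg_of_neg h]
          ring
        · rw [branchShift, if_neg (fun hm => by
            have := (mem_Omega_iff_of_pos h α).1 hm
            rw [harg] at this
            exact absurd (Complex.arg_le_pi ω) (not_le.2 this)), sgnArg_of_pos h]
          ring
      rw [h2]
      ring
    rw [hB] at h1
    refine h1.congr' ?_
    filter_upwards [eventually_gt_atTop 0] with y hy
    rw [hL.scaledDeriv_besselI η m hy, neg_one_mul, mul_assoc]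

theorem continuous_besselK_multiplier (σ : ℂ) :
    Continuous fun ξ : ℂ => 2 * Real.pi * Complex.I * σ * Complex.cos (Real.pi * ξ) := by
  fun_prop

theorem sgnArg_eq_or (h0 : ω.arg ≠ 0) : sgnArg ω = 1 ∨ sgnArg ω = -1 := by
  rcases lt_or_gt_of_ne h0 with h | h
  · exact Or.inr (sgnArg_of_neg h)
  · exact Or.inl (sgnArg_of_pos h)

/-- Full turn κ = 2πiσ: the double-angle formula cancels the sine, which leaves a multiplier that is
entire in ξ. -/
theorem besselK_multiplier_mul_sin {σ : ℂ} (hσ : σ = 1 ∨ σ = -1) (ξ : ℂ) :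
    2 * Real.pi * Complex.I * σ * Complex.cos (Real.pi * ξ) * Complex.sin (ξ * Real.pi) =
      Real.pi / 2 * (Complex.exp (ξ * (2 * Real.pi * Complex.I * σ)) -
        Complex.exp (-(ξ * (2 * Real.pi * Complex.I * σ)))) := by
  have h1 : Complex.exp (ξ * (2 * Real.pi * Complex.I)) -
      Complex.exp (-(ξ * (2 * Real.pi * Complex.I))) =
      2 * Complex.I * (2 * Complex.sin (ξ * Real.pi) * Complex.cos (ξ * Real.pi)) := by
    rw [← Complex.sin_two_mul, Complex.sin,
      show 2 * (ξ * Real.pi) * Complex.I = ξ * (2 * Real.pi * Complex.I) by ring,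
      show -(2 * (ξ * (Real.pi : ℂ))) * Complex.I = -(ξ * (2 * Real.pi * Complex.I)) by ring]
    linear_combination (Complex.exp (ξ * (2 * Real.pi * Complex.I)) -
      Complex.exp (-(ξ * (2 * Real.pi * Complex.I)))) * Complex.I_sq
  rw [mul_comm (Real.pi : ℂ) ξ]
  rcases hσ with rfl | rfl
  · rw [mul_one]
    linear_combination -(Real.pi / 2 : ℂ) * h1
  · rw [show ξ * (2 * Real.pi * Complex.I * -1) = -(ξ * (2 * Real.pi * Complex.I)) by ring, neg_neg]
    linear_combination (Real.pi / 2 : ℂ) * h1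

/-- Half turn κ = πiσ, as it occurs on the negative axis: the multiplier is the constant πiσ. -/
theorem besselK_half_multiplier_mul_sin {σ : ℂ} (hσ : σ = 1 ∨ σ = -1) (ξ : ℂ) :
    Real.pi * Complex.I * σ * Complex.sin (ξ * Real.pi) =
      Real.pi / 2 * (Complex.exp (ξ * (Real.pi * Complex.I * σ)) -
        Complex.exp (-(ξ * (Real.pi * Complex.I * σ)))) := by
  rw [Complex.sin, show -(ξ * (Real.pi : ℂ)) * Complex.I = -(ξ * (Real.pi * Complex.I)) by ring,
    mul_assoc ξ (Real.pi : ℂ)]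
  rcases hσ with rfl | rfl
  · rw [mul_one]
    linear_combination (Real.pi / 2 : ℂ) * (Complex.exp (-(ξ * (Real.pi * Complex.I))) -
      Complex.exp (ξ * (Real.pi * Complex.I))) * Complex.I_sq
  · rw [show ξ * (Real.pi * Complex.I * -1) = -(ξ * (Real.pi * Complex.I)) by ring, neg_neg]
    linear_combination -(Real.pi / 2 : ℂ) * (Complex.exp (-(ξ * (Real.pi * Complex.I))) -
      Complex.exp (ξ * (Real.pi * Complex.I))) * Complex.I_sq

/-- On the negative real axis `K` is dominated by its growing part. -/
theorem twoTermAsymp_besselK_of_neg (h0 : ω.arg ≠ 0) (hne : α.arg ≠ ω.arg) (hre : α.re < 0)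
    (him : α.im = 0) (harg : α.arg = Real.pi) (η : ℂ) (m : ℕ) (A : ℂ) :
    TwoTermAsymp m α A (-((-1) ^ m * (Real.pi * amplitude α) * sgnArg ω))
      (scaledDeriv (besselK ω η) m α) := by
  have hL := localBranch_of_neg h0 (fun h => hne (harg.trans h.symm)) hre him
  have hnre : 0 < (-α).re := by simpa using hre
  have h1 := ((twoTermAsymp_principalBesselK η m (α := -α) (by simpa using hL.2.1)).const_mul
    (Complex.exp (-(η * (Real.pi * Complex.I * sgnArg ω))))).add
    ((twoTermAsymp_principalBesselI_of_re_pos (-η) m hnre).const_mul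
      (Real.pi * Complex.I * sgnArg ω))
  have h2 := ((h1.const_mul ((-1) ^ m)).change_right hnre A).neg
  rw [neg_neg, amplitude_neg hre him] at h2
  have e : (-1) ^ m * (Complex.exp (-(η * (Real.pi * Complex.I * sgnArg ω))) * 0 +
      Real.pi * Complex.I * sgnArg ω * (Complex.I * amplitude α)) =
      -((-1) ^ m * (Real.pi * amplitude α) * sgnArg ω) := by
    linear_combination ((-1) ^ m * Real.pi * sgnArg ω * amplitude α) * Complex.I_sq
  rw [e] at h2
  refine h2.congr' ?_
  filter_upwards [eventually_gt_atTop 0] with y hy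
  rw [hL.scaledDeriv_besselK (M := fun _ => Real.pi * Complex.I * sgnArg ω) continuous_const
    (besselK_half_multiplier_mul_sin (sgnArg_eq_or h0)) η m hy, neg_one_mul]

/-- In the slit plane K is the principal branch here. On the negative axis e^{-αy} is the dominant
exponential, so the two-term estimate is already relative to it; Ω_ω contains π only for σ = -1,
which gives the right sign. -/
theorem isLittleO_besselK_of_mem_Omega (h0 : ω.arg ≠ 0) (hα0 : α ≠ 0) (hne : α.arg ≠ ω.arg)
    (hΩ : α.arg ∈ Omega ω) (η : ℂ) (m : ℕ) :
    (fun y => scaledDeriv (besselK ω η) m α y -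
      (-1) ^ m * (Real.pi * amplitude α) * expTerm m (-α) y) =o[atTop] expTerm m (-α) := by
  rcases slitPlane_or_neg hα0 with hs | ⟨hre, him, harg⟩
  · have hL := localBranch_of_mem_slitPlane h0 hne hs
    rw [if_pos hΩ] at hL
    refine (isLittleO_principalBesselK η m hs).congr' ?_ EventuallyEq.rfl
    filter_upwards [eventually_gt_atTop 0] with y hy
    rw [hL.scaledDeriv_besselK (M := fun _ => 0) continuous_const (by simp) η m hy]
    simp
  · have hneg : ω.arg < 0 := by
      rcases lt_or_gt_of_ne h0 with h | h
      · exact h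
      · have := (mem_Omega_iff_of_pos h α).1 hΩ
        rw [harg] at this
        exact absurd (Complex.arg_le_pi ω) (not_le.2 this)
    have h1 := twoTermAsymp_besselK_of_neg h0 hne hre him harg η m 0
    rw [sgnArg_of_neg hneg] at h1
    have h2 := IsLittleO.trans_isBigO h1 (domTerm_isBigO_expTerm m (c := -α)
      (by rw [Complex.neg_re, abs_of_neg hre]))
    exact h2.congr_left fun y => by ring

/-- The coefficient of `e^{-αy}` in `K` off the principal sector, apart from `(-1)^m / √(2πα)`. -/
theorem stokes_sum_eq_neg_pi {σ τ : ℂ} (h : σ = τ) (hτ : τ = 1 ∨ τ = -1) (η : ℂ) :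
    Complex.exp (-(η * (2 * Real.pi * Complex.I * σ))) * Real.pi +
      2 * Real.pi * Complex.I * σ * Complex.cos (Real.pi * η) *
        (τ * Complex.I * Complex.exp (τ * Complex.I * Real.pi * -η)) = -Real.pi := by
  subst h
  set u := Complex.exp (Real.pi * η * Complex.I) with hu
  set v := Complex.exp (-(Real.pi * η) * Complex.I) with hv
  have huv : u * v = 1 := by
    rw [hu, hv, ← Complex.exp_add, show (Real.pi : ℂ) * η * Complex.I +
      -(Real.pi * η) * Complex.I = 0 by ring, Complex.exp_zero]
  have hcos : Complex.cos (Real.pi * η) = (u + v) / 2 := by rw [Complex.cos]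
  rw [hcos]
  -- With u, v = e^{±iπη} the sum for τ = 1 is π(v² - (u+v)v) = -πuv, and τ = -1 exchanges u and v.
  rcases hτ with rfl | rfl
  · have e1 : Complex.exp (-(η * (2 * Real.pi * Complex.I * 1))) = v * v := by
      rw [hv, ← Complex.exp_add]
      congr 1
      ring
    have e2 : Complex.exp (1 * Complex.I * Real.pi * -η) = v := by
      rw [hv]
      congr 1
      ring
    rw [e1, e2]
    linear_combination (Real.pi * (u + v) * v) * Complex.I_sq - Real.pi * huv
  · have e1 : Complex.exp (-(η * (2 * Real.pi * Complex.I * -1))) = u * u := by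
      rw [hu, ← Complex.exp_add]
      congr 1
      ring
    have e2 : Complex.exp (-1 * Complex.I * Real.pi * -η) = u := by
      rw [hu]
      congr 1
      ring
    rw [e1, e2]
    linear_combination (Real.pi * (u + v) * u) * Complex.I_sq - Real.pi * huv

theorem twoTermAsymp_besselK_of_notMem_Omega (h0 : ω.arg ≠ 0) (hα0 : α ≠ 0) (hne : α.arg ≠ ω.arg)
    (hΩ : α.arg ∉ Omega ω) (η : ℂ) (m : ℕ) {τ : ℂ} (hτ : StokesSign α τ) :
    TwoTermAsymp m α (2 * Real.pi * Complex.I * sgnArg ω * Complex.cos (Real.pi * η) * amplitude α)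
      ((-1) ^ m * amplitude α * (Complex.exp (-(η * (2 * Real.pi * Complex.I * sgnArg ω))) * Real.pi +
        2 * Real.pi * Complex.I * sgnArg ω * Complex.cos (Real.pi * η) *
          (τ * Complex.I * Complex.exp (τ * Complex.I * Real.pi * -η))))
      (scaledDeriv (besselK ω η) m α) := by
  rcases slitPlane_or_neg hα0 with hs | ⟨hre, him, harg⟩
  · have hL := localBranch_of_mem_slitPlane h0 hne hs
    rw [if_neg hΩ] at hL
    have h1 := ((twoTermAsymp_principalBesselK η m hs).const_mul
      (Complex.exp (-(η * (2 * Real.pi * Complex.I * sgnArg ω))))).add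
      ((twoTermAsymp_principalBesselI (-η) m hs hτ).const_mul
        (2 * Real.pi * Complex.I * sgnArg ω * Complex.cos (Real.pi * η)))
    convert h1.congr' ?_ using 1
    · ring
    · ring
    · filter_upwards [eventually_gt_atTop 0] with y hy
      rw [hL.scaledDeriv_besselK (continuous_besselK_multiplier _)
        (besselK_multiplier_mul_sin (sgnArg_eq_or h0)) η m hy]
      simp
  · obtain rfl := hτ.eq_one (by rw [harg]; linarith [Real.pi_pos])
    have hpos : 0 < ω.arg := by
      rcases lt_or_gt_of_ne h0 with h | h
      · exact absurd ((mem_Omega_iff_of_neg h α).2 (by rw [harg]; linarith [Real.pi_pos])) hΩ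
      · exact h
    rw [stokes_sum_eq_neg_pi (sgnArg_of_pos hpos) (Or.inl rfl)]
    convert twoTermAsymp_besselK_of_neg h0 hne hre him harg η m _ using 1
    rw [sgnArg_of_pos hpos]
    ring

/-- The multiplier of I vanishes, so K is a constant times its principal branch and the estimate
relative to e^{-αy} survives off the principal sector. -/
theorem isLittleO_besselK_of_cos_eq_zero (h0 : ω.arg ≠ 0) (hne : α.arg ≠ ω.arg)
    (hΩ : α.arg ∉ Omega ω) (hs : α ∈ Complex.slitPlane) {η : ℂ} (m : ℕ)
    (hcos : Complex.cos (Real.pi * η) = 0) :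
    (fun y => scaledDeriv (besselK ω η) m α y -
      Complex.exp (-(η * (2 * Real.pi * Complex.I * sgnArg ω))) *
        ((-1) ^ m * (Real.pi * amplitude α)) * expTerm m (-α) y) =o[atTop] expTerm m (-α) := by
  have hL := localBranch_of_mem_slitPlane h0 hne hs
  rw [if_neg hΩ] at hL
  refine ((isLittleO_principalBesselK η m hs).const_mul_left
    (Complex.exp (-(η * (2 * Real.pi * Complex.I * sgnArg ω))))).congr' ?_ EventuallyEq.rfl
  filter_upwards [eventually_gt_atTop 0] with y hy
  rw [hL.scaledDeriv_besselK (continuous_besselK_multiplier _)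
    (besselK_multiplier_mul_sin (sgnArg_eq_or h0)) η m hy, hcos]
  simp only [one_pow, one_mul, mul_zero, zero_mul, add_zero]
  ring

end

/-! ### The functions 𝐈 and 𝐊 -/

section

variable {ω α : ℂ}

theorem boldI_eq (ω : ℂ) (m : ℕ) (α : ℂ) (y : ℝ) (s : ℂ) :
    boldI ω m α y s = (Complex.I ^ m)⁻¹ * scaledDeriv (besselI ω (s - 1 / 2)) m α y := by
  rw [boldI, scaledDeriv]
  ring

theorem boldK_eq (ω : ℂ) (m : ℕ) (α : ℂ) (y : ℝ) (s : ℂ) :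
    boldK ω m α y s = (Complex.I ^ m)⁻¹ * scaledDeriv (besselK ω (s - 1 / 2)) m α y := by
  rw [boldK, scaledDeriv]
  ring

theorem inv_I_pow_mul_neg_one_pow (m : ℕ) : (Complex.I ^ m)⁻¹ * (-1) ^ m = Complex.I ^ m := by
  rw [← inv_pow, ← mul_pow, Complex.inv_I, neg_mul_neg, mul_one]

theorem twoTermAsymp_boldI (h0 : ω.arg ≠ 0) (hα0 : α ≠ 0) (hne : α.arg ≠ ω.arg) (s : ℂ) (m : ℕ)
    {τ k e : ℂ} (hτ : StokesSign α τ)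
    (hk : k = Complex.exp (-((s - 1 / 2) * branchShift ω α)))
    (he : e = τ * Complex.I * Complex.exp (τ * Complex.I * Real.pi * (s - 1 / 2))) :
    TwoTermAsymp m α ((Complex.I ^ m)⁻¹ * invSqrt (2 * (Real.pi : ℂ) * α) * k)
      ((Complex.I ^ m)⁻¹ * invSqrt (2 * (Real.pi : ℂ) * α) * k * ((-1) ^ m * e))
      fun y => boldI ω m α y s := by
  have h := (twoTermAsymp_besselI h0 hα0 hne (s - 1 / 2) m hτ).const_mul (Complex.I ^ m)⁻¹
  rw [← hk, ← he] at h
  rw [invSqrt_two_pi_mul hα0]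
  convert h using 1
  · ring
  · ring
  · funext y
    exact boldI_eq ω m α y s

/-- Neither coefficient vanishes, so the error can be charged to e^{αy} when Re α ≥ 0 and to e^{-αy}
when Re α < 0. -/
theorem asympTerms_boldI (h0 : ω.arg ≠ 0) (hα0 : α ≠ 0) (hne : α.arg ≠ ω.arg) (s : ℂ) (m : ℕ)
    {τ k e : ℂ} (hτ : StokesSign α τ)
    (hk : k = Complex.exp (-((s - 1 / 2) * branchShift ω α)))
    (he : e = τ * Complex.I * Complex.exp (τ * Complex.I * Real.pi * (s - 1 / 2))) :
    AsympTerms α (fun y => boldI ω m α y s)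
      ![fun y => (y : ℂ) ^ m / Complex.I ^ m * invSqrt (2 * (Real.pi : ℂ) * α) * k *
          Complex.exp (α * (y : ℂ)),
        fun y => (y : ℂ) ^ m / Complex.I ^ m * invSqrt (2 * (Real.pi : ℂ) * α) * k *
          ((-1) ^ m * e * Complex.exp (-α * (y : ℂ)))] := by
  have h := twoTermAsymp_boldI h0 hα0 hne s m hτ hk he
  have hA : (Complex.I ^ m)⁻¹ * invSqrt (2 * (Real.pi : ℂ) * α) * k ≠ 0 :=
    mul_ne_zero (mul_ne_zero (inv_ne_zero (pow_ne_zero _ Complex.I_ne_zero)) (Complex.exp_ne_zero _))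
      (hk ▸ Complex.exp_ne_zero _)
  have hB : (Complex.I ^ m)⁻¹ * invSqrt (2 * (Real.pi : ℂ) * α) * k * ((-1) ^ m * e) ≠ 0 :=
    mul_ne_zero hA (mul_ne_zero (pow_ne_zero _ (by norm_num)) (he ▸ stokes_factor_ne_zero hτ _))
  rcases le_or_gt 0 α.re with hre | hre
  · refine h.asympTerms (fun y => ?_) 0 ?_ (fun _ => hA) (fun _ => hB)
    · simp only [Fin.sum_univ_two, Matrix.cons_val_zero, Matrix.cons_val_one, expTerm]
      ring
    · refine (domTerm_isBigO_const_mul_expTerm m (abs_of_nonneg hre).le hA).congr_right fun y => ?_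
      simp only [Matrix.cons_val_zero, expTerm]
      ring
  · refine h.asympTerms (fun y => ?_) 1 ?_ (fun _ => hA) (fun _ => hB)
    · simp only [Fin.sum_univ_two, Matrix.cons_val_zero, Matrix.cons_val_one, expTerm]
      ring
    · refine (domTerm_isBigO_const_mul_expTerm m (c := -α)
        (by rw [Complex.neg_re, abs_of_neg hre]) hB).congr_right fun y => ?_
      simp only [Matrix.cons_val_one, Matrix.cons_val_zero, expTerm]
      ring

theorem isEquivalent_boldI_of_re_pos (h0 : ω.arg ≠ 0) (hα0 : α ≠ 0) (hne : α.arg ≠ ω.arg)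
    (hΩ : α.arg ∈ Omega ω) (hre : 0 < α.re) (s : ℂ) (m : ℕ) :
    (fun y : ℝ => boldI ω m α y s) ~[atTop] fun y : ℝ =>
      (y : ℂ) ^ m / Complex.I ^ m * invSqrt (2 * (Real.pi : ℂ) * α) *
        Complex.exp (α * (y : ℂ)) := by
  obtain ⟨τ, hτ⟩ := exists_stokesSign α
  have h := ((twoTermAsymp_boldI h0 hα0 hne s m (k := 1) hτ
    (by rw [branchShift, if_pos hΩ, mul_zero, neg_zero, Complex.exp_zero]) rfl).change_right hre
    0).isEquivalent hre.ne' (fun _ => mul_ne_zero (mul_ne_zero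
      (inv_ne_zero (pow_ne_zero _ Complex.I_ne_zero)) (Complex.exp_ne_zero _)) one_ne_zero)
    (fun h => absurd hre h.not_gt)
  refine h.congr_right (Eventually.of_forall fun y => ?_)
  simp only [expTerm]
  ring

theorem isTheta_boldI (h0 : ω.arg ≠ 0) (hα0 : α ≠ 0) (hne : α.arg ≠ ω.arg) (hre : α.re ≠ 0)
    (s : ℂ) (m : ℕ) : (fun y : ℝ => ‖boldI ω m α y s‖) =Θ[atTop] domTerm m α := by
  obtain ⟨τ, hτ⟩ := exists_stokesSign α
  have hA : (Complex.I ^ m)⁻¹ * invSqrt (2 * (Real.pi : ℂ) * α) *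
      Complex.exp (-((s - 1 / 2) * branchShift ω α)) ≠ 0 :=
    mul_ne_zero (mul_ne_zero (inv_ne_zero (pow_ne_zero _ Complex.I_ne_zero)) (Complex.exp_ne_zero _))
      (Complex.exp_ne_zero _)
  exact (twoTermAsymp_boldI h0 hα0 hne s m hτ rfl rfl).isTheta hre (fun _ => hA) (fun _ =>
    mul_ne_zero hA (mul_ne_zero (pow_ne_zero _ (by norm_num)) (stokes_factor_ne_zero hτ _)))

theorem isEquivalent_boldK (h0 : ω.arg ≠ 0) (hα0 : α ≠ 0) (hne : α.arg ≠ ω.arg)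
    (hΩ : α.arg ∈ Omega ω) (s : ℂ) (m : ℕ) :
    (fun y : ℝ => boldK ω m α y s) ~[atTop] fun y : ℝ =>
      ((Real.sqrt Real.pi : ℝ) : ℂ) * invSqrt (2 * α) * Complex.I ^ m * (y : ℂ) ^ m *
        Complex.exp (-α * (y : ℂ)) := by
  have hc : Real.pi * amplitude α * Complex.I ^ m ≠ 0 :=
    mul_ne_zero (mul_ne_zero (Complex.ofReal_ne_zero.2 Real.pi_ne_zero) (amplitude_ne_zero α))
      (pow_ne_zero _ Complex.I_ne_zero)
  have h := ((isLittleO_besselK_of_mem_Omega h0 hα0 hne hΩ (s - 1 / 2) m).const_mul_left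
    (Complex.I ^ m)⁻¹).trans_isBigO (isBigO_self_const_mul hc (expTerm m (-α)) atTop)
  rw [sqrt_pi_mul_invSqrt_two_mul hα0]
  refine IsLittleO.congr h (fun y => ?_) (fun y => ?_)
  · simp only [Pi.sub_apply, boldK_eq, expTerm]
    linear_combination (-(Real.pi * amplitude α * (y : ℂ) ^ m * Complex.exp (-α * y))) *
      inv_I_pow_mul_neg_one_pow m
  · simp only [expTerm]
    ring

theorem isTheta_boldK_of_mem_Omega (h0 : ω.arg ≠ 0) (hα0 : α ≠ 0) (hne : α.arg ≠ ω.arg)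
    (hΩ : α.arg ∈ Omega ω) (s : ℂ) (m : ℕ) :
    (fun y : ℝ => ‖boldK ω m α y s‖) =Θ[atTop] fun y : ℝ => y ^ m * Real.exp (-α.re * y) := by
  have hc : ((Real.sqrt Real.pi : ℝ) : ℂ) * invSqrt (2 * α) * Complex.I ^ m ≠ 0 :=
    mul_ne_zero (mul_ne_zero (Complex.ofReal_ne_zero.2 (by positivity)) (Complex.exp_ne_zero _))
      (pow_ne_zero _ Complex.I_ne_zero)
  have h1 : (fun y : ℝ => boldK ω m α y s) =Θ[atTop] expTerm m (-α) :=
    ((isEquivalent_boldK h0 hα0 hne hΩ s m).isTheta.trans_eventuallyEq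
      (Eventually.of_forall fun y => mul_assoc _ _ _)).trans
      ((isTheta_refl (expTerm m (-α)) atTop).const_mul_left hc)
  refine (h1.norm_left.norm_right).trans_eventuallyEq ?_
  filter_upwards [eventually_ge_atTop 0] with y hy
  rw [norm_expTerm m _ hy, Complex.neg_re]

theorem twoTermAsymp_boldK (h0 : ω.arg ≠ 0) (hα0 : α ≠ 0) (hne : α.arg ≠ ω.arg)
    (hΩ : α.arg ∉ Omega ω) (s : ℂ) (m : ℕ) {τ : ℂ} (hτ : StokesSign α τ) :
    TwoTermAsymp m α ((Complex.I ^ m)⁻¹ * (2 * Real.pi * Complex.I * sgnArg ω *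
        Complex.sin (Real.pi * s) * amplitude α))
      (Complex.I ^ m * amplitude α *
        (Complex.exp (-((s - 1 / 2) * (2 * Real.pi * Complex.I * sgnArg ω))) * Real.pi +
        2 * Real.pi * Complex.I * sgnArg ω * Complex.sin (Real.pi * s) *
          (τ * Complex.I * Complex.exp (τ * Complex.I * Real.pi * -(s - 1 / 2)))))
      fun y => boldK ω m α y s := by
  have h := (twoTermAsymp_besselK_of_notMem_Omega h0 hα0 hne hΩ (s - 1 / 2) m hτ).const_mul
    (Complex.I ^ m)⁻¹
  rw [mul_assoc ((-1) ^ m) (amplitude α), ← mul_assoc (Complex.I ^ m)⁻¹ ((-1) ^ m),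
    inv_I_pow_mul_neg_one_pow, ← mul_assoc (Complex.I ^ m), ← sin_pi_mul_eq_cos_sub_half] at h
  exact h.congr' (Eventually.of_forall fun y => (boldK_eq ω m α y s).symm)

theorem boldK_coeff_ne_zero (h0 : ω.arg ≠ 0) (α : ℂ) {s : ℂ} (hs : Complex.sin (Real.pi * s) ≠ 0)
    (m : ℕ) : (Complex.I ^ m)⁻¹ * (2 * Real.pi * Complex.I * sgnArg ω *
      Complex.sin (Real.pi * s) * amplitude α) ≠ 0 := by
  have hσ : sgnArg ω ≠ 0 := by
    rcases sgnArg_eq_or h0 with h | h <;> rw [h] <;> norm_num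
  exact mul_ne_zero (inv_ne_zero (pow_ne_zero _ Complex.I_ne_zero)) (mul_ne_zero (mul_ne_zero
    (mul_ne_zero Complex.two_pi_I_ne_zero hσ) hs) (amplitude_ne_zero α))

theorem isTheta_boldK_of_notMem_Omega (h0 : ω.arg ≠ 0) (hα0 : α ≠ 0) (hne : α.arg ≠ ω.arg)
    (hΩ : α.arg ∉ Omega ω) (hre : 0 < α.re) {s : ℂ} (hs : Complex.sin (Real.pi * s) ≠ 0) (m : ℕ) :
    (fun y : ℝ => ‖boldK ω m α y s‖) =Θ[atTop] fun y : ℝ => y ^ m * Real.exp (α.re * y) := by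
  obtain ⟨τ, hτ⟩ := exists_stokesSign α
  have h := (twoTermAsymp_boldK h0 hα0 hne hΩ s m hτ).isTheta hre.ne'
    (fun _ => boldK_coeff_ne_zero h0 α hs m) (fun h => absurd hre h.not_gt)
  unfold domTerm at h
  rwa [abs_of_pos hre] at h

/-- Off the principal sector, the branch cut and `α` with `Re α < 0` lie in the same half plane. -/
theorem sgnArg_eq_stokesSign (h0 : ω.arg ≠ 0) (hΩ : α.arg ∉ Omega ω) (hre : α.re < 0) {τ : ℂ}
    (hτ : StokesSign α τ) : sgnArg ω = τ := by
  rcases lt_or_gt_of_ne h0 with h | h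
  · rw [mem_Omega_iff_of_neg h, not_lt] at hΩ
    rcases hτ with ⟨_, h1⟩ | ⟨rfl, _⟩
    · rcases Complex.neg_pi_div_two_lt_arg_iff.1 h1 with h2 | h2
      · exact absurd h2 hre.not_gt
      · exact absurd (Complex.arg_nonneg_iff.2 h2) (by linarith)
    · exact sgnArg_of_neg h
  · rw [mem_Omega_iff_of_pos h, not_lt] at hΩ
    rw [hτ.eq_one (by linarith [Real.pi_pos]), sgnArg_of_pos h]

theorem neg_exp_sgnArg (h0 : ω.arg ≠ 0) (s : ℂ) :
    -Complex.exp (-2 * (Real.pi : ℂ) * Complex.I * sgnArg ω * s) =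
      Complex.exp (-((s - 1 / 2) * (2 * Real.pi * Complex.I * sgnArg ω))) := by
  rcases sgnArg_eq_or h0 with h | h
  · rw [h, show -((s - 1 / 2) * (2 * Real.pi * Complex.I * 1)) =
      -2 * (Real.pi : ℂ) * Complex.I * 1 * s + Real.pi * Complex.I by ring, Complex.exp_add,
      Complex.exp_pi_mul_I]
    ring
  · rw [h, show -((s - 1 / 2) * (2 * Real.pi * Complex.I * -1)) =
      -2 * (Real.pi : ℂ) * Complex.I * -1 * s - Real.pi * Complex.I by ring, Complex.exp_sub,
      Complex.exp_pi_mul_I]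
    ring

/-- Two of the three terms share the exponential e^{-αy}, so for Re α < 0 the quotient statement
needs their combined coefficient to be nonzero. There σ = τ, and the sum collapses to -π times a
nonzero amplitude. -/
theorem asympTerms_boldK (h0 : ω.arg ≠ 0) (hα0 : α ≠ 0) (hne : α.arg ≠ ω.arg)
    (hΩ : α.arg ∉ Omega ω) (s : ℂ) (m : ℕ) {τ e : ℂ} (hτ : StokesSign α τ)
    (he : -e = τ * Complex.I * Complex.exp (τ * Complex.I * Real.pi * -(s - 1 / 2))) :
    AsympTerms α (fun y => boldK ω m α y s)
      ![fun y => -Complex.exp (-2 * (Real.pi : ℂ) * Complex.I * sgnArg ω * s) *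
          (((Real.sqrt Real.pi : ℝ) : ℂ) * invSqrt (2 * α)) * Complex.I ^ m * (y : ℂ) ^ m *
          Complex.exp (-α * (y : ℂ)),
        fun y => ((Real.sqrt (2 * Real.pi) : ℝ) : ℂ) / Complex.I ^ ((m : ℤ) - 1) * invSqrt α *
          sgnArg ω * Complex.sin ((Real.pi : ℂ) * s) * (y : ℂ) ^ m *
          Complex.exp (α * (y : ℂ)),
        fun y => ((Real.sqrt (2 * Real.pi) : ℝ) : ℂ) / Complex.I ^ ((m : ℤ) - 1) * invSqrt α *
          sgnArg ω * Complex.sin ((Real.pi : ℂ) * s) * (y : ℂ) ^ m *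
          (-((-1) ^ m * e * Complex.exp (-α * (y : ℂ))))] := by
  have h := twoTermAsymp_boldK h0 hα0 hne hΩ s m hτ
  rw [← he] at h
  have hz : ((Real.sqrt (2 * Real.pi) : ℝ) : ℂ) / Complex.I ^ ((m : ℤ) - 1) * invSqrt α =
      (Complex.I ^ m)⁻¹ * (2 * Real.pi * Complex.I * amplitude α) := by
    have h1 := sqrt_two_pi_mul_invSqrt α
    rw [zpow_sub₀ Complex.I_ne_zero, zpow_natCast, zpow_one, div_div_eq_mul_div]
    linear_combination (Complex.I ^ m)⁻¹ * Complex.I * h1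
  rw [sqrt_pi_mul_invSqrt_two_mul hα0, neg_exp_sgnArg h0, hz]
  set E := Complex.exp (-((s - 1 / 2) * (2 * Real.pi * Complex.I * sgnArg ω))) with hE
  have hI := inv_I_pow_mul_neg_one_pow m
  have hc : E * (Real.pi * amplitude α) * Complex.I ^ m ≠ 0 :=
    mul_ne_zero (mul_ne_zero (Complex.exp_ne_zero _) (mul_ne_zero
      (Complex.ofReal_ne_zero.2 Real.pi_ne_zero) (amplitude_ne_zero α)))
      (pow_ne_zero _ Complex.I_ne_zero)
  have hB : α.re < 0 → Complex.I ^ m * amplitude α * (E * Real.pi + 2 * Real.pi * Complex.I *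
      sgnArg ω * Complex.sin (Real.pi * s) * -e) ≠ 0 := fun hre => by
    rw [he, sin_pi_mul_eq_cos_sub_half, stokes_sum_eq_neg_pi (sgnArg_eq_stokesSign h0 hΩ hre hτ)
      (hτ.imp And.left And.left)]
    exact mul_ne_zero (mul_ne_zero (pow_ne_zero _ Complex.I_ne_zero) (amplitude_ne_zero α))
      (neg_ne_zero.2 (Complex.ofReal_ne_zero.2 Real.pi_ne_zero))
  have ht : ∀ y : ℝ, E * (Real.pi * amplitude α) * Complex.I ^ m * (y : ℂ) ^ m *
      Complex.exp (-α * (y : ℂ)) +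
      (Complex.I ^ m)⁻¹ * (2 * Real.pi * Complex.I * amplitude α) * sgnArg ω *
        Complex.sin ((Real.pi : ℂ) * s) * (y : ℂ) ^ m * Complex.exp (α * (y : ℂ)) +
      (Complex.I ^ m)⁻¹ * (2 * Real.pi * Complex.I * amplitude α) * sgnArg ω *
        Complex.sin ((Real.pi : ℂ) * s) * (y : ℂ) ^ m *
          (-((-1) ^ m * e * Complex.exp (-α * (y : ℂ)))) =
      (Complex.I ^ m)⁻¹ * (2 * Real.pi * Complex.I * sgnArg ω *
        Complex.sin (Real.pi * s) * amplitude α) * expTerm m α y +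
      Complex.I ^ m * amplitude α * (E * Real.pi + 2 * Real.pi * Complex.I *
        sgnArg ω * Complex.sin (Real.pi * s) * -e) * expTerm m (-α) y := fun y => by
    simp only [expTerm]
    linear_combination (-(2 * Real.pi * Complex.I * amplitude α * sgnArg ω *
      Complex.sin (Real.pi * s) * (y : ℂ) ^ m * e * Complex.exp (-α * y))) * hI
  -- For Re α ≤ 0 the first term, whose coefficient never vanishes, has the dominant size and
  -- carries the error. For Re α > 0 the growing second term does, unless sin(πs) = 0: then both
  -- sine terms are zero and the recessive estimate charges the error to the first.
  rcases le_or_gt α.re 0 with hre | hre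
  · refine h.asympTerms (fun y => ?_) 0 ?_ (fun h1 => absurd h1 hre.not_gt) hB
    · rw [Fin.sum_univ_three]
      exact ht y
    · refine (domTerm_isBigO_const_mul_expTerm m (c := -α)
        (by rw [Complex.neg_re, abs_of_nonpos hre]) hc).congr_right fun y => ?_
      simp only [Matrix.cons_val_zero, expTerm]
      ring
  · by_cases hs : Complex.sin (Real.pi * s) = 0
    · have h1 := ((isLittleO_besselK_of_cos_eq_zero h0 hne hΩ
        (Complex.mem_slitPlane_iff.2 (Or.inl hre)) m (sin_pi_mul_eq_cos_sub_half s ▸ hs)).const_mul_left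
        (Complex.I ^ m)⁻¹).trans_isBigO (isBigO_self_const_mul hc (expTerm m (-α)) atTop)
      have h2 : (fun y => boldK ω m α y s - (E * (Real.pi * amplitude α) * Complex.I ^ m *
          (y : ℂ) ^ m * Complex.exp (-α * (y : ℂ)))) =o[atTop] fun y : ℝ =>
          E * (Real.pi * amplitude α) * Complex.I ^ m * (y : ℂ) ^ m *
            Complex.exp (-α * (y : ℂ)) := by
        refine h1.congr (fun y => ?_) (fun y => ?_)
        · rw [boldK_eq, expTerm, ← hE]
          linear_combination (-(E * Real.pi * amplitude α * (y : ℂ) ^ m *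
            Complex.exp (-α * y))) * hI
        · rw [expTerm]
          ring
      simp only [hs, mul_zero, zero_mul]
      refine asympTerms_of_isLittleO 0 ?_ ?_ fun _ => ?_
      · refine h2.congr_left fun y => ?_
        simp [Fin.sum_univ_three]
      · filter_upwards [eventually_gt_atTop 0] with y hy
        exact mul_ne_zero (mul_ne_zero hc (pow_ne_zero _ (Complex.ofReal_ne_zero.2 hy.ne')))
          (Complex.exp_ne_zero _)
      · refine IsEquivalent.congr_right h2 (Eventually.of_forall fun y => ?_)
        simp [Fin.sum_univ_three]
    · have hA := boldK_coeff_ne_zero h0 α hs m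
      refine h.asympTerms (fun y => ?_) 1 ?_ (fun _ => hA) hB
      · rw [Fin.sum_univ_three]
        exact ht y
      · refine (domTerm_isBigO_const_mul_expTerm m (abs_of_pos hre).le hA).congr_right fun y => ?_
        simp only [Matrix.cons_val_one, Matrix.cons_val_zero, expTerm]
        ring

end

/-! ### The theorem -/

theorem theorem1p4 (ω : ℂ) (hω : ∀ r : ℝ, 0 ≤ r → ω ≠ (r : ℂ))
    (s α : ℂ) (hα : ∀ r : ℝ, 0 ≤ r → α ≠ ω * (r : ℂ)) (m : ℕ) :
    -- asymptotics of `𝐈`, in the four sectors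
    (α.arg ∈ Set.Ioc (-(Real.pi / 2)) Real.pi ∩ Omega ω →
      AsympTerms α (fun y => boldI ω m α y s)
        ![fun y => (y : ℂ) ^ m / Complex.I ^ m * invSqrt (2 * (Real.pi : ℂ) * α) *
            Complex.exp (α * (y : ℂ)),
          fun y => (y : ℂ) ^ m / Complex.I ^ m * invSqrt (2 * (Real.pi : ℂ) * α) *
            ((-1) ^ m * Complex.exp (Complex.I * (Real.pi : ℂ) * s) *
              Complex.exp (-α * (y : ℂ)))]) ∧
    (α.arg ∈ Set.Ioc (-Real.pi) (-(Real.pi / 2)) ∩ Omega ω →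
      AsympTerms α (fun y => boldI ω m α y s)
        ![fun y => (y : ℂ) ^ m / Complex.I ^ m * invSqrt (2 * (Real.pi : ℂ) * α) *
            Complex.exp (α * (y : ℂ)),
          fun y => (y : ℂ) ^ m / Complex.I ^ m * invSqrt (2 * (Real.pi : ℂ) * α) *
            ((-1) ^ m * Complex.exp (-Complex.I * (Real.pi : ℂ) * s) *
              Complex.exp (-α * (y : ℂ)))]) ∧
    (α.arg ∈ Set.Ioc (-(Real.pi / 2)) Real.pi \ Omega ω →
      AsympTerms α (fun y => boldI ω m α y s)
        ![fun y => (y : ℂ) ^ m / Complex.I ^ m * invSqrt (2 * (Real.pi : ℂ) * α) *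
            Complex.exp (-2 * (Real.pi : ℂ) * Complex.I * (s - 1 / 2) * sgnArg ω) *
            Complex.exp (α * (y : ℂ)),
          fun y => (y : ℂ) ^ m / Complex.I ^ m * invSqrt (2 * (Real.pi : ℂ) * α) *
            Complex.exp (-2 * (Real.pi : ℂ) * Complex.I * (s - 1 / 2) * sgnArg ω) *
            ((-1) ^ m * Complex.exp (Complex.I * (Real.pi : ℂ) * s) *
              Complex.exp (-α * (y : ℂ)))]) ∧
    (α.arg ∈ Set.Ioc (-Real.pi) (-(Real.pi / 2)) \ Omega ω →
      AsympTerms α (fun y => boldI ω m α y s)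
        ![fun y => (y : ℂ) ^ m / Complex.I ^ m * invSqrt (2 * (Real.pi : ℂ) * α) *
            Complex.exp (-2 * (Real.pi : ℂ) * Complex.I * (s - 1 / 2) * sgnArg ω) *
            Complex.exp (α * (y : ℂ)),
          fun y => (y : ℂ) ^ m / Complex.I ^ m * invSqrt (2 * (Real.pi : ℂ) * α) *
            Complex.exp (-2 * (Real.pi : ℂ) * Complex.I * (s - 1 / 2) * sgnArg ω) *
            ((-1) ^ m * Complex.exp (-Complex.I * (Real.pi : ℂ) * s) *
              Complex.exp (-α * (y : ℂ)))]) ∧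
    -- asymptotics of `𝐊`, in the three sectors
    (α.arg ∈ Omega ω →
      (fun y : ℝ => boldK ω m α y s) ~[atTop] fun y : ℝ =>
        ((Real.sqrt Real.pi : ℝ) : ℂ) * invSqrt (2 * α) * Complex.I ^ m * (y : ℂ) ^ m *
          Complex.exp (-α * (y : ℂ))) ∧
    (α.arg ∈ Set.Ioc (-(Real.pi / 2)) Real.pi \ Omega ω →
      AsympTerms α (fun y => boldK ω m α y s)
        ![fun y => -Complex.exp (-2 * (Real.pi : ℂ) * Complex.I * sgnArg ω * s) *
            (((Real.sqrt Real.pi : ℝ) : ℂ) * invSqrt (2 * α)) * Complex.I ^ m * (y : ℂ) ^ m *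
            Complex.exp (-α * (y : ℂ)),
          fun y => ((Real.sqrt (2 * Real.pi) : ℝ) : ℂ) / Complex.I ^ ((m : ℤ) - 1) * invSqrt α *
            sgnArg ω * Complex.sin ((Real.pi : ℂ) * s) * (y : ℂ) ^ m *
            Complex.exp (α * (y : ℂ)),
          fun y => ((Real.sqrt (2 * Real.pi) : ℝ) : ℂ) / Complex.I ^ ((m : ℤ) - 1) * invSqrt α *
            sgnArg ω * Complex.sin ((Real.pi : ℂ) * s) * (y : ℂ) ^ m *
            (-((-1) ^ m * Complex.exp (-Complex.I * (Real.pi : ℂ) * s) *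
              Complex.exp (-α * (y : ℂ))))]) ∧
    (α.arg ∈ Set.Ioc (-Real.pi) (-(Real.pi / 2)) \ Omega ω →
      AsympTerms α (fun y => boldK ω m α y s)
        ![fun y => -Complex.exp (-2 * (Real.pi : ℂ) * Complex.I * sgnArg ω * s) *
            (((Real.sqrt Real.pi : ℝ) : ℂ) * invSqrt (2 * α)) * Complex.I ^ m * (y : ℂ) ^ m *
            Complex.exp (-α * (y : ℂ)),
          fun y => ((Real.sqrt (2 * Real.pi) : ℝ) : ℂ) / Complex.I ^ ((m : ℤ) - 1) * invSqrt α *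
            sgnArg ω * Complex.sin ((Real.pi : ℂ) * s) * (y : ℂ) ^ m *
            Complex.exp (α * (y : ℂ)),
          fun y => ((Real.sqrt (2 * Real.pi) : ℝ) : ℂ) / Complex.I ^ ((m : ℤ) - 1) * invSqrt α *
            sgnArg ω * Complex.sin ((Real.pi : ℂ) * s) * (y : ℂ) ^ m *
            (-((-1) ^ m * Complex.exp (Complex.I * (Real.pi : ℂ) * s) *
              Complex.exp (-α * (y : ℂ))))]) ∧
    -- principal sector: exponential growth of `𝐈`, exponential decay of `𝐊` for `Re α > 0`
    (α.arg ∈ Omega ω → 0 < α.re →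
      (fun y : ℝ => boldI ω m α y s) ~[atTop] fun y : ℝ =>
        (y : ℂ) ^ m / Complex.I ^ m * invSqrt (2 * (Real.pi : ℂ) * α) *
          Complex.exp (α * (y : ℂ))) ∧
    (α.re ≠ 0 →
      (fun y : ℝ => ‖boldI ω m α y s‖) =Θ[atTop] fun y : ℝ => y ^ m * Real.exp (|α.re| * y)) ∧
    (α.arg ∈ Omega ω → 0 < α.re →
      (fun y : ℝ => ‖boldK ω m α y s‖) =Θ[atTop] fun y : ℝ => y ^ m * Real.exp (-α.re * y)) ∧
    -- outside of the principal sector `𝐊` picks up an exponentially growing term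
    (α.arg ∉ Omega ω → 0 < α.re → Complex.sin ((Real.pi : ℂ) * s) ≠ 0 →
      (fun y : ℝ => ‖boldK ω m α y s‖) =Θ[atTop] fun y : ℝ => y ^ m * Real.exp (α.re * y)) := by
  have h0 := arg_ne_zero_of_not_nonneg hω
  obtain ⟨hα0, hne⟩ := ne_zero_and_arg_ne hω hα
  have hshift : α.arg ∉ Omega ω →
      Complex.exp (-2 * (Real.pi : ℂ) * Complex.I * (s - 1 / 2) * sgnArg ω) =
        Complex.exp (-((s - 1 / 2) * branchShift ω α)) := fun h => by
    rw [branchShift, if_neg h]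
    congr 1
    ring
  have hshift₀ : α.arg ∈ Omega ω → 1 = Complex.exp (-((s - 1 / 2) * branchShift ω α)) :=
    fun h => by rw [branchShift, if_pos h, mul_zero, neg_zero, Complex.exp_zero]
  -- The prefactors ±i of the Stokes multipliers are absorbed by the index shift η = s - 1/2.
  have hplus : Complex.exp (Complex.I * Real.pi * s) =
      1 * Complex.I * Complex.exp (1 * Complex.I * Real.pi * (s - 1 / 2)) := by
    rw [one_mul]
    exact exp_I_mul_pi_mul s
  have hminus : Complex.exp (-Complex.I * Real.pi * s) =
      -1 * Complex.I * Complex.exp (-1 * Complex.I * Real.pi * (s - 1 / 2)) := by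
    rw [neg_one_mul]
    exact exp_neg_I_mul_pi_mul s
  refine ⟨fun h => ?_, fun h => ?_, fun h => ?_, fun h => ?_, fun h => ?_, fun h => ?_,
    fun h => ?_, fun h hre => ?_, fun hre => ?_, fun h _ => ?_, fun h hre hs => ?_⟩
  · simpa only [mul_one] using
      asympTerms_boldI h0 hα0 hne s m (Or.inl ⟨rfl, h.1.1⟩) (hshift₀ h.2) hplus
  · simpa only [mul_one] using
      asympTerms_boldI h0 hα0 hne s m (Or.inr ⟨rfl, h.1.2⟩) (hshift₀ h.2) hminus
  · exact asympTerms_boldI h0 hα0 hne s m (Or.inl ⟨rfl, h.1.1⟩) (hshift h.2) hplus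
  · exact asympTerms_boldI h0 hα0 hne s m (Or.inr ⟨rfl, h.1.2⟩) (hshift h.2) hminus
  · exact isEquivalent_boldK h0 hα0 hne h s m
  · refine asympTerms_boldK h0 hα0 hne h.2 s m (Or.inl ⟨rfl, h.1.1⟩) ?_
    rw [exp_neg_I_mul_pi_mul, show 1 * Complex.I * Real.pi * -(s - 1 / 2) =
      -Complex.I * Real.pi * (s - 1 / 2) by ring]
    ring
  · refine asympTerms_boldK h0 hα0 hne h.2 s m (Or.inr ⟨rfl, h.1.2⟩) ?_
    rw [exp_I_mul_pi_mul, show -1 * Complex.I * Real.pi * -(s - 1 / 2) =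
      Complex.I * Real.pi * (s - 1 / 2) by ring]
    ring
  · exact isEquivalent_boldI_of_re_pos h0 hα0 hne h hre s m
  · exact isTheta_boldI h0 hα0 hne hre s m
  · exact isTheta_boldK_of_mem_Omega h0 hα0 hne h s m
  · exact isTheta_boldK_of_notMem_Omega h0 hα0 hne h hre hs m
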